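/- Let $k$ be a commutative ring. **Matrix categories.** For $k$-linear categories $\mathcal C,\mathcal D$ let $\mathcal C\boxtimes\mathcal D$ be the $k$-linear category whose objects are pairs $(X,Y)$, with $\mathrm{Hom}((X,Y),(X',Y'))=\mathrm{Hom}(X,X')\otimes_k\mathrm{Hom}(Y,Y')$. Let $\mathrm{Mat}(\mathcal C)$ be the category whose objects are finite families of objects of $\mathcal C$ and whose morphisms are matrices of morphisms of $\mathcal C$. Regard $\mathcal C\subseteq \mathrm{Mat}(\mathcal C)$ as the one-element families, and regard $k$ as a $k$-linear category with one object. Every $k$-linear $F:\mathcal C\to\mathrm{Mat}(\mathcal D)$ extends to a functor $\mathrm{Mat}(\mathcal C)\to\mathrm{Mat}(\mathcal D)$ (concatenation of families), by which such functors are composed. $k$-linear functors $F:\mathcal C\to\mathrm{Mat}(\mathcal C')$ and $G:\mathcal D\to\mathrm{Mat}(\mathcal D')$ induce $F\boxtimes G:\mathcal C\boxtimes\mathcal D\to\mathrm{Mat}(\mathcal C'\boxtimes\mathcal D')$ (all pairs of members of the two families). Let $\tau:\mathcal C\boxtimes\mathcal D\to\mathcal D\boxtimes\mathcal C$ be the transposition.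 In these composites we identify $(\mathcal C\boxtimes\mathcal D)\boxtimes\mathcal E$ with $\mathcal C\boxtimes(\mathcal D\boxtimes\mathcal E)$, and $k\boxtimes\mathcal C$ and $\mathcal C\boxtimes k$ with $\mathcal C$. **Quasitriangular coalgebra categories.** A *coalgebra category* is a $k$-linear category $\mathcal I$ with $k$-linear functors $\Delta:\mathcal I\to\mathrm{Mat}(\mathcal I\boxtimes\mathcal I)$ and $\varepsilon:\mathcal I\to\mathrm{Mat}(k)$ which is coassociative and counital up to coherent natural isomorphism. That is, it comes with natural isomorphisms $$a:(\Delta\boxtimes\mathrm{id})\circ\Delta\cong(\mathrm{id}\boxtimes\Delta)\circ\Delta,\qquad (\varepsilon\boxtimes\mathrm{id})\circ\Delta\cong\mathrm{id}_{\mathcal I}\cong(\mathrm{id}\boxtimes\varepsilon)\circ\Delta$$ satisfying the pentagon identity (for functors $\mathcal I\to\mathrm{Mat}(\mathcal I\boxtimes\mathcal I\boxtimes\mathcal I\boxtimes\mathcal I)$) and the triangle identity (for functors $\mathcal I\to\mathrm{Mat}(\mathcal I\boxtimes\mathcal I)$). If the equations of a coalgebra hold strictly, up to reindexing the families coherently,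 these isomorphisms are permutation matrices. It is *quasitriangular* if it is equipped with a natural isomorphism $R:\Delta\to\Delta^{\mathrm{op}}:=\tau\circ\Delta$ satisfying the dual hexagon identities $$(\mathrm{id}\boxtimes\Delta)\diamond R=\big(((\tau\boxtimes\mathrm{id})\diamond(\mathrm{id}\boxtimes R))\circ(R\boxtimes\mathrm{id})\big)\diamond\Delta,$$ $$(\Delta\boxtimes\mathrm{id})\diamond R=\big(((\mathrm{id}\boxtimes\tau)\diamond(R\boxtimes\mathrm{id}))\circ(\mathrm{id}\boxtimes R)\big)\diamond\Delta,$$ where $\diamond$ is the composition of functors with natural transformations, and where $a^{\pm1}$ is inserted wherever it is needed to match source and target. **Properties of the tensor product.** Let $\mathcal E$ be a monoidal category. It is *$\otimes$-factor* if $f\otimes g$ is an epimorphism whenever $f$ and $g$ are, and a monomorphism whenever $f$ and $g$ are. It is *$\otimes$-exact* if for all epimorphisms $f_i:X_i\to Y_i$ ($i=1,2$) the push-out of $f_1\otimes\mathrm{id}_{X_2}$ and $\mathrm{id}_{X_1}\otimes f_2$ is given by $\mathrm{id}_{Y_1}\otimes f_2$ and $f_1\otimes\mathrm{id}_{Y_2}$,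 and for all monomorphisms $f_i:X_i\to Y_i$ the pull-back of $\mathrm{id}_{Y_1}\otimes f_2$ and $f_1\otimes\mathrm{id}_{Y_2}$ is given by $f_1\otimes\mathrm{id}_{X_2}$ and $\mathrm{id}_{X_1}\otimes f_2$. **Proposition.** Let $(\mathcal I,\Delta,\varepsilon,R)$ be a quasitriangular coalgebra category and let $(\mathcal C,\otimes,\mathbb 1,\Psi)$ be a $k$-linear abelian braided monoidal category with $k$-bilinear $\otimes$. Let $\bullet:\mathrm{Mat}(\mathcal C\boxtimes\mathcal C)\to\mathcal C$ be the functor $(X_i,Y_i)_i\mapsto\bigoplus_i X_i\otimes Y_i$, let $\times:\mathrm{Mat}(\mathcal C)\to\mathcal C$ be the functor $(X_i)_i\mapsto\bigoplus_iX_i$, and let $\eta:\mathrm{Mat}(k)\to\mathcal C$ be the additive functor with $\eta(k)=\mathbb 1$ and $\eta(\lambda)=\lambda\,\mathrm{id}_{\mathbb 1}$. Then the category $\mathcal C^{\mathcal I}$ of $k$-linear functors $\mathcal I\to\mathcal C$ and natural transformations, with its pointwise $k$-linear structure, is again a $k$-linear abelian braided monoidal category with $k$-bilinear tensor product, as follows.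 1. The tensor product is $F\otimes G=\bullet\circ(F\boxtimes G)\circ\Delta$ on functors and $\varphi\otimes\chi=\bullet\circ(\varphi\boxtimes\chi)\circ\Delta$ on natural transformations. The unit object is $\eta\circ\varepsilon$. 2. The associativity and unit isomorphisms are defined componentwise. On the direct summands of $((F\otimes G)\otimes K)(X)$ the associativity isomorphism is that of $\mathcal C$ followed by the image under $F\boxtimes G\boxtimes K$ of the corresponding matrix entries of $a$. On the direct summands of the source, the left (right) unit isomorphism for $F$ is that of $\mathcal C$ followed by the image under $F$ of the matrix entries of the left (right) counit isomorphism of $\mathcal I$. 3. The braiding is $$\Psi_{F,G}=\big(\times\diamond\Psi\diamond(F\boxtimes G)\circ\Delta^{\mathrm{op}}\big)\circ\big(\bullet\circ(F\boxtimes G)\diamond R\big):F\otimes G\to G\otimes F.$$ If $\mathcal C$ is $\otimes$-factor, then so is $\mathcal C^{\mathcal I}$. If $\mathcal C$ is $\otimes$-exact, then so is $\mathcal C^{\mathcal I}$. -/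

import Mathlib

open CategoryTheory CategoryTheory.Limits

universe w v₁ v₂ v₃ v₄ v₅ u₁ u₂ u₃ u₄ u₅

noncomputable section

attribute [instance] CategoryTheory.Abelian.hasFiniteBiproducts

namespace KMat

section LinearCategories

variable (k : Type w) [CommRing k]

/-! ### The tensor product of `k`-linear categories -/

/-- Objects of the tensor product `C ⊠ D` of two `k`-linear categories: pairs of objects. -/
@[ext]
structure Box (k : Type w) (C : Type u₁) (D : Type u₂) where
  /-- first component -/
  fst : C
  /-- second component -/
  snd : D

variable {C : Type u₁} [Category.{v₁} C] [Preadditive C] [Linear k C]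
variable {D : Type u₂} [Category.{v₂} D] [Preadditive D] [Linear k D]
variable {C' : Type u₃} [Category.{v₃} C'] [Preadditive C'] [Linear k C']
variable {D' : Type u₄} [Category.{v₄} D'] [Preadditive D'] [Linear k D']
variable {E : Type u₅} [Category.{v₅} E] [Preadditive E] [Linear k E]

variable {k}

/-- Composition in `C ⊠ D`: the `k`-bilinear extension of
`(f ⊗ g) ≫ (f' ⊗ g') = (f ≫ f') ⊗ (g ≫ g')`. -/
def Box.compHom (X Y Z : Box k C D) :
    TensorProduct k (X.fst ⟶ Y.fst) (X.snd ⟶ Y.snd) →ₗ[k]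
      TensorProduct k (Y.fst ⟶ Z.fst) (Y.snd ⟶ Z.snd) →ₗ[k]
        TensorProduct k (X.fst ⟶ Z.fst) (X.snd ⟶ Z.snd) :=
  TensorProduct.map₂ (Linear.comp X.fst Y.fst Z.fst) (Linear.comp X.snd Y.snd Z.snd)

@[simp]
lemma Box.compHom_tmul (X Y Z : Box k C D) (f : X.fst ⟶ Y.fst) (g : X.snd ⟶ Y.snd)
    (f' : Y.fst ⟶ Z.fst) (g' : Y.snd ⟶ Z.snd) :
    Box.compHom X Y Z (TensorProduct.tmul k f g) (TensorProduct.tmul k f' g') =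
      TensorProduct.tmul k (f ≫ f') (g ≫ g') := rfl

instance : Category.{max v₁ v₂} (Box k C D) where
  Hom X Y := TensorProduct k (X.fst ⟶ Y.fst) (X.snd ⟶ Y.snd)
  id X := TensorProduct.tmul k (𝟙 X.fst) (𝟙 X.snd)
  comp {X Y Z} f g := Box.compHom X Y Z f g
  id_comp {X Y} f := by
    induction f using TensorProduct.induction_on with
    | zero => simp
    | tmul a b => simp
    | add a b ha hb => rw [map_add, ha, hb]
  comp_id {X Y} f := by
    induction f using TensorProduct.induction_on with
    | zero => simp
    | tmul a b => simp
    | add a b ha hb => rw [map_add, LinearMap.add_apply, ha, hb]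
  assoc {W X Y Z} f g h := by
    induction f using TensorProduct.induction_on with
    | zero => simp
    | add a b ha hb => simp only [map_add, LinearMap.add_apply, ha, hb]
    | tmul a b =>
      induction g using TensorProduct.induction_on with
      | zero => simp
      | add a b ha hb => simp only [map_add, LinearMap.add_apply, ha, hb]
      | tmul c d =>
        induction h using TensorProduct.induction_on with
        | zero => simp
        | add a b ha hb => simp only [map_add, ha, hb]
        | tmul e f => simp

instance : Preadditive (Box k C D) where
  homGroup X Y := (inferInstance : AddCommGroup (TensorProduct k (X.fst ⟶ Y.fst) (X.snd ⟶ Y.snd)))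
  add_comp X Y Z f f' g := by
    have h : ∀ (f f' : TensorProduct k (X.fst ⟶ Y.fst) (X.snd ⟶ Y.snd))
        (g : TensorProduct k (Y.fst ⟶ Z.fst) (Y.snd ⟶ Z.snd)),
        Box.compHom X Y Z (f + f') g = Box.compHom X Y Z f g + Box.compHom X Y Z f' g := by simp
    exact h f f' g
  comp_add X Y Z f g g' := by
    have h : ∀ (f : TensorProduct k (X.fst ⟶ Y.fst) (X.snd ⟶ Y.snd))
        (g g' : TensorProduct k (Y.fst ⟶ Z.fst) (Y.snd ⟶ Z.snd)),
        Box.compHom X Y Z f (g + g') = Box.compHom X Y Z f g + Box.compHom X Y Z f g' := by simp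
    exact h f g g'

instance : Linear k (Box k C D) where
  homModule X Y := (inferInstance : Module k (TensorProduct k (X.fst ⟶ Y.fst) (X.snd ⟶ Y.snd)))
  smul_comp X Y Z r f g := by
    have h : ∀ (f : TensorProduct k (X.fst ⟶ Y.fst) (X.snd ⟶ Y.snd))
        (g : TensorProduct k (Y.fst ⟶ Z.fst) (Y.snd ⟶ Z.snd)),
        Box.compHom X Y Z (r • f) g = r • Box.compHom X Y Z f g := by simp
    exact h f g
  comp_smul X Y Z f r g := by
    have h : ∀ (f : TensorProduct k (X.fst ⟶ Y.fst) (X.snd ⟶ Y.snd))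
        (g : TensorProduct k (Y.fst ⟶ Z.fst) (Y.snd ⟶ Z.snd)),
        Box.compHom X Y Z f (r • g) = r • Box.compHom X Y Z f g := by simp
    exact h f g

/-- The morphism `f ⊗ g` of `C ⊠ D`. -/
def Box.tmul {X Y : Box k C D} (f : X.fst ⟶ Y.fst) (g : X.snd ⟶ Y.snd) : X ⟶ Y :=
  TensorProduct.tmul k f g

variable (k) in
/-- The morphism `f ⊗ g` of `C ⊠ D`, for objects written as pairs. -/
def Box.tens {X Y : C} {Z W : D} (f : X ⟶ Y) (g : Z ⟶ W) : (⟨X, Z⟩ : Box k C D) ⟶ ⟨Y, W⟩ :=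
  TensorProduct.tmul k f g

lemma Box.tmul_comp {X Y Z : Box k C D} (f : X.fst ⟶ Y.fst) (g : X.snd ⟶ Y.snd)
    (f' : Y.fst ⟶ Z.fst) (g' : Y.snd ⟶ Z.snd) :
    (Box.tmul f g : X ⟶ Y) ≫ (Box.tmul f' g' : Y ⟶ Z) = Box.tmul (f ≫ f') (g ≫ g') := rfl

lemma Box.id_eq (X : Box k C D) : 𝟙 X = Box.tmul (𝟙 X.fst) (𝟙 X.snd) := rfl

lemma Box.hom_induction {X Y : Box k C D} {P : (X ⟶ Y) → Prop} (f : X ⟶ Y)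
    (zero : P 0) (tmul : ∀ a b, P (Box.tmul a b)) (add : ∀ a b, P a → P b → P (a + b)) : P f :=
  TensorProduct.induction_on (motive := P) f zero tmul add

/-- A `k`-linear functor out of `C ⊠ D`, from linear maps on morphisms which respect identities
and composites of pure tensors. -/
def Box.mkFunctor (obj : Box k C D → E) (map : ∀ X Y : Box k C D, (X ⟶ Y) →ₗ[k] (obj X ⟶ obj Y))
    (map_id : ∀ X : Box k C D, map X X (Box.tmul (𝟙 X.fst) (𝟙 X.snd)) = 𝟙 (obj X))
    (map_comp : ∀ (X Y Z : Box k C D) (f : X.fst ⟶ Y.fst) (g : X.snd ⟶ Y.snd)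
      (f' : Y.fst ⟶ Z.fst) (g' : Y.snd ⟶ Z.snd),
      map X Z (Box.tmul (f ≫ f') (g ≫ g')) =
        map X Y (Box.tmul f g) ≫ map Y Z (Box.tmul f' g')) :
    Box k C D ⥤ E where
  obj := obj
  map {X Y} f := map X Y f
  map_id X := map_id X
  map_comp {X Y Z} f g := by
    induction f using Box.hom_induction with
    | zero => simp
    | add a b ha hb => rw [Preadditive.add_comp, map_add, map_add, ha, hb, Preadditive.add_comp]
    | tmul a b =>
      induction g using Box.hom_induction with
      | zero => simp
      | add a b ha hb => rw [Preadditive.comp_add, map_add, map_add, ha, hb, Preadditive.comp_add]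
      | tmul c d => rw [Box.tmul_comp, map_comp]

lemma Box.mkFunctor_additive (obj : Box k C D → E)
    (map : ∀ X Y : Box k C D, (X ⟶ Y) →ₗ[k] (obj X ⟶ obj Y))
    (map_id) (map_comp) : (Box.mkFunctor obj map map_id map_comp).Additive where
  map_add {X Y f g} := _root_.map_add (map X Y) f g

lemma Box.mkFunctor_linear (obj : Box k C D → E)
    (map : ∀ X Y : Box k C D, (X ⟶ Y) →ₗ[k] (obj X ⟶ obj Y))
    (map_id) (map_comp) : (Box.mkFunctor obj map map_id map_comp).Linear k where
  map_smul {X Y} f r := _root_.map_smul (map X Y) r f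

variable (k) in
/-- The functor `F ⊠ G : C ⊠ D ⥤ C' ⊠ D'`, `(X, Y) ↦ (F X, G Y)`, `f ⊗ g ↦ F f ⊗ G g`. -/
def Box.map (F : C ⥤ C') (G : D ⥤ D') [F.Additive] [F.Linear k] [G.Additive] [G.Linear k] :
    Box k C D ⥤ Box k C' D' :=
  Box.mkFunctor (fun X => ⟨F.obj X.fst, G.obj X.snd⟩)
    (fun _ _ => TensorProduct.map (F.mapLinearMap k) (G.mapLinearMap k))
    (fun X => by
      change TensorProduct.tmul k (F.map (𝟙 X.fst)) (G.map (𝟙 X.snd)) = _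
      rw [F.map_id, G.map_id]; rfl)
    (fun X Y Z f g f' g' => by
      change TensorProduct.tmul k (F.map (f ≫ f')) (G.map (g ≫ g')) = _
      rw [F.map_comp, G.map_comp]; rfl)

instance (F : C ⥤ C') (G : D ⥤ D') [F.Additive] [F.Linear k] [G.Additive] [G.Linear k] : (Box.map k F G).Additive :=
  Box.mkFunctor_additive _ _ _ _

instance (F : C ⥤ C') (G : D ⥤ D') [F.Additive] [F.Linear k] [G.Additive] [G.Linear k] : (Box.map k F G).Linear k :=
  Box.mkFunctor_linear _ _ _ _

variable (k C D) in
/-- The transposition `τ : C ⊠ D ⥤ D ⊠ C`. -/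
def Box.swap : Box k C D ⥤ Box k D C :=
  Box.mkFunctor (fun X => ⟨X.snd, X.fst⟩)
    (fun _ _ => (TensorProduct.comm k _ _).toLinearMap)
    (fun _ => rfl) (fun _ _ _ _ _ _ _ => rfl)

instance : (Box.swap k C D).Additive :=
  Box.mkFunctor_additive _ _ _ _

instance : (Box.swap k C D).Linear k :=
  Box.mkFunctor_linear _ _ _ _

variable (k C D E) in
/-- The associativity isomorphism `(C ⊠ D) ⊠ E ⥤ C ⊠ (D ⊠ E)`. -/
def Box.assoc : Box k (Box k C D) E ⥤ Box k C (Box k D E) :=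
  Box.mkFunctor (fun X => ⟨X.fst.fst, ⟨X.fst.snd, X.snd⟩⟩)
    (fun _ _ => (TensorProduct.assoc k _ _ _).toLinearMap)
    (fun _ => rfl)
    (fun X Y Z f g f' g' => by
      induction f using Box.hom_induction with
      | zero => simp [Box.tmul]
      | add a b ha hb =>
        simp only [Box.tmul, Preadditive.add_comp, TensorProduct.add_tmul, map_add] at ha hb ⊢
        rw [ha, hb]
      | tmul a b =>
        induction f' using Box.hom_induction with
        | zero => simp [Box.tmul]
        | add a b ha hb =>
          simp only [Box.tmul, Preadditive.comp_add, TensorProduct.add_tmul, map_add] at ha hb ⊢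
          rw [ha, hb]
        | tmul c d => rfl)

instance : (Box.assoc k C D E).Additive :=
  Box.mkFunctor_additive _ _ _ _

instance : (Box.assoc k C D E).Linear k :=
  Box.mkFunctor_linear _ _ _ _

/-- The linear map `φ ⊗ ψ` on morphism modules. -/
def Box.homMap {X Y : C} {X' Y' : C'} {Z W : D} {Z' W' : D'}
    (φ : (X ⟶ Y) →ₗ[k] (X' ⟶ Y')) (ψ : (Z ⟶ W) →ₗ[k] (Z' ⟶ W')) :
    ((⟨X, Z⟩ : Box k C D) ⟶ ⟨Y, W⟩) →ₗ[k] ((⟨X', Z'⟩ : Box k C' D') ⟶ ⟨Y', W'⟩) :=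
  TensorProduct.map φ ψ

/-- The associativity isomorphism on morphism modules. -/
def Box.homAssoc {X X' : C} {Y Y' : D} {Z Z' : E} :
    ((⟨⟨X, Y⟩, Z⟩ : Box k (Box k C D) E) ⟶ ⟨⟨X', Y'⟩, Z'⟩) →ₗ[k]
      ((⟨X, ⟨Y, Z⟩⟩ : Box k C (Box k D E)) ⟶ ⟨X', ⟨Y', Z'⟩⟩) :=
  (Box.assoc k C D E).mapLinearMap k

/-- The cyclic permutation `(x, (y, z)) ↦ (y, (z, x))` on morphisms. -/
def Box.rot {X X' : C} {Y Y' : D} {Z Z' : E}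
    (f : (⟨X, ⟨Y, Z⟩⟩ : Box k C (Box k D E)) ⟶ ⟨X', ⟨Y', Z'⟩⟩) :
    (⟨Y, ⟨Z, X⟩⟩ : Box k D (Box k E C)) ⟶ ⟨Y', ⟨Z', X'⟩⟩ :=
  (Box.swap k C (Box k D E) ⋙ Box.assoc k D E C).map f

/-- The transposition `(x, (y, z)) ↦ (x, (z, y))` on morphisms. -/
def Box.swap₂₃ {X X' : C} {Y Y' : D} {Z Z' : E}
    (f : (⟨X, ⟨Y, Z⟩⟩ : Box k C (Box k D E)) ⟶ ⟨X', ⟨Y', Z'⟩⟩) :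
    (⟨X, ⟨Z, Y⟩⟩ : Box k C (Box k E D)) ⟶ ⟨X', ⟨Z', Y'⟩⟩ :=
  (Box.map k (𝟭 C) (Box.swap k D E)).map f

/-- The transposition `(x, (y, z)) ↦ (y, (x, z))` on morphisms. -/
def Box.swap₁₂ {X X' : C} {Y Y' : D} {Z Z' : E}
    (f : (⟨X, ⟨Y, Z⟩⟩ : Box k C (Box k D E)) ⟶ ⟨X', ⟨Y', Z'⟩⟩) :
    (⟨Y, ⟨X, Z⟩⟩ : Box k D (Box k C E)) ⟶ ⟨Y', ⟨X', Z'⟩⟩ :=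
  Box.swap₂₃ (Box.rot f)

/-! ### The ring `k` as a one-object category -/

variable (k) in
instance : Linear k (SingleObj k) where
  homModule _ _ := inferInstanceAs (Module k k)
  smul_comp _ _ _ r f g := by
    change g * (r * f) = r * (g * f); ring
  comp_smul _ _ _ f r g := by
    change r * g * f = r * (g * f); ring

variable (k C) in
/-- The left unit isomorphism `k ⊠ C ⥤ C`, `r ⊗ f ↦ r • f`. -/
def Box.leftUnit : Box k (SingleObj k) C ⥤ C :=
  Box.mkFunctor (fun X => X.snd)
    (fun X Y => TensorProduct.lift (LinearMap.lsmul k (X.snd ⟶ Y.snd)))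
    (fun X => one_smul k (𝟙 X.snd))
    (fun X Y Z r f r' f' => by
      change ((r' * r : k) • (f ≫ f')) = (r • f) ≫ (r' • f')
      rw [Linear.smul_comp, Linear.comp_smul, smul_smul, mul_comm])

instance : (Box.leftUnit k C).Additive :=
  Box.mkFunctor_additive _ _ _ _

instance : (Box.leftUnit k C).Linear k :=
  Box.mkFunctor_linear _ _ _ _

variable (k C) in
/-- The right unit isomorphism `C ⊠ k ⥤ C`, `f ⊗ r ↦ r • f`. -/
def Box.rightUnit : Box k C (SingleObj k) ⥤ C :=
  Box.swap k C (SingleObj k) ⋙ Box.leftUnit k C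

instance : (Box.rightUnit k C).Additive :=
  by unfold Box.rightUnit; infer_instance

instance : (Box.rightUnit k C).Linear k :=
  by unfold Box.rightUnit; infer_instance

/-! ### Matrix categories -/

instance : Linear k (Mat_ C) where
  homModule M N := inferInstanceAs (Module k (∀ i j, M.X i ⟶ N.X j))
  smul_comp M N K r f g := by
    ext i j
    change ∑ l, (r • f i l) ≫ g l j = r • ∑ l, f i l ≫ g l j
    simp [Finset.smul_sum]
  comp_smul M N K f r g := by
    ext i j
    change ∑ l, f i l ≫ (r • g l j) = r • ∑ l, f i l ≫ g l j
    simp [Finset.smul_sum]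

@[simp]
lemma smul_entry {M N : Mat_ C} (r : k) (f : M ⟶ N) (i : M.ι) (j : N.ι) :
    (r • f) i j = r • f i j := rfl

instance : (Mat_.embedding C).Linear k where
  map_smul _ _ := rfl

/-- The `(i, j)` matrix entry of a `k`-linear functor with values in a matrix category, as a
linear map on morphisms. -/
def entry (F : C ⥤ Mat_ D) [F.Additive] [F.Linear k] {X Y : C} (i : (F.obj X).ι)
    (j : (F.obj Y).ι) : (X ⟶ Y) →ₗ[k] ((F.obj X).X i ⟶ (F.obj Y).X j) where
  toFun f := F.map f i j
  map_add' f g := by rw [F.map_add]; rfl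
  map_smul' r f := by rw [F.map_smul]; rfl

/-- The functor of matrix categories induced by a functor `C ⥤ D`. -/
def matMap (F : C ⥤ D) [F.Additive] : Mat_ C ⥤ Mat_ D where
  obj M := ⟨M.ι, fun i => F.obj (M.X i)⟩
  map f := fun i j => F.map (f i j)
  map_id M := by
    ext i j
    by_cases h : i = j
    · subst h; simp
    · simp [h]
  map_comp f g := by
    ext i j
    have h : F.map (∑ l, f i l ≫ g l j) = ∑ l, F.map (f i l) ≫ F.map (g l j) := by simp
    exact h

instance (F : C ⥤ D) [F.Additive] : (matMap F).Additive where
  map_add {M N f g} := by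
    ext i j
    have h : F.map (f i j + g i j) = F.map (f i j) + F.map (g i j) := F.map_add
    exact h

instance (F : C ⥤ D) [F.Additive] [F.Linear k] : (matMap F).Linear k where
  map_smul f r := by
    ext i j
    exact F.map_smul r (f i j)

/-- The extension `F̂ : Mat C ⥤ Mat D` of a functor `F : C ⥤ Mat D`. -/
def matExt (F : C ⥤ Mat_ D) [F.Additive] : Mat_ C ⥤ Mat_ D where
  obj M := ⟨Σ i : M.ι, (F.obj (M.X i)).ι, fun x => (F.obj (M.X x.1)).X x.2⟩
  map f := fun x y => F.map (f x.1 y.1) x.2 y.2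
  map_id M := by
    ext ⟨i, a⟩ ⟨j, b⟩
    by_cases h : i = j
    · subst h
      by_cases h' : a = b
      · subst h'; simp
      · rw [Mat_.id_apply_self, F.map_id, Mat_.id_apply_of_ne _ _ _ h', Mat_.id_apply_of_ne]
        intro e; exact h' (by simpa using e)
    · rw [Mat_.id_apply_of_ne _ _ _ h, F.map_zero, Mat_.id_apply_of_ne]
      · rfl
      · intro e; exact h (congrArg Sigma.fst e)
  map_comp {M N K} f g := by
    ext ⟨i, a⟩ ⟨j, b⟩
    have hs : ∀ (s : Finset N.ι),
        F.map (∑ l ∈ s, f i l ≫ g l j) a b =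
          ∑ l ∈ s, ∑ c : (F.obj (N.X l)).ι, F.map (f i l) a c ≫ F.map (g l j) c b := by
      classical
      intro s
      induction s using Finset.induction_on with
      | empty => simp only [Finset.sum_empty, F.map_zero]; rfl
      | insert l s hl ih =>
        rw [Finset.sum_insert hl, Finset.sum_insert hl, F.map_add, Mat_.add_apply, ih, F.map_comp,
          Mat_.comp_apply]
    refine (hs Finset.univ).trans ?_
    exact (Fintype.sum_sigma (fun x : Σ l : N.ι, (F.obj (N.X l)).ι =>
      F.map (f i x.1) a x.2 ≫ F.map (g x.1 j) x.2 b)).symm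

variable (k) in
/-- The functor `F ⊠ G : C ⊠ D ⥤ Mat (C' ⊠ D')` of two functors `F : C ⥤ Mat C'` and
`G : D ⥤ Mat D'`; on morphisms `f ⊗ g ↦ (F f i j ⊗ G g k l)`. -/
def matBox (F : C ⥤ Mat_ C') (G : D ⥤ Mat_ D') [F.Additive] [F.Linear k] [G.Additive]
    [G.Linear k] : Box k C D ⥤ Mat_ (Box k C' D') :=
  Box.mkFunctor
    (fun X => ⟨(F.obj X.fst).ι × (G.obj X.snd).ι,
      fun x => ⟨(F.obj X.fst).X x.1, (G.obj X.snd).X x.2⟩⟩)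
    (fun X Y =>
      { toFun := fun h => fun x y =>
          TensorProduct.map (entry (k := k) F x.1 y.1) (entry (k := k) G x.2 y.2) h
        map_add' := fun a b => by ext x y; exact map_add _ a b
        map_smul' := fun r a => by ext x y; exact map_smul _ r a })
    (fun X => by
      ext ⟨a, b⟩ ⟨a', b'⟩
      change TensorProduct.tmul k (F.map (𝟙 X.fst) a a') (G.map (𝟙 X.snd) b b') = _
      rw [F.map_id, G.map_id]
      by_cases h : a = a'
      · subst h
        by_cases h' : b = b'
        · subst h'; simp only [Mat_.id_apply_self]; rfl
        · rw [Mat_.id_apply_of_ne _ _ _ h', TensorProduct.tmul_zero]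
          exact (Mat_.id_apply_of_ne (Mat_.mk ((F.obj X.fst).ι × (G.obj X.snd).ι)
            fun x => (⟨(F.obj X.fst).X x.1, (G.obj X.snd).X x.2⟩ : Box k C' D')) (a, b) (a, b')
            (fun e => h' (Prod.mk.inj e).2)).symm
      · rw [Mat_.id_apply_of_ne _ _ _ h, TensorProduct.zero_tmul]
        exact (Mat_.id_apply_of_ne (Mat_.mk ((F.obj X.fst).ι × (G.obj X.snd).ι)
          fun x => (⟨(F.obj X.fst).X x.1, (G.obj X.snd).X x.2⟩ : Box k C' D')) (a, b) (a', b')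
          (fun e => h (Prod.mk.inj e).1)).symm)
    (fun X Y Z f g f' g' => by
      ext ⟨a, b⟩ ⟨a', b'⟩
      change TensorProduct.tmul k (F.map (f ≫ f') a a') (G.map (g ≫ g') b b') = _
      rw [F.map_comp, G.map_comp, Mat_.comp_apply, Mat_.comp_apply, Mat_.comp_apply,
        TensorProduct.sum_tmul]
      simp_rw [TensorProduct.tmul_sum]
      exact (Fintype.sum_prod_type (fun x : (F.obj Y.fst).ι × (G.obj Y.snd).ι =>
        TensorProduct.tmul k (F.map f a x.1 ≫ F.map f' x.1 a')
          (G.map g b x.2 ≫ G.map g' x.2 b'))).symm)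

instance (F : C ⥤ Mat_ C') (G : D ⥤ Mat_ D') [F.Additive] [F.Linear k] [G.Additive]
    [G.Linear k] : (matBox k F G).Additive :=
  Box.mkFunctor_additive _ _ _ _

instance (F : C ⥤ Mat_ C') (G : D ⥤ Mat_ D') [F.Additive] [F.Linear k] [G.Additive]
    [G.Linear k] : (matBox k F G).Linear k :=
  Box.mkFunctor_linear _ _ _ _

/-- The extension `Mat D ⥤ C`, `(X₁, …, Xₙ) ↦ T X₁ ⊕ … ⊕ T Xₙ`, of a functor `T : D ⥤ C` to a
category with finite direct sums. -/
def matLift [HasFiniteBiproducts C] (T : D ⥤ C) [T.Additive] : Mat_ D ⥤ C where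
  obj M := ⨁ fun i => T.obj (M.X i)
  map f := biproduct.matrix fun i j => T.map (f i j)
  map_id M := by
    ext i j
    by_cases h : j = i
    · subst h; simp
    · simp [h]
  map_comp f g := by
    ext i j
    simp [biproduct.lift_desc]

instance [HasFiniteBiproducts C] (T : D ⥤ C) [T.Additive] : (matLift T).Additive where
  map_add {M N f g} := by
    have h : biproduct.matrix (fun i j => T.map (f i j + g i j)) =
        biproduct.matrix (fun i j => T.map (f i j)) +
          biproduct.matrix (fun i j => T.map (g i j)) := by
      ext; simp
    exact h

instance [HasFiniteBiproducts C] (T : D ⥤ C) [T.Additive] [T.Linear k] :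
    (matLift T).Linear k where
  map_smul {M N} f r := by
    have h : biproduct.matrix (fun i j => T.map (r • f i j)) =
        r • biproduct.matrix (fun i j => T.map (f i j)) := by
      ext; simp
    exact h

/-- The natural transformation `matLift T ⟶ matLift T'` with components the direct sums of the
components of `θ : T ⟶ T'`. -/
def matLiftHom [HasFiniteBiproducts C] {T T' : D ⥤ C} [T.Additive] [T'.Additive] (θ : T ⟶ T') :
    matLift T ⟶ matLift T' where
  app M := biproduct.map fun i => θ.app (M.X i)
  naturality M N f := by
    have h : biproduct.matrix (fun i j => T.map (f i j)) ≫ biproduct.map (fun j => θ.app (N.X j)) =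
        biproduct.map (fun i => θ.app (M.X i)) ≫ biproduct.matrix (fun i j => T'.map (f i j)) := by
      ext; simp
    exact h

end LinearCategories

section Coalgebra

/-! ### Coalgebra categories -/

variable (k : Type w) [CommRing k]
variable (I : Type u₁) [Category.{v₁} I] [Preadditive I] [Linear k I]

/-- Data of a coalgebra category: `k`-linear functors `Δ : I ⥤ Mat (I ⊠ I)`, `ε : I ⥤ Mat k`
and the natural isomorphisms `(Δ ⊠ id) ∘ Δ ≅ (id ⊠ Δ) ∘ Δ`, `(ε ⊠ id) ∘ Δ ≅ id ≅ (id ⊠ ε) ∘ Δ`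
which express coassociativity and counitality (composites are taken in `k`-Mcat, where the
identity of `I` is the embedding `I ⥤ Mat I`). -/
structure CoalgebraData where
  /-- the comultiplication -/
  Δ : I ⥤ Mat_ (Box k I I)
  [Δ_additive : Δ.Additive]
  [Δ_linear : Δ.Linear k]
  /-- the counit -/
  ε : I ⥤ Mat_ (SingleObj k)
  [ε_additive : ε.Additive]
  [ε_linear : ε.Linear k]
  /-- coassociativity -/
  coassoc : Δ ⋙ matExt (matBox k Δ (Mat_.embedding I)) ⋙ matMap (Box.assoc k I I I) ≅
    Δ ⋙ matExt (matBox k (Mat_.embedding I) Δ)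
  /-- left counitality -/
  counitLeft : Δ ⋙ matExt (matBox k ε (Mat_.embedding I)) ⋙ matMap (Box.leftUnit k I) ≅
    Mat_.embedding I
  /-- right counitality -/
  counitRight : Δ ⋙ matExt (matBox k (Mat_.embedding I) ε) ⋙ matMap (Box.rightUnit k I) ≅
    Mat_.embedding I

namespace CoalgebraData

attribute [instance] Δ_additive Δ_linear ε_additive ε_linear

variable {k I} (Q : CoalgebraData k I)
variable {J : Type u₂} [Category.{v₂} J] [Preadditive J] [Linear k J]

/-- The index set of `Δ X = ((l₁, r₁), …, (lₙ, rₙ))`. -/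
abbrev idx (X : I) : Type := (Q.Δ.obj X).ι

/-- The first components of `Δ X`. -/
abbrev l (X : I) (p : Q.idx X) : I := ((Q.Δ.obj X).X p).fst

/-- The second components of `Δ X`. -/
abbrev r (X : I) (p : Q.idx X) : I := ((Q.Δ.obj X).X p).snd

/-- The index set of `ε X`. -/
abbrev eidx (X : I) : Type := (Q.ε.obj X).ι

/-- The `(i, j)` matrix entry of `Δ f`, as a linear function of `f`. -/
def comul {X Y : I} (i : Q.idx X) (j : Q.idx Y) :
    (X ⟶ Y) →ₗ[k] ((⟨Q.l X i, Q.r X i⟩ : Box k I I) ⟶ ⟨Q.l Y j, Q.r Y j⟩) :=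
  entry Q.Δ i j

/-- The `(i, j)` matrix entry of `(Δ ⊠ id) f`. -/
def comulFst {X X' : I} {Y Y' : J} (i : Q.idx X) (j : Q.idx X') :
    ((⟨X, Y⟩ : Box k I J) ⟶ ⟨X', Y'⟩) →ₗ[k]
      ((⟨Q.l X i, ⟨Q.r X i, Y⟩⟩ : Box k I (Box k I J)) ⟶ ⟨Q.l X' j, ⟨Q.r X' j, Y'⟩⟩) :=
  Box.homAssoc ∘ₗ Box.homMap (Q.comul i j) LinearMap.id

/-- The `(i, j)` matrix entry of `(id ⊠ Δ) f`. -/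
def comulSnd {X X' : J} {Y Y' : I} (i : Q.idx Y) (j : Q.idx Y') :
    ((⟨X, Y⟩ : Box k J I) ⟶ ⟨X', Y'⟩) →ₗ[k]
      ((⟨X, ⟨Q.l Y i, Q.r Y i⟩⟩ : Box k J (Box k I I)) ⟶ ⟨X', ⟨Q.l Y' j, Q.r Y' j⟩⟩) :=
  Box.homMap LinearMap.id (Q.comul i j)

/-- The `(i, j)` matrix entry of `(ε ⊠ id) f`, regarded as a morphism of `J` through
`k ⊠ J ≅ J`. -/
def counitFst {X X' : I} {Y Y' : J} (i : Q.eidx X) (j : Q.eidx X') :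
    ((⟨X, Y⟩ : Box k I J) ⟶ ⟨X', Y'⟩) →ₗ[k] (Y ⟶ Y') :=
  (Box.leftUnit k J).mapLinearMap k ∘ₗ Box.homMap (entry Q.ε i j) LinearMap.id

/-- The matrix entries of the coassociativity isomorphism. -/
def a (X : I) (p : Q.idx X) (q : Q.idx (Q.l X p)) (p' : Q.idx X) (q' : Q.idx (Q.r X p')) :
    (⟨Q.l (Q.l X p) q, ⟨Q.r (Q.l X p) q, Q.r X p⟩⟩ : Box k I (Box k I I)) ⟶
      ⟨Q.l X p', ⟨Q.l (Q.r X p') q', Q.r (Q.r X p') q'⟩⟩ :=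
  (Q.coassoc.hom.app X) ⟨p, (q, PUnit.unit)⟩ ⟨p', (PUnit.unit, q')⟩

/-- The matrix entries of the inverse of the coassociativity isomorphism. -/
def aInv (X : I) (p : Q.idx X) (q : Q.idx (Q.r X p)) (p' : Q.idx X) (q' : Q.idx (Q.l X p')) :
    (⟨Q.l X p, ⟨Q.l (Q.r X p) q, Q.r (Q.r X p) q⟩⟩ : Box k I (Box k I I)) ⟶
      ⟨Q.l (Q.l X p') q', ⟨Q.r (Q.l X p') q', Q.r X p'⟩⟩ :=
  (Q.coassoc.inv.app X) ⟨p, (PUnit.unit, q)⟩ ⟨p', (q', PUnit.unit)⟩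

/-- The matrix entries of the left counit isomorphism. -/
def cl (X : I) (p : Q.idx X) (e : Q.eidx (Q.l X p)) : Q.r X p ⟶ X :=
  (Q.counitLeft.hom.app X) ⟨p, (e, PUnit.unit)⟩ PUnit.unit

/-- The matrix entries of the right counit isomorphism. -/
def cr (X : I) (p : Q.idx X) (e : Q.eidx (Q.r X p)) : Q.l X p ⟶ X :=
  (Q.counitRight.hom.app X) ⟨p, (PUnit.unit, e)⟩ PUnit.unit

/-- The morphism `f ⊗ id_X` of `I ⊠ I ⊠ I ⊠ I`, for a morphism `f` of `I ⊠ I ⊠ I`. -/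
def tensorId {A A' B B' C C' : I} (f : (⟨A, ⟨B, C⟩⟩ : Box k I (Box k I I)) ⟶ ⟨A', ⟨B', C'⟩⟩)
    (X : I) :
    (⟨A, ⟨B, ⟨C, X⟩⟩⟩ : Box k I (Box k I (Box k I I))) ⟶ ⟨A', ⟨B', ⟨C', X⟩⟩⟩ :=
  Box.homMap LinearMap.id Box.homAssoc (Box.homAssoc (Box.tens k f (𝟙 X)))

/-- The pentagon: the two composites `(Δ ⊠ id ⊠ id)(Δ ⊠ id)Δ ⟶ (id ⊠ id ⊠ Δ)(id ⊠ Δ)Δ` of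
coassociativity isomorphisms agree. Written out in matrix entries: `p, q, s` index a summand of
the source, and `t, u, v` a summand of the target. -/
def Pentagon : Prop :=
  ∀ (X : I) (p : Q.idx X) (q : Q.idx (Q.l X p)) (s : Q.idx (Q.l (Q.l X p) q))
    (t : Q.idx X) (u : Q.idx (Q.r X t)) (v : Q.idx (Q.r (Q.r X t) u)),
    (∑ q' : Q.idx (Q.l X p), ∑ s' : Q.idx (Q.r (Q.l X p) q'),
      ∑ u' : Q.idx (Q.r X t), ∑ v' : Q.idx (Q.l (Q.r X t) u'),
        tensorId (Q.a (Q.l X p) q s q' s') (Q.r X p) ≫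
          Box.homMap LinearMap.id (Q.comulFst s' v') (Q.a X p q' t u') ≫
            Box.tens k (𝟙 (Q.l X t)) (Q.a (Q.r X t) u' v' u v)) =
    ∑ p' : Q.idx X, ∑ q' : Q.idx (Q.r X p'), ∑ s' : Q.idx (Q.l X p'),
      Q.comulFst s s' (Q.a X p q p' q') ≫
        Box.homMap LinearMap.id (Q.comulSnd q' v) (Q.a X p' s' t u)

/-- The triangle: the two isomorphisms `(id ⊠ ε ⊠ id)(Δ ⊠ id)Δ ⟶ Δ` built from the
coassociativity and counit isomorphisms agree. -/
def Triangle : Prop :=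
  ∀ (X : I) (p : Q.idx X) (q : Q.idx (Q.l X p)) (e : Q.eidx (Q.r (Q.l X p) q)) (t : Q.idx X),
    (∑ u : Q.idx (Q.r X t), ∑ e' : Q.eidx (Q.l (Q.r X t) u),
      Box.homMap LinearMap.id (Q.counitFst e e') (Q.a X p q t u) ≫
        Box.tens k (𝟙 (Q.l X t)) (Q.cl (Q.r X t) u e')) =
    Box.tens k (Q.cr (Q.l X p) q e) (𝟙 (Q.r X p)) ≫ (𝟙 (Q.Δ.obj X) : Q.Δ.obj X ⟶ Q.Δ.obj X) p t

/-- The opposite comultiplication `Δᵒᵖ = τ ∘ Δ`. -/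
abbrev Δop : I ⥤ Mat_ (Box k I I) := Q.Δ ⋙ matMap (Box.swap k I I)

/-- The matrix entries of a natural isomorphism `R : Δ ⟶ Δᵒᵖ`. -/
def R₂ (R : Q.Δ ≅ Q.Δop) (X : I) (p q : Q.idx X) :
    (⟨Q.l X p, Q.r X p⟩ : Box k I I) ⟶ ⟨Q.r X q, Q.l X q⟩ :=
  (R.hom.app X) p q

/-- The first dual hexagon identity
`(id ⊠ Δ) ⋄ R = (((τ ⊠ id) ⋄ (id ⊠ R)) ∘ (R ⊠ id)) ⋄ Δ` in matrix entries, with the coassociativity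
isomorphisms inserted. -/
def Hexagon₁ (R : Q.Δ ≅ Q.Δop) : Prop :=
  ∀ (X : I) (p : Q.idx X) (q : Q.idx (Q.l X p)) (t : Q.idx X) (u : Q.idx (Q.r X t)),
    (∑ p₁ : Q.idx X, ∑ q₁ : Q.idx (Q.r X p₁), ∑ p₂ : Q.idx X, ∑ q₂ : Q.idx (Q.l X p₂),
      Q.a X p q p₁ q₁ ≫ Q.comulSnd q₁ q₂ (Q.R₂ R X p₁ p₂) ≫
        Box.rot (Box.rot (Q.a X p₂ q₂ t u))) =
    ∑ q₁ : Q.idx (Q.l X p), ∑ u₁ : Q.idx (Q.r X t),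
      Box.homAssoc (Box.tens k (Q.R₂ R (Q.l X p) q q₁) (𝟙 (Q.r X p))) ≫
        Box.swap₁₂ (Q.a X p q₁ t u₁) ≫
          Box.swap₁₂ (Box.tens k (𝟙 (Q.l X t)) (Q.R₂ R (Q.r X t) u₁ u))

/-- The second dual hexagon identity
`(Δ ⊠ id) ⋄ R = (((id ⊠ τ) ⋄ (R ⊠ id)) ∘ (id ⊠ R)) ⋄ Δ` in matrix entries, with the coassociativity
isomorphisms inserted. -/
def Hexagon₂ (R : Q.Δ ≅ Q.Δop) : Prop :=
  ∀ (X : I) (p : Q.idx X) (q : Q.idx (Q.r X p)) (t : Q.idx X) (u : Q.idx (Q.l X t)),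
    (∑ p₁ : Q.idx X, ∑ q₁ : Q.idx (Q.l X p₁), ∑ p₂ : Q.idx X, ∑ q₂ : Q.idx (Q.r X p₂),
      Q.aInv X p q p₁ q₁ ≫ Q.comulFst q₁ q₂ (Q.R₂ R X p₁ p₂) ≫
        Box.rot (Q.aInv X p₂ q₂ t u)) =
    ∑ q₁ : Q.idx (Q.r X p), ∑ u₁ : Q.idx (Q.l X t),
      Box.tens k (𝟙 (Q.l X p)) (Q.R₂ R (Q.r X p) q q₁) ≫
        Box.swap₂₃ (Q.aInv X p q₁ t u₁) ≫
          Box.swap₂₃ (Box.homAssoc (Box.tens k (Q.R₂ R (Q.l X t) u₁ u) (𝟙 (Q.r X t))))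

end CoalgebraData

/-- A coalgebra category in `k`-Mcat: a `k`-linear category with `k`-linear functors `Δ` and `ε`
which are coassociative and counital up to coherent natural isomorphism. -/
structure CoalgebraCategory extends CoalgebraData k I where
  pentagon : toCoalgebraData.Pentagon
  triangle : toCoalgebraData.Triangle

/-- A quasitriangular coalgebra category: a coalgebra category with a natural isomorphism
`R : Δ ⟶ Δᵒᵖ` satisfying the two dual hexagon identities. -/
structure QuasitriangularCoalgebraCategory extends CoalgebraCategory k I where
  R : toCoalgebraData.Δ ≅ toCoalgebraData.Δop
  hexagon₁ : toCoalgebraData.Hexagon₁ R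
  hexagon₂ : toCoalgebraData.Hexagon₂ R

end Coalgebra

section Monoidal

open MonoidalCategory

/-! ### Monoidal structures and exactness of the tensor product -/

/-- The axioms of a monoidal category. -/
structure IsMonoidal {E : Type u₁} [Category.{v₁} E] (S : MonoidalCategoryStruct E) : Prop where
  tensorHom_def {X₁ Y₁ X₂ Y₂ : E} (f : X₁ ⟶ Y₁) (g : X₂ ⟶ Y₂) :
    f ⊗ₘ g = (f ▷ X₂) ≫ (Y₁ ◁ g)
  id_tensorHom_id (X₁ X₂ : E) : 𝟙 X₁ ⊗ₘ 𝟙 X₂ = 𝟙 (X₁ ⊗ X₂)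
  tensorHom_comp_tensorHom {X₁ Y₁ Z₁ X₂ Y₂ Z₂ : E} (f₁ : X₁ ⟶ Y₁) (f₂ : X₂ ⟶ Y₂)
    (g₁ : Y₁ ⟶ Z₁) (g₂ : Y₂ ⟶ Z₂) : (f₁ ⊗ₘ f₂) ≫ (g₁ ⊗ₘ g₂) = (f₁ ≫ g₁) ⊗ₘ (f₂ ≫ g₂)
  whiskerLeft_id (X Y : E) : X ◁ 𝟙 Y = 𝟙 (X ⊗ Y)
  id_whiskerRight (X Y : E) : 𝟙 X ▷ Y = 𝟙 (X ⊗ Y)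
  associator_naturality {X₁ X₂ X₃ Y₁ Y₂ Y₃ : E} (f₁ : X₁ ⟶ Y₁) (f₂ : X₂ ⟶ Y₂) (f₃ : X₃ ⟶ Y₃) :
    ((f₁ ⊗ₘ f₂) ⊗ₘ f₃) ≫ (α_ Y₁ Y₂ Y₃).hom = (α_ X₁ X₂ X₃).hom ≫ (f₁ ⊗ₘ (f₂ ⊗ₘ f₃))
  leftUnitor_naturality {X Y : E} (f : X ⟶ Y) : 𝟙_ _ ◁ f ≫ (λ_ Y).hom = (λ_ X).hom ≫ f
  rightUnitor_naturality {X Y : E} (f : X ⟶ Y) : f ▷ 𝟙_ _ ≫ (ρ_ Y).hom = (ρ_ X).hom ≫ f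
  pentagon (W X Y Z : E) :
    (α_ W X Y).hom ▷ Z ≫ (α_ W (X ⊗ Y) Z).hom ≫ W ◁ (α_ X Y Z).hom =
      (α_ (W ⊗ X) Y Z).hom ≫ (α_ W X (Y ⊗ Z)).hom
  triangle (X Y : E) : (α_ X (𝟙_ _) Y).hom ≫ X ◁ (λ_ Y).hom = (ρ_ X).hom ▷ Y

/-- The monoidal category with given structure. -/
abbrev IsMonoidal.toMonoidalCategory {E : Type u₁} [Category.{v₁} E]
    {S : MonoidalCategoryStruct E} (h : IsMonoidal S) : MonoidalCategory E :=
  { S with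
    tensorHom_def := h.tensorHom_def
    id_tensorHom_id := h.id_tensorHom_id
    tensorHom_comp_tensorHom := h.tensorHom_comp_tensorHom
    whiskerLeft_id := h.whiskerLeft_id
    id_whiskerRight := h.id_whiskerRight
    associator_naturality := h.associator_naturality
    leftUnitor_naturality := h.leftUnitor_naturality
    rightUnitor_naturality := h.rightUnitor_naturality
    pentagon := h.pentagon
    triangle := h.triangle }

/-- The `⊗`-factor property: the tensor product of two epimorphisms is an epimorphism, and the
tensor product of two monomorphisms is a monomorphism. -/
def TensorFactor (E : Type u₁) [Category.{v₁} E] [MonoidalCategory E] : Prop :=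
  (∀ {X₁ Y₁ X₂ Y₂ : E} (f : X₁ ⟶ Y₁) (g : X₂ ⟶ Y₂), Epi f → Epi g → Epi (f ⊗ₘ g)) ∧
    ∀ {X₁ Y₁ X₂ Y₂ : E} (f : X₁ ⟶ Y₁) (g : X₂ ⟶ Y₂), Mono f → Mono g → Mono (f ⊗ₘ g)

/-- The `⊗`-exact property: for epimorphisms `f₁, f₂` the push-out of `f₁ ⊗ id` and `id ⊗ f₂` is
given by `id ⊗ f₂` and `f₁ ⊗ id`, and dually for monomorphisms and pull-backs. -/
def TensorExact (E : Type u₁) [Category.{v₁} E] [MonoidalCategory E] : Prop :=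
  (∀ {X₁ Y₁ X₂ Y₂ : E} (f₁ : X₁ ⟶ Y₁) (f₂ : X₂ ⟶ Y₂), Epi f₁ → Epi f₂ →
    IsPushout (f₁ ▷ X₂) (X₁ ◁ f₂) (Y₁ ◁ f₂) (f₁ ▷ Y₂)) ∧
  ∀ {X₁ Y₁ X₂ Y₂ : E} (f₁ : X₁ ⟶ Y₁) (f₂ : X₂ ⟶ Y₂), Mono f₁ → Mono f₂ →
    IsPullback (f₁ ▷ X₂) (X₁ ◁ f₂) (Y₁ ◁ f₂) (f₁ ▷ Y₂)

end Monoidal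

section FunctorCategory

/-! ### The category of `k`-linear functors and its convolution product -/

open MonoidalCategory

variable (k : Type w) [CommRing k]
variable (I : Type u₁) [Category.{v₁} I] [Preadditive I] [Linear k I]
variable (C : Type u₂) [Category.{v₂} C] [Preadditive C] [Linear k C]

/-- The property of being a `k`-linear functor. -/
def isLinear : ObjectProperty (I ⥤ C) := fun F => F.Additive ∧ F.Linear k

/-- The category of `k`-linear functors `I ⥤ C` and natural transformations. It carries the
pointwise `k`-linear structure. -/
abbrev LinFun := (isLinear k I C).FullSubcategory

variable {k I C}

instance (F : LinFun k I C) : F.obj.Additive := F.property.1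

instance (F : LinFun k I C) : F.obj.Linear k := F.property.2

variable [MonoidalCategory C]

variable (k C) in
/-- The functor `η : k ⥤ C` with `η(k) = 𝟙` and `η(r) = r • id`. -/
def unitFun : SingleObj k ⥤ C where
  obj _ := 𝟙_ C
  map r := (r : k) • 𝟙 (𝟙_ C)
  map_id _ := one_smul k _
  map_comp r s := by
    change ((s * r : k) • 𝟙 (𝟙_ C)) = (r • 𝟙 (𝟙_ C)) ≫ (s • 𝟙 (𝟙_ C))
    rw [Linear.smul_comp, Linear.comp_smul, smul_smul, mul_comm s r, Category.id_comp]

instance : (unitFun k C).Additive where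
  map_add {_ _ r s} := add_smul (r : k) (s : k) (𝟙 (𝟙_ C))

instance : (unitFun k C).Linear k where
  map_smul s r := by
    change ((r * s : k) • 𝟙 (𝟙_ C)) = r • (s • 𝟙 (𝟙_ C))
    rw [smul_smul]

variable [MonoidalPreadditive C] [MonoidalLinear k C]

variable (k C) in
/-- The tensor product of `C` as a `k`-linear functor `C ⊠ C ⥤ C`. -/
def tensorFun : Box k C C ⥤ C :=
  Box.mkFunctor (fun X => X.fst ⊗ X.snd)
    (fun X Y => TensorProduct.lift
      { toFun := fun f =>
          { toFun := fun g => f ⊗ₘ g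
            map_add' := fun g g' => MonoidalPreadditive.tensor_add f g g'
            map_smul' := fun r g => by simp [MonoidalCategory.tensorHom_def] }
        map_add' := fun f f' => by ext g; exact MonoidalPreadditive.add_tensor f f' g
        map_smul' := fun r f => by ext g; simp [MonoidalCategory.tensorHom_def] })
    (fun X => id_tensorHom_id X.fst X.snd)
    (fun _ _ _ f g f' g' => (tensorHom_comp_tensorHom f g f' g').symm)

instance : (tensorFun k C).Additive := Box.mkFunctor_additive _ _ _ _

instance : (tensorFun k C).Linear k := Box.mkFunctor_linear _ _ _ _

/-- The functor `I ⊠ J ⥤ C`, `(X, Y) ↦ F X ⊗ G Y`. -/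
abbrev tensorBox {J : Type u₃} [Category.{v₃} J] [Preadditive J] [Linear k J]
    (F : I ⥤ C) (G : J ⥤ C) [F.Additive] [F.Linear k] [G.Additive] [G.Linear k] :
    Box k I J ⥤ C :=
  Box.map k F G ⋙ tensorFun k C

/-- The natural transformation with components `φ_X ⊗ χ_Y`. -/
def tensorBoxHom {J : Type u₃} [Category.{v₃} J] [Preadditive J] [Linear k J]
    {F F' : I ⥤ C} {G G' : J ⥤ C} [F.Additive] [F.Linear k] [G.Additive] [G.Linear k]
    [F'.Additive] [F'.Linear k] [G'.Additive] [G'.Linear k] (φ : F ⟶ F') (χ : G ⟶ G') :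
    tensorBox (k := k) F G ⟶ tensorBox F' G' where
  app X := φ.app X.fst ⊗ₘ χ.app X.snd
  naturality X Y f := by
    induction f using Box.hom_induction with
    | zero =>
      rw [Functor.map_zero, Functor.map_zero]
      exact zero_comp.trans comp_zero.symm
    | add a b ha hb =>
      rw [Functor.map_add, Functor.map_add]
      refine (Preadditive.add_comp _ _ _ _ _ _).trans ?_
      refine Eq.trans ?_ (Preadditive.comp_add _ _ _ _ _ _).symm
      rw [ha, hb]
    | tmul a b =>
      change (F.map a ⊗ₘ G.map b) ≫ (φ.app Y.fst ⊗ₘ χ.app Y.snd) =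
        (φ.app X.fst ⊗ₘ χ.app X.snd) ≫ (F'.map a ⊗ₘ G'.map b)
      simp only [tensorHom_comp_tensorHom, NatTrans.naturality]

variable [HasFiniteBiproducts C]

variable (k C) in
/-- The functor `• : Mat (C ⊠ C) ⥤ C`, `(Xᵢ, Yᵢ)ᵢ ↦ ⨁ᵢ Xᵢ ⊗ Yᵢ`. -/
abbrev bullet : Mat_ (Box k C C) ⥤ C := matLift (tensorFun k C)

namespace CoalgebraData

variable (Q : CoalgebraData k I)

/-- The tensor product `F ⊗ G = • ∘ (F ⊠ G) ∘ Δ` of `k`-linear functors. -/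
def conv (F G : LinFun k I C) : LinFun k I C where
  obj := Q.Δ ⋙ matMap (Box.map k F.obj G.obj) ⋙ bullet k C
  property := ⟨inferInstance, inferInstance⟩

/-- The tensor product `φ ⊗ χ = • ∘ (φ ⊠ χ) ∘ Δ` of natural transformations; its component at `X`
is the direct sum of the morphisms `φ ⊗ χ` at the pairs of objects `Δ X`. -/
def convHom {F F' G G' : LinFun k I C} (φ : F ⟶ F') (χ : G ⟶ G') :
    Q.conv F G ⟶ Q.conv F' G' :=
  ObjectProperty.homMk (Functor.whiskerLeft Q.Δ (matLiftHom (tensorBoxHom φ.hom χ.hom)))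

/-- The unit object `η ∘ ε`. -/
def convUnit : LinFun k I C where
  obj := Q.ε ⋙ matLift (unitFun k C)
  property := ⟨inferInstance, inferInstance⟩

/-- The inclusion of the summand with index `p` into `(F ⊗ G)(X)`. -/
def convι (F G : LinFun k I C) (X : I) (p : Q.idx X) :
    F.obj.obj (Q.l X p) ⊗ G.obj.obj (Q.r X p) ⟶ (Q.conv F G).obj.obj X :=
  biproduct.ι (fun p : Q.idx X => F.obj.obj (Q.l X p) ⊗ G.obj.obj (Q.r X p)) p

/-- The projection of `(F ⊗ G)(X)` to the summand with index `p`. -/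
def convπ (F G : LinFun k I C) (X : I) (p : Q.idx X) :
    (Q.conv F G).obj.obj X ⟶ F.obj.obj (Q.l X p) ⊗ G.obj.obj (Q.r X p) :=
  biproduct.π (fun p : Q.idx X => F.obj.obj (Q.l X p) ⊗ G.obj.obj (Q.r X p)) p

/-- The inclusion of the summand with index `e` into `(η ∘ ε)(X)`. -/
def unitι (X : I) (e : Q.eidx X) : 𝟙_ C ⟶ (Q.convUnit : LinFun k I C).obj.obj X :=
  biproduct.ι (fun _ : Q.eidx X => 𝟙_ C) e

/-- The isomorphisms `a_{F,G,K} : (F ⊗ G) ⊗ K ≅ F ⊗ (G ⊗ K)` are defined componentwise through the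
associativity of `C`: the restriction of `a_{F,G,K}` at `X` to a summand of its source and a summand
of its target is the associativity of `C`, followed by the value of `F ⊠ G ⊠ K` on the matrix entry
of the coassociativity isomorphism of `I`. -/
def IsAssociator (assoc : ∀ F G K : LinFun k I C,
    Q.conv (Q.conv F G) K ≅ Q.conv F (Q.conv G K)) : Prop :=
  ∀ (F G K : LinFun k I C) (X : I) (p : Q.idx X) (q : Q.idx (Q.l X p)) (p' : Q.idx X)
    (q' : Q.idx (Q.r X p')),
    (Q.convι F G (Q.l X p) q ▷ K.obj.obj (Q.r X p)) ≫ Q.convι (Q.conv F G) K X p ≫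
        (assoc F G K).hom.hom.app X ≫
          Q.convπ F (Q.conv G K) X p' ≫ (F.obj.obj (Q.l X p') ◁ Q.convπ G K (Q.r X p') q') =
      (α_ (F.obj.obj (Q.l (Q.l X p) q)) (G.obj.obj (Q.r (Q.l X p) q)) (K.obj.obj (Q.r X p))).hom ≫
        (tensorBox F.obj (tensorBox G.obj K.obj)).map (Q.a X p q p' q')

/-- The isomorphisms `1 ⊗ F ≅ F` are defined componentwise through the left unit isomorphisms of
`C` (and the left counit isomorphism of `I`). -/
def IsLeftUnitor (lam : ∀ F : LinFun k I C, Q.conv Q.convUnit F ≅ F) : Prop :=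
  ∀ (F : LinFun k I C) (X : I) (p : Q.idx X) (e : Q.eidx (Q.l X p)),
    (Q.unitι (Q.l X p) e ▷ F.obj.obj (Q.r X p)) ≫ Q.convι Q.convUnit F X p ≫
        (lam F).hom.hom.app X =
      (λ_ (F.obj.obj (Q.r X p))).hom ≫ F.obj.map (Q.cl X p e)

/-- The isomorphisms `F ⊗ 1 ≅ F` are defined componentwise through the right unit isomorphisms of
`C` (and the right counit isomorphism of `I`). -/
def IsRightUnitor (rho : ∀ F : LinFun k I C, Q.conv F Q.convUnit ≅ F) : Prop :=
  ∀ (F : LinFun k I C) (X : I) (p : Q.idx X) (e : Q.eidx (Q.r X p)),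
    (F.obj.obj (Q.l X p) ◁ Q.unitι (Q.r X p) e) ≫ Q.convι F Q.convUnit X p ≫
        (rho F).hom.hom.app X =
      (ρ_ (F.obj.obj (Q.l X p))).hom ≫ F.obj.map (Q.cr X p e)

/-- The isomorphisms `Ψ_{F,G} : F ⊗ G ≅ G ⊗ F` are given by
`Ψ_{F,G} = (× ⋄ Ψ ⋄ (F ⊠ G) ∘ Δᵒᵖ) ∘ (• ∘ (F ⊠ G) ⋄ R)`. -/
def IsBraiding [BraidedCategory C] (R : Q.Δ ≅ Q.Δop)
    (braid : ∀ F G : LinFun k I C, Q.conv F G ≅ Q.conv G F) : Prop :=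
  ∀ (F G : LinFun k I C) (X : I),
    (braid F G).hom.hom.app X =
      (matMap (Box.map k F.obj G.obj) ⋙ bullet k C).map (R.hom.app X) ≫
        biproduct.map (f := fun p : Q.idx X => F.obj.obj (Q.r X p) ⊗ G.obj.obj (Q.l X p))
          (g := fun p : Q.idx X => G.obj.obj (Q.l X p) ⊗ F.obj.obj (Q.r X p))
          fun p => (β_ (F.obj.obj (Q.r X p)) (G.obj.obj (Q.l X p))).hom

/-- The convolution tensor product, with given associativity and unit isomorphisms. -/
abbrev convStruct
    (assoc : ∀ F G K : LinFun k I C, Q.conv (Q.conv F G) K ≅ Q.conv F (Q.conv G K))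
    (lam : ∀ F : LinFun k I C, Q.conv Q.convUnit F ≅ F)
    (rho : ∀ F : LinFun k I C, Q.conv F Q.convUnit ≅ F) :
    MonoidalCategoryStruct (LinFun k I C) where
  tensorObj F G := Q.conv F G
  whiskerLeft F _ _ χ := Q.convHom (𝟙 F) χ
  whiskerRight φ G := Q.convHom φ (𝟙 G)
  tensorHom φ χ := Q.convHom φ χ
  tensorUnit := Q.convUnit
  associator := assoc
  leftUnitor := lam
  rightUnitor := rho

end CoalgebraData

end FunctorCategory

end KMat

end

noncomputable section

namespace KMat

/-! ### Linear functors form an abelian subcategory, with pointwise monos and epis -/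

section AbelianFunctors

variable {k : Type w} [CommRing k]
variable {I : Type u₁} [Category.{v₁} I] [Preadditive I] [Linear k I]
variable {C : Type u₂} [Category.{v₂} C] [Abelian C] [Linear k C]

/-! A morphism out of an iterated convolution product is determined by its restrictions to the
direct summands. On them the structure morphisms are matrices whose entries are values of `F ⊠ G ⊠
…` on morphisms of `I ⊠ I ⊠ …`, composed with structure morphisms of `C`. Each axiom thus becomes an
identity of matrix entries, in which an axiom of `I` and the corresponding axiom of `C` are used
side by side.

The evaluations are `tmap₂`, `tmap₃` and `tmap₄`. They are linear on morphism modules, so they pass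
through the sums in matrix products, and their compatibility with the associativity and the braiding
of `C` need only be checked on pure tensors, where it is naturality in `C`. The link with `Δ` is
`convι_map`: on a summand, `(F ⊗ G)(f)` is a row of the matrix `Δ f`. Hence a factor `F ⊗ G` in one
slot can be traded for `F` and `G` in two slots by applying `Δ` in that slot (`convι_tmap₂`,
`tmap₂_convι` and their three-slot versions); the unit object is treated likewise with `ε`.

The associator is obtained by identifying both triple products with direct sums of `F ⊠ G ⊠ K` over
the families `(Δ ⊠ id)Δ X` and `(id ⊠ Δ)Δ X`, and applying `F ⊠ G ⊠ K` to `a`. The unitors and the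
braiding arise in the same way from the counit isomorphisms and from `R`. For a coherence diagram
every edge is expanded on a summand, the structure morphisms of `C` are moved past the evaluations,
and the sums are reordered so that a target summand is fixed. Coherence in `C` then matches the
structure morphisms, and coherence in `I` matches the evaluated ones: `convAssoc_pentagon`,
`convAssoc_triangle`, `convBraiding_hexagon_forward`, `convBraiding_hexagon_reverse`.

Linear functors are closed under subobjects, quotients and finite products in `I ⥤ C`, because
linearity is an equality that can be tested after a mono or before an epi; so they form an abelian
category, with pointwise monos and epis. At `X`, `φ ⊗ χ` is a direct sum of tensor products in `C`.
Direct sums of epis, monos, pushouts and pullbacks are of the same kind, so both tensor properties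
pass from `C` to the functor category. -/

/-- A functor which is jointly embedded, at each object, into linear functors is linear. -/
lemma isLinear_of_jointly_mono {ι : Type*} (F : I ⥤ C) (G : ι → I ⥤ C)
    (hG : ∀ j, isLinear k I C (G j)) (m : ∀ j, F ⟶ G j)
    (hm : ∀ (X : I) {Z : C} (f g : Z ⟶ F.obj X),
      (∀ j, f ≫ (m j).app X = g ≫ (m j).app X) → f = g) : isLinear k I C F := by
  have hadd : F.Additive := ⟨fun {X Y f g} => hm _ _ _ fun j => by
    have := (hG j).1
    simp [Functor.map_add]⟩
  refine ⟨hadd, ⟨fun {X Y} f r => hm _ _ _ fun j => ?_⟩⟩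
  have := (hG j).1
  have := (hG j).2
  simp [Functor.map_smul]

/-- A functor onto which linear functors jointly surject, at each object, is linear. -/
lemma isLinear_of_jointly_epi {ι : Type*} (F : I ⥤ C) (G : ι → I ⥤ C)
    (hG : ∀ j, isLinear k I C (G j)) (m : ∀ j, G j ⟶ F)
    (hm : ∀ (X : I) {Z : C} (f g : F.obj X ⟶ Z),
      (∀ j, (m j).app X ≫ f = (m j).app X ≫ g) → f = g) : isLinear k I C F := by
  have hadd : F.Additive := ⟨fun {X Y f g} => hm _ _ _ fun j => by
    have := (hG j).1
    rw [← NatTrans.naturality, Functor.map_add]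
    simp⟩
  refine ⟨hadd, ⟨fun {X Y} f r => hm _ _ _ fun j => ?_⟩⟩
  have := (hG j).1
  have := (hG j).2
  rw [← NatTrans.naturality, Functor.map_smul]
  simp

/-- A mono of functors into `C` is pointwise mono, so it is by itself a jointly monic family. -/
instance : (isLinear k I C).IsClosedUnderSubobjects where
  prop_of_mono {F G} m _ hG :=
    isLinear_of_jointly_mono F (fun _ : Unit => G) (fun _ => hG) (fun _ => m)
      fun _ _ _ _ h => (cancel_mono _).1 (h ())

instance : (isLinear k I C).IsClosedUnderQuotients where
  prop_of_epi {F G} m _ hF :=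
    isLinear_of_jointly_epi G (fun _ : Unit => F) (fun _ => hF) (fun _ => m)
      fun _ _ _ _ h => (cancel_epi _).1 (h ())

/-- Evaluation at `X` preserves limits, so the projections of a limit are jointly monic at every
object. -/
instance : (isLinear k I C).IsClosedUnderFiniteProducts where
  isClosedUnderLimitsOfShape J _ :=
    { limitsOfShape_le := by
        rintro F ⟨p⟩
        refine isLinear_of_jointly_mono F _ p.prop_diag_obj p.π.app fun X Z f g h => ?_
        exact (isLimitOfPreserves ((evaluation I C).obj X) p.isLimit).hom_ext h }

instance : (isLinear k I C).ContainsZero where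
  exists_zero := by
    obtain ⟨Z, hZ⟩ := HasZeroObject.zero (C := I ⥤ C)
    -- At a zero object even the empty family is jointly monic.
    exact ⟨Z, hZ, isLinear_of_jointly_mono _ (fun e : Empty => e.elim)
      (fun e => e.elim) (fun e => e.elim) fun X _ _ _ _ => (hZ.obj X).eq_of_tgt _ _⟩

variable (k I C) in
/-- The category of linear functors to an abelian category is abelian. -/
abbrev linFunAbelian : Abelian (LinFun k I C) := inferInstance

-- The abelian structure is built on the pointwise addition of natural transformations, not merely
-- on an isomorphic one.
variable (k I C) in
lemma linFunAbelian_toPreadditive :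
    (linFunAbelian k I C).toPreadditive = Preadditive.fullSubcategory (isLinear k I C) := rfl

/-- No epimorphism is created by restricting to linear functors: the cokernel in `I ⥤ C` of a map of
linear functors is a quotient of a linear functor, hence linear. Among all functors, epimorphisms
are pointwise. -/
lemma epi_app {F G : LinFun k I C} (φ : F ⟶ G) [Epi φ] (X : I) : Epi (φ.hom.app X) := by
  have := (isLinear k I C).preservesEpimorphisms_ι_of_isNormalMonoCategory
  have : Epi φ.hom := inferInstanceAs (Epi ((isLinear k I C).ι.map φ))
  infer_instance

lemma mono_app {F G : LinFun k I C} (φ : F ⟶ G) [Mono φ] (X : I) : Mono (φ.hom.app X) := by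
  have := (isLinear k I C).preservesMonomorphisms_ι_of_isNormalEpiCategory
  have : Mono φ.hom := inferInstanceAs (Mono ((isLinear k I C).ι.map φ))
  infer_instance

lemma epi_of_epi_app {F G : LinFun k I C} (φ : F ⟶ G) (h : ∀ X, Epi (φ.hom.app X)) : Epi φ := by
  have : Epi ((isLinear k I C).ι.map φ) := NatTrans.epi_of_epi_app φ.hom
  exact (isLinear k I C).ι.epi_of_epi_map this

lemma mono_of_mono_app {F G : LinFun k I C} (φ : F ⟶ G) (h : ∀ X, Mono (φ.hom.app X)) :
    Mono φ := by
  have : Mono ((isLinear k I C).ι.map φ) := NatTrans.mono_of_mono_app φ.hom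
  exact (isLinear k I C).ι.mono_of_mono_map this

/-- The inclusion into `I ⥤ C` is fully faithful, hence reflects pushouts, and pushouts of functors
may be recognised pointwise. -/
lemma isPushout_of_app {F₁ F₂ F₃ F₄ : LinFun k I C} {f : F₁ ⟶ F₂} {g : F₁ ⟶ F₃} {h : F₂ ⟶ F₄}
    {i : F₃ ⟶ F₄} (H : ∀ X, IsPushout (f.hom.app X) (g.hom.app X) (h.hom.app X) (i.hom.app X)) :
    IsPushout f g h i :=
  IsPushout.of_map (isLinear k I C).ι (by ext X; exact (H X).w)
    (IsPushout.of_forall_isPushout_app H)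

lemma isPullback_of_app {F₁ F₂ F₃ F₄ : LinFun k I C} {f : F₁ ⟶ F₂} {g : F₁ ⟶ F₃} {h : F₂ ⟶ F₄}
    {i : F₃ ⟶ F₄} (H : ∀ X, IsPullback (f.hom.app X) (g.hom.app X) (h.hom.app X) (i.hom.app X)) :
    IsPullback f g h i :=
  IsPullback.of_map (isLinear k I C).ι (by ext X; exact (H X).w)
    (IsPullback.of_forall_isPullback_app H)

end AbelianFunctors

/-! ### Direct sums of epimorphisms, monomorphisms, pushouts and pullbacks -/

section Biproducts

variable {C : Type u₁} [Category.{v₁} C] [Preadditive C] [HasFiniteBiproducts C]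
variable {J : Type} [Fintype J] {f g h i : J → C}

lemma biproduct_map_epi (p : ∀ j, f j ⟶ g j) (hp : ∀ j, Epi (p j)) : Epi (biproduct.map p) where
  left_cancellation u v e := by
    ext j
    have := hp j
    rw [← cancel_epi (p j), ← biproduct.ι_map_assoc, ← biproduct.ι_map_assoc, e]

lemma biproduct_map_mono (p : ∀ j, f j ⟶ g j) (hp : ∀ j, Mono (p j)) :
    Mono (biproduct.map p) where
  right_cancellation u v e := by
    ext j
    have := hp j
    rw [← cancel_mono (p j), Category.assoc, Category.assoc, ← biproduct.map_π,
      reassoc_of% e]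

/-- A morphism out of a direct sum is a family of morphisms, so the universal properties of the
single squares assemble to that of their sum. -/
lemma biproduct_isPushout {p : ∀ j, f j ⟶ g j} {q : ∀ j, f j ⟶ h j} {r : ∀ j, g j ⟶ i j}
    {s : ∀ j, h j ⟶ i j} (H : ∀ j, IsPushout (p j) (q j) (r j) (s j)) :
    IsPushout (biproduct.map p) (biproduct.map q) (biproduct.map r) (biproduct.map s) where
  w := by
    refine biproduct.hom_ext' _ _ fun j => ?_
    rw [biproduct.ι_map_assoc, biproduct.ι_map_assoc, biproduct.ι_map, biproduct.ι_map,
      (H j).w_assoc]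
  isColimit' := ⟨PushoutCocone.IsColimit.mk _
    (fun t => biproduct.desc fun j => (H j).desc (biproduct.ι g j ≫ t.inl) (biproduct.ι h j ≫ t.inr)
      (by have := biproduct.ι f j ≫= t.condition; simpa using this))
    (fun t => by ext; simp) (fun t => by ext; simp)
    (fun t m h₁ h₂ => by
      ext j
      apply (H j).hom_ext
      · simp [← h₁]
      · simp [← h₂])⟩

lemma biproduct_isPullback {p : ∀ j, f j ⟶ g j} {q : ∀ j, f j ⟶ h j} {r : ∀ j, g j ⟶ i j}
    {s : ∀ j, h j ⟶ i j} (H : ∀ j, IsPullback (p j) (q j) (r j) (s j)) :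
    IsPullback (biproduct.map p) (biproduct.map q) (biproduct.map r) (biproduct.map s) where
  w := by ext; simp [(H _).w]
  isLimit' := ⟨PullbackCone.IsLimit.mk _
    (fun t => biproduct.lift fun j => (H j).lift (t.fst ≫ biproduct.π g j) (t.snd ≫ biproduct.π h j)
      (by have := t.condition =≫ biproduct.π i j; simpa using this))
    (fun t => by ext; simp) (fun t => by ext; simp)
    (fun t m h₁ h₂ => by
      ext j
      apply (H j).hom_ext
      · simp [← h₁]
      · simp [← h₂])⟩

end Biproducts

end KMat

end

/-! ### Evaluation of `F ⊠ G ⊠ …` on morphisms, as linear maps -/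

noncomputable section

namespace KMat

open MonoidalCategory

section TensorMaps

variable {k : Type w} [CommRing k]
variable {I : Type u₁} [Category.{v₁} I] [Preadditive I] [Linear k I]

section Induction

variable {J : Type u₂} [Category.{v₂} J] [Preadditive J] [Linear k J]
variable {L : Type u₃} [Category.{v₃} L] [Preadditive L] [Linear k L]

lemma Box.tens_zero {x x' : I} {y y' : J} (f : x ⟶ x') : Box.tens k f (0 : y ⟶ y') = 0 :=
  TensorProduct.tmul_zero _ _

lemma Box.tens_add {x x' : I} {y y' : J} (f : x ⟶ x') (g g' : y ⟶ y') :
    Box.tens k f (g + g') = Box.tens k f g + Box.tens k f g' :=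
  TensorProduct.tmul_add _ _ _

lemma Box.zero_tens {x x' : I} {y y' : J} (g : y ⟶ y') : Box.tens k (0 : x ⟶ x') g = 0 :=
  TensorProduct.zero_tmul _ _

lemma Box.add_tens {x x' : I} {y y' : J} (f f' : x ⟶ x') (g : y ⟶ y') :
    Box.tens k (f + f') g = Box.tens k f g + Box.tens k f' g :=
  TensorProduct.add_tmul _ _ _

lemma Box.induction₂ {x x' : I} {y y' : J}
    {P : ((⟨x, y⟩ : Box k I J) ⟶ ⟨x', y'⟩) → Prop} (h) (zero : P 0)
    (tens : ∀ f g, P (Box.tens k f g)) (add : ∀ a b, P a → P b → P (a + b)) : P h :=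
  Box.hom_induction h zero tens add

/-- A morphism of the triple product is a sum of triple pure tensors, so an additive identity need
only be checked on those. -/
lemma Box.induction₃ {x x' : I} {y y' : J} {z z' : L}
    {P : ((⟨x, ⟨y, z⟩⟩ : Box k I (Box k J L)) ⟶ ⟨x', ⟨y', z'⟩⟩) → Prop} (h) (zero : P 0)
    (tens : ∀ f g g', P (Box.tens k f (Box.tens k g g')))
    (add : ∀ a b, P a → P b → P (a + b)) : P h := by
  induction h using Box.induction₂ with
  | zero => exact zero
  | add a b ha hb => exact add a b ha hb
  | tens f c =>
    induction c using Box.induction₂ with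
    | zero => rw [Box.tens_zero]; exact zero
    | add a b ha hb => rw [Box.tens_add]; exact add _ _ ha hb
    | tens g g' => exact tens f g g'

end Induction

variable {C : Type u₂} [Category.{v₂} C] [Preadditive C] [Linear k C]
variable [MonoidalCategory C] [MonoidalPreadditive C] [MonoidalLinear k C]

/-- The value of `F ⊠ G` on a morphism of `I ⊠ I`. -/
def tmap₂ (F G : LinFun k I C) {x x' y y' : I} :
    ((⟨x, y⟩ : Box k I I) ⟶ ⟨x', y'⟩) →ₗ[k]
      (F.obj.obj x ⊗ G.obj.obj y ⟶ F.obj.obj x' ⊗ G.obj.obj y') :=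
  (tensorBox (k := k) F.obj G.obj).mapLinearMap k

/-- The value of `F ⊠ G ⊠ K` on a morphism of `I ⊠ I ⊠ I`. -/
def tmap₃ (F G K : LinFun k I C) {x x' y y' z z' : I} :
    ((⟨x, ⟨y, z⟩⟩ : Box k I (Box k I I)) ⟶ ⟨x', ⟨y', z'⟩⟩) →ₗ[k]
      (F.obj.obj x ⊗ (G.obj.obj y ⊗ K.obj.obj z) ⟶
        F.obj.obj x' ⊗ (G.obj.obj y' ⊗ K.obj.obj z')) :=
  (tensorBox (k := k) F.obj (tensorBox (k := k) G.obj K.obj)).mapLinearMap k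

/-- The value of `F ⊠ G ⊠ K ⊠ H` on a morphism of `I ⊠ I ⊠ I ⊠ I`. -/
def tmap₄ (F G K H : LinFun k I C) {x x' y y' z z' w w' : I} :
    ((⟨x, ⟨y, ⟨z, w⟩⟩⟩ : Box k I (Box k I (Box k I I))) ⟶ ⟨x', ⟨y', ⟨z', w'⟩⟩⟩) →ₗ[k]
      (F.obj.obj x ⊗ (G.obj.obj y ⊗ (K.obj.obj z ⊗ H.obj.obj w)) ⟶
        F.obj.obj x' ⊗ (G.obj.obj y' ⊗ (K.obj.obj z' ⊗ H.obj.obj w'))) :=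
  (tensorBox (k := k) F.obj
    (tensorBox (k := k) G.obj (tensorBox (k := k) K.obj H.obj))).mapLinearMap k

section

variable (F G K H : LinFun k I C) {x x' x'' y y' y'' z z' z'' w w' w'' : I}

lemma tmap₂_tens (f : x ⟶ x') (g : y ⟶ y') :
    tmap₂ F G (Box.tens k f g) = F.obj.map f ⊗ₘ G.obj.map g := rfl

lemma tmap₃_tens (f : x ⟶ x') (g : (⟨y, z⟩ : Box k I I) ⟶ ⟨y', z'⟩) :
    tmap₃ F G K (Box.tens k f g) = F.obj.map f ⊗ₘ tmap₂ G K g := rfl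

lemma tmap₄_tens (f : x ⟶ x') (g : (⟨y, ⟨z, w⟩⟩ : Box k I (Box k I I)) ⟶ ⟨y', ⟨z', w'⟩⟩) :
    tmap₄ F G K H (Box.tens k f g) = F.obj.map f ⊗ₘ tmap₃ G K H g := rfl

lemma tmap₂_comp (f : (⟨x, y⟩ : Box k I I) ⟶ ⟨x', y'⟩)
    (g : (⟨x', y'⟩ : Box k I I) ⟶ ⟨x'', y''⟩) :
    tmap₂ F G (f ≫ g) = tmap₂ F G f ≫ tmap₂ F G g :=
  (tensorBox (k := k) F.obj G.obj).map_comp f g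

lemma tmap₂_id : tmap₂ F G (𝟙 (⟨x, y⟩ : Box k I I)) = 𝟙 _ :=
  (tensorBox (k := k) F.obj G.obj).map_id _

lemma tmap₃_comp (f : (⟨x, ⟨y, z⟩⟩ : Box k I (Box k I I)) ⟶ ⟨x', ⟨y', z'⟩⟩)
    (g : (⟨x', ⟨y', z'⟩⟩ : Box k I (Box k I I)) ⟶ ⟨x'', ⟨y'', z''⟩⟩) :
    tmap₃ F G K (f ≫ g) = tmap₃ F G K f ≫ tmap₃ F G K g :=
  (tensorBox (k := k) F.obj (tensorBox (k := k) G.obj K.obj)).map_comp f g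

lemma tmap₄_comp
    (f : (⟨x, ⟨y, ⟨z, w⟩⟩⟩ : Box k I (Box k I (Box k I I))) ⟶ ⟨x', ⟨y', ⟨z', w'⟩⟩⟩)
    (g : (⟨x', ⟨y', ⟨z', w'⟩⟩⟩ : Box k I (Box k I (Box k I I))) ⟶ ⟨x'', ⟨y'', ⟨z'', w''⟩⟩⟩) :
    tmap₄ F G K H (f ≫ g) = tmap₄ F G K H f ≫ tmap₄ F G K H g :=
  (tensorBox (k := k) F.obj
    (tensorBox (k := k) G.obj (tensorBox (k := k) K.obj H.obj))).map_comp f g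

/-- Both sides are linear in `c`; for a pure tensor this is naturality of the associativity of `C`.
The two associators appear because `tmap₃` is bracketed to the right. -/
lemma tmap₃_homAssoc (c : (⟨x, y⟩ : Box k I I) ⟶ ⟨x', y'⟩) (g : z ⟶ z') :
    tmap₃ F G K (Box.homAssoc (Box.tens k c g)) =
      (α_ _ _ _).inv ≫ (tmap₂ F G c ⊗ₘ K.obj.map g) ≫ (α_ _ _ _).hom := by
  induction c using Box.induction₂ with
  | zero => simp [Box.zero_tens]
  | add a b ha hb => simp [Box.add_tens, MonoidalPreadditive.add_tensor, ha, hb]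
  | tens f f' =>
    rw [tmap₂_tens, associator_naturality, Iso.inv_hom_id_assoc]
    rfl

lemma tmap₄_homAssoc (c : (⟨x, y⟩ : Box k I I) ⟶ ⟨x', y'⟩)
    (g : (⟨z, w⟩ : Box k I I) ⟶ ⟨z', w'⟩) :
    tmap₄ F G K H (Box.homAssoc (Box.tens k c g)) =
      (α_ _ _ _).inv ≫ (tmap₂ F G c ⊗ₘ tmap₂ K H g) ≫ (α_ _ _ _).hom := by
  induction c using Box.induction₂ with
  | zero => simp [Box.zero_tens]
  | add a b ha hb => simp [Box.add_tens, MonoidalPreadditive.add_tensor, ha, hb]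
  | tens f f' =>
    rw [tmap₂_tens, associator_naturality, Iso.inv_hom_id_assoc]
    rfl

/-- The two associators bring `(F ⊗ (G ⊗ K)) ⊗ H` to the bracketing of `tmap₄`. On pure tensors the
claim is their naturality. -/
lemma tmap₄_tensorId (c : (⟨x, ⟨y, z⟩⟩ : Box k I (Box k I I)) ⟶ ⟨x', ⟨y', z'⟩⟩) (w : I) :
    (tmap₃ F G K c ▷ H.obj.obj w) ≫ (α_ _ _ _).hom ≫ (_ ◁ (α_ _ _ _).hom) =
      (α_ _ _ _).hom ≫ (_ ◁ (α_ _ _ _).hom) ≫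
        tmap₄ F G K H (CoalgebraData.tensorId c w) := by
  induction c using Box.induction₃ with
  | zero => simp [CoalgebraData.tensorId, Box.zero_tens]
  | add a b ha hb =>
    simp only [CoalgebraData.tensorId, Box.add_tens, map_add, Preadditive.add_comp,
      Preadditive.comp_add, MonoidalPreadditive.add_whiskerRight] at ha hb ⊢
    rw [ha, hb]
  | tens f g g' =>
    have h : tmap₄ F G K H (CoalgebraData.tensorId (Box.tens k f (Box.tens k g g')) w) =
      F.obj.map f ⊗ₘ (G.obj.map g ⊗ₘ (K.obj.map g' ⊗ₘ H.obj.map (𝟙 w))) := rfl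
    rw [h, tmap₃_tens, tmap₂_tens, CategoryTheory.Functor.map_id, ← tensorHom_id,
      associator_naturality_assoc, ← id_tensorHom, ← id_tensorHom, tensorHom_comp_tensorHom,
      tensorHom_comp_tensorHom, associator_naturality, Category.id_comp, Category.comp_id]

lemma tmap₄_tensorId_assoc (c : (⟨x, ⟨y, z⟩⟩ : Box k I (Box k I I)) ⟶ ⟨x', ⟨y', z'⟩⟩) (w : I) {T : C}
    (h' : _ ⟶ T) :
    (tmap₃ F G K c ▷ H.obj.obj w) ≫ (α_ _ _ _).hom ≫ (_ ◁ (α_ _ _ _).hom) ≫ h' =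
      (α_ _ _ _).hom ≫ (_ ◁ (α_ _ _ _).hom) ≫
        tmap₄ F G K H (CoalgebraData.tensorId c w) ≫ h' := by
  rw [reassoc_of% tmap₄_tensorId]

end

end TensorMaps

end KMat

end

/-! ### Summands of matrix extensions and of convolution products -/

noncomputable section

namespace KMat

open MonoidalCategory

section MatLift

variable {C : Type u₁} [Category.{v₁} C] [Preadditive C] [HasFiniteBiproducts C]
variable {D : Type u₂} [Category.{v₂} D] [Preadditive D]

/-- The inclusion of a summand into the value of `matLift T`. -/
def matι (T : D ⥤ C) [T.Additive] (M : Mat_ D) (i : M.ι) : T.obj (M.X i) ⟶ (matLift T).obj M :=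
  biproduct.ι (fun i => T.obj (M.X i)) i

/-- The morphism out of the value of `matLift T` with given restrictions to the summands. -/
def matDesc (T : D ⥤ C) [T.Additive] (M : Mat_ D) {Z : C} (f : ∀ i, T.obj (M.X i) ⟶ Z) :
    (matLift T).obj M ⟶ Z :=
  biproduct.desc f

lemma matι_desc (T : D ⥤ C) [T.Additive] (M : Mat_ D) {Z : C} (f : ∀ i, T.obj (M.X i) ⟶ Z)
    (i : M.ι) : matι T M i ≫ matDesc T M f = f i :=
  biproduct.ι_desc _ _

lemma matι_ext {T : D ⥤ C} [T.Additive] {M : Mat_ D} {Z : C} {f g : (matLift T).obj M ⟶ Z}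
    (h : ∀ i, matι T M i ≫ f = matι T M i ≫ g) : f = g :=
  biproduct.hom_ext' _ _ h

/-- Row `i` of the matrix. The component formulas for `Δ`, `ε`, `a`, the counit isomorphisms and `R`
are all instances of this one. -/
lemma matι_map (T : D ⥤ C) [T.Additive] {M N : Mat_ D} (f : M ⟶ N) (i : M.ι) :
    matι T M i ≫ (matLift T).map f = ∑ j, T.map (f i j) ≫ matι T N j :=
  (biproduct.ι_matrix _ i).trans biproduct.lift_eq

end MatLift

set_option linter.unusedSectionVars false

namespace CoalgebraData

variable {k : Type w} [CommRing k]
variable {I : Type u₁} [Category.{v₁} I] [Preadditive I] [Linear k I]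
variable {C : Type u₂} [Category.{v₂} C] [Preadditive C] [Linear k C]
variable [MonoidalCategory C] [MonoidalPreadditive C] [MonoidalLinear k C]
variable [HasFiniteBiproducts C]
variable (Q : CoalgebraData k I)

section Components

variable {F F' G G' : LinFun k I C} {X Y : I} {W Z : C}

lemma conv_ext {f g : (Q.conv F G).obj.obj X ⟶ Z}
    (h : ∀ p, Q.convι F G X p ≫ f = Q.convι F G X p ≫ g) : f = g :=
  biproduct.hom_ext' _ _ h

/-- Tensoring with `W` is additive, so it preserves the direct sum and the whiskered inclusions
remain jointly epic. -/
lemma conv_ext_right {f g : (Q.conv F G).obj.obj X ⊗ W ⟶ Z}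
    (h : ∀ p, (Q.convι F G X p ▷ W) ≫ f = (Q.convι F G X p ▷ W) ≫ g) : f = g :=
  rightDistributor_ext_left h

lemma conv_ext_left {f g : W ⊗ (Q.conv F G).obj.obj X ⟶ Z}
    (h : ∀ p, (W ◁ Q.convι F G X p) ≫ f = (W ◁ Q.convι F G X p) ≫ g) : f = g :=
  leftDistributor_ext_left h

variable (F G X) in
/-- The morphism out of `(F ⊗ G)(X)` with given restrictions to the summands. -/
def convDesc (f : ∀ p, F.obj.obj (Q.l X p) ⊗ G.obj.obj (Q.r X p) ⟶ Z) :
    (Q.conv F G).obj.obj X ⟶ Z :=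
  biproduct.desc f

lemma convι_desc (f : ∀ p, F.obj.obj (Q.l X p) ⊗ G.obj.obj (Q.r X p) ⟶ Z) (p : Q.idx X) :
    Q.convι F G X p ≫ Q.convDesc F G X f = f p :=
  biproduct.ι_desc _ _

variable (F G X) in
/-- The morphism out of `(F ⊗ G)(X) ⊗ W` with given restrictions to the summands. -/
def convDescRight (f : ∀ p, (F.obj.obj (Q.l X p) ⊗ G.obj.obj (Q.r X p)) ⊗ W ⟶ Z) :
    (Q.conv F G).obj.obj X ⊗ W ⟶ Z :=
  (rightDistributor (fun p => F.obj.obj (Q.l X p) ⊗ G.obj.obj (Q.r X p)) W).hom ≫ biproduct.desc f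

lemma convι_descRight (f : ∀ p, (F.obj.obj (Q.l X p) ⊗ G.obj.obj (Q.r X p)) ⊗ W ⟶ Z)
    (p : Q.idx X) : (Q.convι F G X p ▷ W) ≫ Q.convDescRight F G X f = f p :=
  (biproduct_ι_comp_rightDistributor_hom_assoc (J := Q.idx X) _ W p _).trans (biproduct.ι_desc _ _)

variable (F G X) in
/-- The morphism out of `W ⊗ (F ⊗ G)(X)` with given restrictions to the summands. -/
def convDescLeft (f : ∀ p, W ⊗ (F.obj.obj (Q.l X p) ⊗ G.obj.obj (Q.r X p)) ⟶ Z) :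
    W ⊗ (Q.conv F G).obj.obj X ⟶ Z :=
  (leftDistributor W (fun p => F.obj.obj (Q.l X p) ⊗ G.obj.obj (Q.r X p))).hom ≫ biproduct.desc f

lemma convι_descLeft (f : ∀ p, W ⊗ (F.obj.obj (Q.l X p) ⊗ G.obj.obj (Q.r X p)) ⟶ Z)
    (p : Q.idx X) : (W ◁ Q.convι F G X p) ≫ Q.convDescLeft F G X f = f p :=
  (biproduct_ι_comp_leftDistributor_hom_assoc (J := Q.idx X) W _ p _).trans (biproduct.ι_desc _ _)

lemma convι_π_self (p : Q.idx X) : Q.convι F G X p ≫ Q.convπ F G X p = 𝟙 _ :=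
  biproduct.ι_π_self _ _

lemma convι_π_ne {p q : Q.idx X} (h : p ≠ q) : Q.convι F G X p ≫ Q.convπ F G X q = 0 :=
  biproduct.ι_π_ne _ h

lemma convι_map (f : X ⟶ Y) (p : Q.idx X) :
    Q.convι F G X p ≫ (Q.conv F G).obj.map f =
      ∑ q, tmap₂ F G (Q.comul p q f) ≫ Q.convι F G Y q :=
  matι_map (tensorBox (k := k) F.obj G.obj) (Q.Δ.map f) p

lemma convι_convHom (φ : F ⟶ F') (χ : G ⟶ G') (p : Q.idx X) :
    Q.convι F G X p ≫ (Q.convHom φ χ).hom.app X =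
      (φ.hom.app _ ⊗ₘ χ.hom.app _) ≫ Q.convι F' G' X p :=
  biproduct.ι_map (fun p : Q.idx X => φ.hom.app (Q.l X p) ⊗ₘ χ.hom.app (Q.r X p)) p

/-- The direct sum form, from which the factor and exactness properties are read off. -/
lemma convHom_app (φ : F ⟶ F') (χ : G ⟶ G') :
    (Q.convHom φ χ).hom.app X = biproduct.map
      (f := fun p : Q.idx X => F.obj.obj (Q.l X p) ⊗ G.obj.obj (Q.r X p))
      (g := fun p : Q.idx X => F'.obj.obj (Q.l X p) ⊗ G'.obj.obj (Q.r X p))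
      fun p => φ.hom.app (Q.l X p) ⊗ₘ χ.hom.app (Q.r X p) := rfl

lemma unit_ext_right {f g : (Q.convUnit : LinFun k I C).obj.obj X ⊗ W ⟶ Z}
    (h : ∀ e, (Q.unitι X e ▷ W) ≫ f = (Q.unitι X e ▷ W) ≫ g) : f = g :=
  rightDistributor_ext_left h

lemma unit_ext_left {f g : W ⊗ (Q.convUnit : LinFun k I C).obj.obj X ⟶ Z}
    (h : ∀ e, (W ◁ Q.unitι X e) ≫ f = (W ◁ Q.unitι X e) ≫ g) : f = g :=
  leftDistributor_ext_left h

variable (X) in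
/-- The morphism out of `(η ∘ ε)(X) ⊗ W` with given restrictions to the summands. -/
def unitDescRight (f : Q.eidx X → (𝟙_ C ⊗ W ⟶ Z)) :
    (Q.convUnit : LinFun k I C).obj.obj X ⊗ W ⟶ Z :=
  (rightDistributor (fun _ : Q.eidx X => 𝟙_ C) W).hom ≫ biproduct.desc f

lemma unitι_descRight (f : Q.eidx X → (𝟙_ C ⊗ W ⟶ Z)) (e : Q.eidx X) :
    (Q.unitι X e ▷ W) ≫ Q.unitDescRight X f = f e :=
  (biproduct_ι_comp_rightDistributor_hom_assoc (J := Q.eidx X) _ W e _).trans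
    (biproduct.ι_desc _ _)

variable (X) in
/-- The morphism out of `W ⊗ (η ∘ ε)(X)` with given restrictions to the summands. -/
def unitDescLeft (f : Q.eidx X → (W ⊗ 𝟙_ C ⟶ Z)) :
    W ⊗ (Q.convUnit : LinFun k I C).obj.obj X ⟶ Z :=
  (leftDistributor W (fun _ : Q.eidx X => 𝟙_ C)).hom ≫ biproduct.desc f

lemma unitι_descLeft (f : Q.eidx X → (W ⊗ 𝟙_ C ⟶ Z)) (e : Q.eidx X) :
    (W ◁ Q.unitι X e) ≫ Q.unitDescLeft X f = f e :=
  (biproduct_ι_comp_leftDistributor_hom_assoc (J := Q.eidx X) W _ e _).trans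
    (biproduct.ι_desc _ _)

/-- The matrix entries of `ε f`, as elements of `k`. -/
def counitEntry (e : Q.eidx X) (e' : Q.eidx Y) (f : X ⟶ Y) : k := Q.ε.map f e e'

/-- The entries of `ε f` are scalars, and `η` sends a scalar to that multiple of the identity. -/
lemma unitι_map (f : X ⟶ Y) (e : Q.eidx X) :
    Q.unitι X e ≫ (Q.convUnit : LinFun k I C).obj.map f =
      ∑ e', Q.counitEntry e e' f • Q.unitι Y e' := by
  refine (matι_map (unitFun k C) (Q.ε.map f) e).trans (Finset.sum_congr rfl fun e' _ => ?_)
  exact (Linear.smul_comp _ _ _ _ _ _).trans (congrArg _ (Category.id_comp _))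

end Components

/-! ### Expanding a convolution product inside a tensor factor -/

section Expansion

variable (F G K H : LinFun k I C) {x x' y y' z z' : I}

/-- Evaluating `F ⊗ G` in the first slot is evaluating `F` and `G` in two slots after `Δ ⊠ id`. Both
sides are linear in `h`; on a pure tensor this is `convι_map` for the first factor. -/
lemma convι_tmap₂ (h : (⟨x, y⟩ : Box k I I) ⟶ ⟨x', y'⟩) (q : Q.idx x) :
    (Q.convι F G x q ▷ K.obj.obj y) ≫ tmap₂ (Q.conv F G) K h =
      ∑ q', (α_ _ _ _).hom ≫ tmap₃ F G K (Q.comulFst q q' h) ≫ (α_ _ _ _).inv ≫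
        (Q.convι F G x' q' ▷ K.obj.obj y') := by
  induction h using Box.induction₂ with
  | zero => simp
  | add a b ha hb =>
    simp only [map_add, Preadditive.comp_add, Preadditive.add_comp, Finset.sum_add_distrib, ha, hb]
  | tens f g =>
    have e : ∀ q', Q.comulFst q q' (Box.tens k f g) =
      Box.homAssoc (Box.tens k (Q.comul q q' f) g) := fun _ => rfl
    simp only [e, tmap₃_homAssoc, Category.assoc, Iso.hom_inv_id_assoc]
    rw [tmap₂_tens, ← tensorHom_id, tensorHom_comp_tensorHom, convι_map, Category.id_comp,
      sum_tensor]
    simp [← tensorHom_id, tensorHom_comp_tensorHom]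

lemma convι_tmap₃ (h : (⟨x, ⟨y, z⟩⟩ : Box k I (Box k I I)) ⟶ ⟨x', ⟨y', z'⟩⟩) (q : Q.idx x) :
    (Q.convι F G x q ▷ (K.obj.obj y ⊗ H.obj.obj z)) ≫ tmap₃ (Q.conv F G) K H h =
      ∑ q', (α_ _ _ _).hom ≫ tmap₄ F G K H (Q.comulFst q q' h) ≫ (α_ _ _ _).inv ≫
        (Q.convι F G x' q' ▷ (K.obj.obj y' ⊗ H.obj.obj z')) := by
  induction h using Box.induction₂ with
  | zero => simp
  | add a b ha hb =>
    simp only [map_add, Preadditive.comp_add, Preadditive.add_comp, Finset.sum_add_distrib, ha, hb]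
  | tens f g =>
    have e : ∀ q', Q.comulFst q q' (Box.tens k f g) =
      Box.homAssoc (Box.tens k (Q.comul q q' f) g) := fun _ => rfl
    simp only [e, tmap₄_homAssoc, Category.assoc, Iso.hom_inv_id_assoc]
    rw [tmap₃_tens, ← tensorHom_id, tensorHom_comp_tensorHom, convι_map, Category.id_comp,
      sum_tensor]
    simp [← tensorHom_id, tensorHom_comp_tensorHom]

/-- The counterpart for the second slot, with `id ⊠ Δ`. No associator enters, since splitting the
last slot already gives the right-nested bracketing. -/
lemma tmap₂_convι (h : (⟨x, y⟩ : Box k I I) ⟶ ⟨x', y'⟩) (q : Q.idx y) :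
    (F.obj.obj x ◁ Q.convι G K y q) ≫ tmap₂ F (Q.conv G K) h =
      ∑ q', tmap₃ F G K (Q.comulSnd q q' h) ≫ (F.obj.obj x' ◁ Q.convι G K y' q') := by
  induction h using Box.induction₂ with
  | zero => simp
  | add a b ha hb =>
    simp only [map_add, Preadditive.comp_add, Preadditive.add_comp, Finset.sum_add_distrib, ha, hb]
  | tens f g =>
    have e : ∀ q', Q.comulSnd q q' (Box.tens k f g) = Box.tens k f (Q.comul q q' g) := fun _ => rfl
    simp only [e, tmap₃_tens]
    rw [tmap₂_tens, ← id_tensorHom, tensorHom_comp_tensorHom, convι_map, Category.id_comp,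
      tensor_sum]
    simp [← id_tensorHom, tensorHom_comp_tensorHom]

/-- The middle slot is the first slot of the inner pair, so the pure tensor case is `convι_tmap₂`
tensored on the left. -/
lemma tmap₃_convι_left (h : (⟨x, ⟨y, z⟩⟩ : Box k I (Box k I I)) ⟶ ⟨x', ⟨y', z'⟩⟩)
    (q : Q.idx y) :
    (F.obj.obj x ◁ (Q.convι G K y q ▷ H.obj.obj z)) ≫ tmap₃ F (Q.conv G K) H h =
      ∑ q', (_ ◁ (α_ _ _ _).hom) ≫ tmap₄ F G K H (Box.homMap LinearMap.id (Q.comulFst q q') h) ≫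
        (_ ◁ (α_ _ _ _).inv) ≫ (F.obj.obj x' ◁ (Q.convι G K y' q' ▷ H.obj.obj z')) := by
  induction h using Box.induction₂ with
  | zero => simp
  | add a b ha hb =>
    simp only [map_add, Preadditive.comp_add, Preadditive.add_comp, Finset.sum_add_distrib, ha, hb]
  | tens f g =>
    have e : ∀ q', Box.homMap (k := k) LinearMap.id (Q.comulFst q q') (Box.tens k f g) =
      Box.tens k f (Q.comulFst q q' g) := fun _ => rfl
    simp only [e, tmap₄_tens]
    rw [tmap₃_tens, ← id_tensorHom, tensorHom_comp_tensorHom, convι_tmap₂, Category.id_comp,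
      tensor_sum]
    simp [← id_tensorHom, tensorHom_comp_tensorHom]

lemma tmap₃_convι_right (h : (⟨x, ⟨y, z⟩⟩ : Box k I (Box k I I)) ⟶ ⟨x', ⟨y', z'⟩⟩)
    (q : Q.idx z) :
    (F.obj.obj x ◁ (G.obj.obj y ◁ Q.convι K H z q)) ≫ tmap₃ F G (Q.conv K H) h =
      ∑ q', tmap₄ F G K H (Box.homMap LinearMap.id (Q.comulSnd q q') h) ≫
        (F.obj.obj x' ◁ (G.obj.obj y' ◁ Q.convι K H z' q')) := by
  induction h using Box.induction₂ with
  | zero => simp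
  | add a b ha hb =>
    simp only [map_add, Preadditive.comp_add, Preadditive.add_comp, Finset.sum_add_distrib, ha, hb]
  | tens f g =>
    have e : ∀ q', Box.homMap (k := k) LinearMap.id (Q.comulSnd q q') (Box.tens k f g) =
      Box.tens k f (Q.comulSnd q q' g) := fun _ => rfl
    simp only [e, tmap₄_tens]
    rw [tmap₃_tens, ← id_tensorHom, tensorHom_comp_tensorHom, tmap₂_convι, Category.id_comp,
      tensor_sum]
    simp [← id_tensorHom, tensorHom_comp_tensorHom]

/-- The matrix entry of `(id ⊠ ε) f`, regarded as a morphism of `I`. -/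
def counitSnd (e : Q.eidx y) (e' : Q.eidx y') :
    ((⟨x, y⟩ : Box k I I) ⟶ ⟨x', y'⟩) →ₗ[k] (x ⟶ x') :=
  (Box.rightUnit k I).mapLinearMap k ∘ₗ Box.homMap LinearMap.id (entry Q.ε e e')

/-- Here `ε` plays the role of `Δ`: the unit object in a slot amounts to applying `ε` there and
removing the slot by the unitor of `C`. -/
lemma unitι_tmap₂ (h : (⟨x, y⟩ : Box k I I) ⟶ ⟨x', y'⟩) (e : Q.eidx x) :
    (Q.unitι x e ▷ G.obj.obj y) ≫ tmap₂ Q.convUnit G h =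
      ∑ e', (λ_ _).hom ≫ G.obj.map (Q.counitFst e e' h) ≫ (λ_ _).inv ≫
        (Q.unitι x' e' ▷ G.obj.obj y') := by
  induction h using Box.induction₂ with
  | zero => simp
  | add a b ha hb =>
    simp only [map_add, Functor.map_add, Preadditive.comp_add, Preadditive.add_comp,
      Finset.sum_add_distrib, ha, hb]
  | tens f g =>
    have h' : ∀ e', Q.counitFst e e' (Box.tens k f g) = Q.counitEntry e e' f • g := fun _ => rfl
    simp only [h', Functor.map_smul]
    rw [tmap₂_tens, ← tensorHom_id, tensorHom_comp_tensorHom, unitι_map, Category.id_comp,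
      sum_tensor]
    refine Finset.sum_congr rfl fun e' _ => ?_
    simp [MonoidalCategory.tensorHom_def']

lemma tmap₂_unitι (h : (⟨x, y⟩ : Box k I I) ⟶ ⟨x', y'⟩) (e : Q.eidx y) :
    (F.obj.obj x ◁ Q.unitι y e) ≫ tmap₂ F Q.convUnit h =
      ∑ e', (ρ_ _).hom ≫ F.obj.map (Q.counitSnd e e' h) ≫ (ρ_ _).inv ≫
        (F.obj.obj x' ◁ Q.unitι y' e') := by
  induction h using Box.induction₂ with
  | zero => simp
  | add a b ha hb =>
    simp only [map_add, Functor.map_add, Preadditive.comp_add, Preadditive.add_comp,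
      Finset.sum_add_distrib, ha, hb]
  | tens f g =>
    have h' : ∀ e', Q.counitSnd e e' (Box.tens k f g) = Q.counitEntry e e' g • f := fun _ => rfl
    simp only [h', Functor.map_smul]
    rw [tmap₂_tens, ← id_tensorHom, tensorHom_comp_tensorHom, unitι_map, Category.id_comp,
      tensor_sum]
    refine Finset.sum_congr rfl fun e' _ => ?_
    simp [MonoidalCategory.tensorHom_def]

lemma tmap₃_unitι (h : (⟨x, ⟨y, z⟩⟩ : Box k I (Box k I I)) ⟶ ⟨x', ⟨y', z'⟩⟩)
    (e : Q.eidx y) :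
    (F.obj.obj x ◁ (Q.unitι y e ▷ G.obj.obj z)) ≫ tmap₃ F Q.convUnit G h =
      ∑ e', (_ ◁ (λ_ _).hom) ≫ tmap₂ F G (Box.homMap LinearMap.id (Q.counitFst e e') h) ≫
        (_ ◁ (λ_ _).inv) ≫ (F.obj.obj x' ◁ (Q.unitι y' e' ▷ G.obj.obj z')) := by
  induction h using Box.induction₂ with
  | zero => simp
  | add a b ha hb =>
    simp only [map_add, Preadditive.comp_add, Preadditive.add_comp, Finset.sum_add_distrib, ha, hb]
  | tens f g =>
    have h' : ∀ e', Box.homMap (k := k) LinearMap.id (Q.counitFst e e') (Box.tens k f g) =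
      Box.tens k f (Q.counitFst e e' g) := fun _ => rfl
    simp only [h', tmap₂_tens]
    rw [tmap₃_tens, ← id_tensorHom, tensorHom_comp_tensorHom, unitι_tmap₂, Category.id_comp,
      tensor_sum]
    simp [← id_tensorHom, tensorHom_comp_tensorHom]

end Expansion

end CoalgebraData

end KMat

end

/-! ### The associativity isomorphism -/

noncomputable section

namespace KMat

open MonoidalCategory

/-- The identity of `I` enters `(Δ ⊠ id) ∘ Δ` as the embedding by one-element families, so the index
sets carry a factor `PUnit`. This removes it, leaving sums over pairs of indices. -/
lemma sum_sigma_prod_punit {M : Type*} [AddCommMonoid M] {A : Type} [Fintype A] {B : A → Type}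
    [∀ a, Fintype (B a)] (f : (Σ a, B a × PUnit.{1}) → M) :
    ∑ i, f i = ∑ a, ∑ b, f ⟨a, (b, PUnit.unit)⟩ := by
  rw [Fintype.sum_sigma]
  refine Finset.sum_congr rfl fun a _ => ?_
  rw [Fintype.sum_prod_type]
  simp

lemma sum_sigma_punit_prod {M : Type*} [AddCommMonoid M] {A : Type} [Fintype A] {B : A → Type}
    [∀ a, Fintype (B a)] (f : (Σ a, PUnit.{1} × B a) → M) :
    ∑ i, f i = ∑ a, ∑ b, f ⟨a, (PUnit.unit, b)⟩ := by
  rw [Fintype.sum_sigma]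
  refine Finset.sum_congr rfl fun a _ => ?_
  rw [Fintype.sum_prod_type]
  simp

set_option linter.unusedSectionVars false

namespace CoalgebraData

variable {k : Type w} [CommRing k]
variable {I : Type u₁} [Category.{v₁} I] [Preadditive I] [Linear k I]
variable {C : Type u₂} [Category.{v₂} C] [Preadditive C] [Linear k C]
variable [MonoidalCategory C] [MonoidalPreadditive C] [MonoidalLinear k C]
variable [HasFiniteBiproducts C]
variable (Q : CoalgebraData k I)

/-- The functor `(Δ ⊠ id) ∘ Δ`. -/
abbrev comulLeft : I ⥤ Mat_ (Box k I (Box k I I)) :=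
  Q.Δ ⋙ matExt (matBox k Q.Δ (Mat_.embedding I)) ⋙ matMap (Box.assoc k I I I)

/-- The functor `(id ⊠ Δ) ∘ Δ`. -/
abbrev comulRight : I ⥤ Mat_ (Box k I (Box k I I)) :=
  Q.Δ ⋙ matExt (matBox k (Mat_.embedding I) Q.Δ)

/-- The functor `(ε ⊠ id) ∘ Δ`. -/
abbrev counitLeftFun : I ⥤ Mat_ I :=
  Q.Δ ⋙ matExt (matBox k Q.ε (Mat_.embedding I)) ⋙ matMap (Box.leftUnit k I)

/-- The functor `(id ⊠ ε) ∘ Δ`. -/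
abbrev counitRightFun : I ⥤ Mat_ I :=
  Q.Δ ⋙ matExt (matBox k (Mat_.embedding I) Q.ε) ⋙ matMap (Box.rightUnit k I)

section Associator

variable (F G K : LinFun k I C)

/-- The functor `F ⊠ G ⊠ K`, followed by the tensor product of `C`. -/
abbrev tensorBox₃ : Box k I (Box k I I) ⥤ C :=
  tensorBox (k := k) F.obj (tensorBox (k := k) G.obj K.obj)

/-- The inclusion of a summand into `(• ∘ (F ⊠ G ⊠ K) ∘ (Δ ⊠ id) ∘ Δ)(X)`. -/
def comulLeftι (X : I) (p : Q.idx X) (q : Q.idx (Q.l X p)) :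
    F.obj.obj (Q.l (Q.l X p) q) ⊗ (G.obj.obj (Q.r (Q.l X p) q) ⊗ K.obj.obj (Q.r X p)) ⟶
      (matLift (tensorBox₃ F G K)).obj (Q.comulLeft.obj X) :=
  matι (tensorBox₃ F G K) (Q.comulLeft.obj X) ⟨p, (q, PUnit.unit)⟩

/-- The inclusion of a summand into `(• ∘ (F ⊠ G ⊠ K) ∘ (id ⊠ Δ) ∘ Δ)(X)`. -/
def comulRightι (X : I) (p : Q.idx X) (q : Q.idx (Q.r X p)) :
    F.obj.obj (Q.l X p) ⊗ (G.obj.obj (Q.l (Q.r X p) q) ⊗ K.obj.obj (Q.r (Q.r X p) q)) ⟶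
      (matLift (tensorBox₃ F G K)).obj (Q.comulRight.obj X) :=
  matι (tensorBox₃ F G K) (Q.comulRight.obj X) ⟨p, (PUnit.unit, q)⟩

variable {F G K} in
lemma comulLeft_ext {X : I} {Z : C}
    {f g : (matLift (tensorBox₃ F G K)).obj (Q.comulLeft.obj X) ⟶ Z}
    (h : ∀ p q, Q.comulLeftι F G K X p q ≫ f = Q.comulLeftι F G K X p q ≫ g) : f = g :=
  matι_ext fun i => h i.1 i.2.1

/-- The morphism with given restrictions to the summands `comulLeftι`. -/
def comulLeftDesc (X : I) {Z : C}
    (f : ∀ (p : Q.idx X) (q : Q.idx (Q.l X p)),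
      F.obj.obj (Q.l (Q.l X p) q) ⊗ (G.obj.obj (Q.r (Q.l X p) q) ⊗ K.obj.obj (Q.r X p)) ⟶ Z) :
    (matLift (tensorBox₃ F G K)).obj (Q.comulLeft.obj X) ⟶ Z :=
  matDesc (tensorBox₃ F G K) (Q.comulLeft.obj X) fun i => f i.1 i.2.1

lemma comulLeftι_desc (X : I) {Z : C}
    (f : ∀ (p : Q.idx X) (q : Q.idx (Q.l X p)),
      F.obj.obj (Q.l (Q.l X p) q) ⊗ (G.obj.obj (Q.r (Q.l X p) q) ⊗ K.obj.obj (Q.r X p)) ⟶ Z)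
    (p : Q.idx X) (q : Q.idx (Q.l X p)) :
    Q.comulLeftι F G K X p q ≫ Q.comulLeftDesc F G K X f = f p q :=
  matι_desc _ _ _ _

variable {F G K} in
lemma comulRight_ext {X : I} {Z : C}
    {f g : (matLift (tensorBox₃ F G K)).obj (Q.comulRight.obj X) ⟶ Z}
    (h : ∀ p q, Q.comulRightι F G K X p q ≫ f = Q.comulRightι F G K X p q ≫ g) : f = g :=
  matι_ext fun i => h i.1 i.2.2

/-- The morphism with given restrictions to the summands `comulRightι`. -/
def comulRightDesc (X : I) {Z : C}
    (f : ∀ (p : Q.idx X) (q : Q.idx (Q.r X p)),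
      F.obj.obj (Q.l X p) ⊗ (G.obj.obj (Q.l (Q.r X p) q) ⊗ K.obj.obj (Q.r (Q.r X p) q)) ⟶ Z) :
    (matLift (tensorBox₃ F G K)).obj (Q.comulRight.obj X) ⟶ Z :=
  matDesc (tensorBox₃ F G K) (Q.comulRight.obj X) fun i => f i.1 i.2.2

lemma comulRightι_desc (X : I) {Z : C}
    (f : ∀ (p : Q.idx X) (q : Q.idx (Q.r X p)),
      F.obj.obj (Q.l X p) ⊗ (G.obj.obj (Q.l (Q.r X p) q) ⊗ K.obj.obj (Q.r (Q.r X p) q)) ⟶ Z)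
    (p : Q.idx X) (q : Q.idx (Q.r X p)) :
    Q.comulRightι F G K X p q ≫ Q.comulRightDesc F G K X f = f p q :=
  matι_desc _ _ _ _

/-- The isomorphism `((F ⊗ G) ⊗ K)(X) ≅ (• ∘ (F ⊠ G ⊠ K) ∘ (Δ ⊠ id) ∘ Δ)(X)`. -/
def convLeftIsoApp (X : I) : (Q.conv (Q.conv F G) K).obj.obj X ≅
    (matLift (tensorBox₃ F G K)).obj (Q.comulLeft.obj X) where
  hom := Q.convDesc _ _ X fun p => Q.convDescRight _ _ _ fun q =>
    (α_ _ _ _).hom ≫ Q.comulLeftι F G K X p q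
  inv := Q.comulLeftDesc F G K X fun p q => (α_ _ _ _).inv ≫
    (Q.convι F G (Q.l X p) q ▷ K.obj.obj (Q.r X p)) ≫ Q.convι (Q.conv F G) K X p
  hom_inv_id := Q.conv_ext fun p => Q.conv_ext_right fun q => by
    rw [reassoc_of% convι_desc, reassoc_of% convι_descRight, Category.assoc, Category.comp_id,
      comulLeftι_desc, Iso.hom_inv_id_assoc]
  inv_hom_id := Q.comulLeft_ext fun p q => by
    rw [reassoc_of% comulLeftι_desc, Category.assoc, Category.assoc, convι_desc, convι_descRight,
      Iso.inv_hom_id_assoc, Category.comp_id]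

lemma convι_convLeftIsoApp_hom (X : I) (p : Q.idx X) (q : Q.idx (Q.l X p)) :
    (Q.convι F G (Q.l X p) q ▷ K.obj.obj (Q.r X p)) ≫ Q.convι (Q.conv F G) K X p ≫
      (Q.convLeftIsoApp F G K X).hom = (α_ _ _ _).hom ≫ Q.comulLeftι F G K X p q := by
  rw [convLeftIsoApp, convι_desc, convι_descRight]

lemma comulLeftι_convLeftIsoApp_inv (X : I) (p : Q.idx X) (q : Q.idx (Q.l X p)) :
    Q.comulLeftι F G K X p q ≫ (Q.convLeftIsoApp F G K X).inv = (α_ _ _ _).inv ≫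
      (Q.convι F G (Q.l X p) q ▷ K.obj.obj (Q.r X p)) ≫ Q.convι (Q.conv F G) K X p := by
  rw [Iso.comp_inv_eq, Category.assoc, Category.assoc, convι_convLeftIsoApp_hom,
    Iso.inv_hom_id_assoc]

/-- The isomorphism `(F ⊗ (G ⊗ K))(X) ≅ (• ∘ (F ⊠ G ⊠ K) ∘ (id ⊠ Δ) ∘ Δ)(X)`. -/
def convRightIsoApp (X : I) : (Q.conv F (Q.conv G K)).obj.obj X ≅
    (matLift (tensorBox₃ F G K)).obj (Q.comulRight.obj X) where
  hom := Q.convDesc _ _ X fun p => Q.convDescLeft _ _ _ fun q => Q.comulRightι F G K X p q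
  inv := Q.comulRightDesc F G K X fun p q =>
    (F.obj.obj (Q.l X p) ◁ Q.convι G K (Q.r X p) q) ≫ Q.convι F (Q.conv G K) X p
  hom_inv_id := Q.conv_ext fun p => Q.conv_ext_left fun q => by
    rw [reassoc_of% convι_desc, reassoc_of% convι_descLeft, Category.comp_id, comulRightι_desc]
  inv_hom_id := Q.comulRight_ext fun p q => by
    rw [reassoc_of% comulRightι_desc, Category.assoc, convι_desc, convι_descLeft, Category.comp_id]

lemma convι_convRightIsoApp_hom (X : I) (p : Q.idx X) (q : Q.idx (Q.r X p)) :
    (F.obj.obj (Q.l X p) ◁ Q.convι G K (Q.r X p) q) ≫ Q.convι F (Q.conv G K) X p ≫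
      (Q.convRightIsoApp F G K X).hom = Q.comulRightι F G K X p q := by
  rw [convRightIsoApp, convι_desc, convι_descLeft]

lemma comulRightι_convRightIsoApp_inv (X : I) (p : Q.idx X) (q : Q.idx (Q.r X p)) :
    Q.comulRightι F G K X p q ≫ (Q.convRightIsoApp F G K X).inv =
      (F.obj.obj (Q.l X p) ◁ Q.convι G K (Q.r X p) q) ≫ Q.convι F (Q.conv G K) X p := by
  rw [Iso.comp_inv_eq, Category.assoc, convι_convRightIsoApp_hom]

lemma comulLeftι_map {X Y : I} (f : X ⟶ Y) (p : Q.idx X) (q : Q.idx (Q.l X p)) :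
    Q.comulLeftι F G K X p q ≫ (matLift (tensorBox₃ F G K)).map (Q.comulLeft.map f) =
      ∑ p', ∑ q', tmap₃ F G K (Q.comulFst q q' (Q.comul p p' f)) ≫
        Q.comulLeftι F G K Y p' q' :=
  (matι_map (tensorBox₃ F G K) (Q.comulLeft.map f) ⟨p, (q, PUnit.unit)⟩).trans
    (sum_sigma_prod_punit _)

lemma comulRightι_map {X Y : I} (f : X ⟶ Y) (p : Q.idx X) (q : Q.idx (Q.r X p)) :
    Q.comulRightι F G K X p q ≫ (matLift (tensorBox₃ F G K)).map (Q.comulRight.map f) =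
      ∑ p', ∑ q', tmap₃ F G K (Q.comulSnd q q' (Q.comul p p' f)) ≫
        Q.comulRightι F G K Y p' q' :=
  (matι_map (tensorBox₃ F G K) (Q.comulRight.map f) ⟨p, (PUnit.unit, q)⟩).trans
    (sum_sigma_punit_prod _)

lemma comulLeftι_coassoc_hom (X : I) (p : Q.idx X) (q : Q.idx (Q.l X p)) :
    Q.comulLeftι F G K X p q ≫ (matLift (tensorBox₃ F G K)).map (Q.coassoc.hom.app X) =
      ∑ p', ∑ q', tmap₃ F G K (Q.a X p q p' q') ≫ Q.comulRightι F G K X p' q' :=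
  (matι_map (tensorBox₃ F G K) (Q.coassoc.hom.app X) ⟨p, (q, PUnit.unit)⟩).trans
    (sum_sigma_punit_prod _)

lemma comulRightι_coassoc_inv (X : I) (p : Q.idx X) (q : Q.idx (Q.r X p)) :
    Q.comulRightι F G K X p q ≫ (matLift (tensorBox₃ F G K)).map (Q.coassoc.inv.app X) =
      ∑ p', ∑ q', tmap₃ F G K (Q.aInv X p q p' q') ≫ Q.comulLeftι F G K X p' q' :=
  (matι_map (tensorBox₃ F G K) (Q.coassoc.inv.app X) ⟨p, (PUnit.unit, q)⟩).trans
    (sum_sigma_prod_punit _)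

/-- The isomorphism `(F ⊗ G) ⊗ K ≅ • ∘ (F ⊠ G ⊠ K) ∘ (Δ ⊠ id) ∘ Δ`. -/
def convLeftIso : (Q.conv (Q.conv F G) K).obj ≅ Q.comulLeft ⋙ matLift (tensorBox₃ F G K) :=
  NatIso.ofComponents (Q.convLeftIsoApp F G K) fun {X Y} f => by
    refine Q.conv_ext fun p => Q.conv_ext_right fun q => ?_
    rw [reassoc_of% convι_map, reassoc_of% convι_convLeftIsoApp_hom, Functor.comp_map, comulLeftι_map]
    -- The outer `Δ f` has been expanded; `convι_tmap₂` now applies `Δ` to its left components,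
    -- producing the entries of `(Δ ⊠ id)Δ f`.
    simp only [Preadditive.comp_sum, Preadditive.sum_comp, Category.assoc, reassoc_of% convι_tmap₂,
      convι_convLeftIsoApp_hom, Iso.inv_hom_id_assoc]

/-- The isomorphism `F ⊗ (G ⊗ K) ≅ • ∘ (F ⊠ G ⊠ K) ∘ (id ⊠ Δ) ∘ Δ`. -/
def convRightIso : (Q.conv F (Q.conv G K)).obj ≅ Q.comulRight ⋙ matLift (tensorBox₃ F G K) :=
  NatIso.ofComponents (Q.convRightIsoApp F G K) fun {X Y} f => by
    refine Q.conv_ext fun p => Q.conv_ext_left fun q => ?_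
    rw [reassoc_of% convι_map, reassoc_of% convι_convRightIsoApp_hom, Functor.comp_map, comulRightι_map]
    simp only [Preadditive.comp_sum, Preadditive.sum_comp, Category.assoc, reassoc_of% tmap₂_convι,
      convι_convRightIsoApp_hom]

/-- The associativity isomorphism of the convolution product. -/
def convAssoc : Q.conv (Q.conv F G) K ≅ Q.conv F (Q.conv G K) :=
  ObjectProperty.isoMk _ (Q.convLeftIso F G K ≪≫
    Functor.isoWhiskerRight Q.coassoc (matLift (tensorBox₃ F G K)) ≪≫
      (Q.convRightIso F G K).symm)

lemma convAssoc_hom_app (X : I) : (Q.convAssoc F G K).hom.hom.app X =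
    (Q.convLeftIsoApp F G K X).hom ≫ (matLift (tensorBox₃ F G K)).map (Q.coassoc.hom.app X) ≫
      (Q.convRightIsoApp F G K X).inv := rfl

lemma convAssoc_inv_app (X : I) : (Q.convAssoc F G K).inv.hom.app X =
    (Q.convRightIsoApp F G K X).hom ≫ (matLift (tensorBox₃ F G K)).map (Q.coassoc.inv.app X) ≫
      (Q.convLeftIsoApp F G K X).inv :=
  -- The inverse of the threefold composite is bracketed to the left.
  Category.assoc _ _ _

/-- The associator as a matrix: the associativity of `C`, then `F ⊠ G ⊠ K` on the entries of `a`.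
The coherence proofs use the associator only through this formula and the one for its inverse. -/
lemma convι_convAssoc_hom (X : I) (p : Q.idx X) (q : Q.idx (Q.l X p)) :
    (Q.convι F G (Q.l X p) q ▷ K.obj.obj (Q.r X p)) ≫ Q.convι (Q.conv F G) K X p ≫
      (Q.convAssoc F G K).hom.hom.app X =
        ∑ p', ∑ q', (α_ _ _ _).hom ≫ tmap₃ F G K (Q.a X p q p' q') ≫
          (F.obj.obj (Q.l X p') ◁ Q.convι G K (Q.r X p') q') ≫ Q.convι F (Q.conv G K) X p' := by
  rw [convAssoc_hom_app, reassoc_of% convι_convLeftIsoApp_hom, reassoc_of% comulLeftι_coassoc_hom]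
  simp only [Preadditive.comp_sum, Preadditive.sum_comp, Category.assoc,
    comulRightι_convRightIsoApp_inv]

lemma convι_convAssoc_hom_assoc (X : I) (p : Q.idx X) (q : Q.idx (Q.l X p)) {T : C}
    (h' : _ ⟶ T) :
    (Q.convι F G (Q.l X p) q ▷ K.obj.obj (Q.r X p)) ≫ Q.convι (Q.conv F G) K X p ≫
      (Q.convAssoc F G K).hom.hom.app X ≫ h' =
      (∑ p', ∑ q', (α_ _ _ _).hom ≫ tmap₃ F G K (Q.a X p q p' q') ≫
          (F.obj.obj (Q.l X p') ◁ Q.convι G K (Q.r X p') q') ≫ Q.convι F (Q.conv G K) X p') ≫ h' := by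
  rw [reassoc_of% convι_convAssoc_hom]

lemma convι_convAssoc_inv (X : I) (p : Q.idx X) (q : Q.idx (Q.r X p)) :
    (F.obj.obj (Q.l X p) ◁ Q.convι G K (Q.r X p) q) ≫ Q.convι F (Q.conv G K) X p ≫
      (Q.convAssoc F G K).inv.hom.app X =
        ∑ p', ∑ q', tmap₃ F G K (Q.aInv X p q p' q') ≫ (α_ _ _ _).inv ≫
          (Q.convι F G (Q.l X p') q' ▷ K.obj.obj (Q.r X p')) ≫
            Q.convι (Q.conv F G) K X p' := by
  rw [convAssoc_inv_app, reassoc_of% convι_convRightIsoApp_hom, reassoc_of% comulRightι_coassoc_inv]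
  simp only [Preadditive.sum_comp, Category.assoc, comulLeftι_convLeftIsoApp_inv]

lemma convι_convAssoc_inv_assoc (X : I) (p : Q.idx X) (q : Q.idx (Q.r X p)) {T : C}
    (h' : _ ⟶ T) :
    (F.obj.obj (Q.l X p) ◁ Q.convι G K (Q.r X p) q) ≫ Q.convι F (Q.conv G K) X p ≫
      (Q.convAssoc F G K).inv.hom.app X ≫ h' =
      (∑ p', ∑ q', tmap₃ F G K (Q.aInv X p q p' q') ≫ (α_ _ _ _).inv ≫
          (Q.convι F G (Q.l X p') q' ▷ K.obj.obj (Q.r X p')) ≫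
            Q.convι (Q.conv F G) K X p') ≫ h' := by
  rw [reassoc_of% convι_convAssoc_inv]

lemma isAssociator_convAssoc : Q.IsAssociator (C := C) Q.convAssoc := by
  intro F G K X p q p' q'
  rw [convι_convAssoc_hom_assoc]
  simp only [Preadditive.sum_comp, Category.assoc]
  -- Projecting to the summand `(p', q')` kills every other term.
  rw [Finset.sum_eq_single p' ?_ (by simp), Finset.sum_eq_single q' ?_ (by simp)]
  · rw [reassoc_of% convι_π_self, ← whiskerLeft_comp, convι_π_self, whiskerLeft_id, Category.comp_id]
    rfl
  · intro q'' _ h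
    rw [reassoc_of% convι_π_self, ← whiskerLeft_comp, convι_π_ne _ h]
    simp
  · intro p'' _ h
    refine Finset.sum_eq_zero fun q'' _ => ?_
    rw [reassoc_of% convι_π_ne _ h]
    simp

end Associator

end CoalgebraData

end KMat

end

/-! ### The unit isomorphisms -/

noncomputable section

namespace KMat

open MonoidalCategory

set_option linter.unusedSectionVars false

namespace CoalgebraData

variable {k : Type w} [CommRing k]
variable {I : Type u₁} [Category.{v₁} I] [Preadditive I] [Linear k I]
variable {C : Type u₂} [Category.{v₂} C] [Preadditive C] [Linear k C]
variable [MonoidalCategory C] [MonoidalPreadditive C] [MonoidalLinear k C]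
variable [HasFiniteBiproducts C]
variable (Q : CoalgebraData k I)

section Unitors

variable (F : LinFun k I C)

/-- The inclusion of `F X` into the value of `matLift F` at a one-element family. -/
def embι (X : I) : F.obj.obj X ⟶ (matLift F.obj).obj ((Mat_.embedding I).obj X) :=
  matι F.obj ((Mat_.embedding I).obj X) PUnit.unit

variable {F} in
lemma emb_ext {X : I} {Z : C} {f g : (matLift F.obj).obj ((Mat_.embedding I).obj X) ⟶ Z}
    (h : embι F X ≫ f = embι F X ≫ g) : f = g :=
  matι_ext fun _ => h

/-- The projection of the value of `matLift F` at a one-element family to `F X`. -/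
def embπ (X : I) : (matLift F.obj).obj ((Mat_.embedding I).obj X) ⟶ F.obj.obj X :=
  matDesc F.obj ((Mat_.embedding I).obj X) fun _ => 𝟙 (F.obj.obj X)

lemma embι_π (X : I) : embι F X ≫ embπ F X = 𝟙 _ :=
  matι_desc _ _ _ _

lemma embι_map {X Y : I} (f : X ⟶ Y) :
    embι F X ≫ (matLift F.obj).map ((Mat_.embedding I).map f) = F.obj.map f ≫ embι F Y :=
  (matι_map F.obj ((Mat_.embedding I).map f) PUnit.unit).trans (Fintype.sum_unique (ι := PUnit) _)

/-- The isomorphism `matLift F (X) ≅ F X` for a one-element family `X`, at an object. -/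
def embIsoApp (X : I) : (matLift F.obj).obj ((Mat_.embedding I).obj X) ≅ F.obj.obj X where
  hom := embπ F X
  inv := embι F X
  hom_inv_id := emb_ext (by rw [reassoc_of% embι_π, Category.comp_id])
  inv_hom_id := embι_π F X

lemma embι_isoApp_hom (X : I) : embι F X ≫ (embIsoApp F X).hom = 𝟙 _ :=
  embι_π F X

/-- The isomorphism `matLift F (X) ≅ F X` for a one-element family `X`. -/
def matLiftEmbeddingIso : Mat_.embedding I ⋙ matLift F.obj ≅ F.obj :=
  NatIso.ofComponents (embIsoApp F) fun {X Y} f => emb_ext (by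
    rw [Functor.comp_map, reassoc_of% embι_map, reassoc_of% embι_isoApp_hom, embι_isoApp_hom,
      Category.comp_id])

/-- The inclusion of a summand into `(× ∘ F ∘ (ε ⊠ id) ∘ Δ)(X)`. -/
def counitLeftι (X : I) (p : Q.idx X) (e : Q.eidx (Q.l X p)) :
    F.obj.obj (Q.r X p) ⟶ (matLift F.obj).obj (Q.counitLeftFun.obj X) :=
  matι F.obj (Q.counitLeftFun.obj X) ⟨p, (e, PUnit.unit)⟩

/-- The inclusion of a summand into `(× ∘ F ∘ (id ⊠ ε) ∘ Δ)(X)`. -/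
def counitRightι (X : I) (p : Q.idx X) (e : Q.eidx (Q.r X p)) :
    F.obj.obj (Q.l X p) ⟶ (matLift F.obj).obj (Q.counitRightFun.obj X) :=
  matι F.obj (Q.counitRightFun.obj X) ⟨p, (PUnit.unit, e)⟩

variable {F} in
lemma counitLeft_ext {X : I} {Z : C} {f g : (matLift F.obj).obj (Q.counitLeftFun.obj X) ⟶ Z}
    (h : ∀ p e, Q.counitLeftι F X p e ≫ f = Q.counitLeftι F X p e ≫ g) : f = g :=
  matι_ext fun i => h i.1 i.2.1

variable {F} in
lemma counitRight_ext {X : I} {Z : C} {f g : (matLift F.obj).obj (Q.counitRightFun.obj X) ⟶ Z}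
    (h : ∀ p e, Q.counitRightι F X p e ≫ f = Q.counitRightι F X p e ≫ g) : f = g :=
  matι_ext fun i => h i.1 i.2.2

/-- The morphism with given restrictions to the summands `counitLeftι`. -/
def counitLeftDesc (X : I) {Z : C}
    (f : ∀ (p : Q.idx X) (_ : Q.eidx (Q.l X p)), F.obj.obj (Q.r X p) ⟶ Z) :
    (matLift F.obj).obj (Q.counitLeftFun.obj X) ⟶ Z :=
  matDesc F.obj (Q.counitLeftFun.obj X) fun i => f i.1 i.2.1

/-- The morphism with given restrictions to the summands `counitRightι`. -/
def counitRightDesc (X : I) {Z : C}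
    (f : ∀ (p : Q.idx X) (_ : Q.eidx (Q.r X p)), F.obj.obj (Q.l X p) ⟶ Z) :
    (matLift F.obj).obj (Q.counitRightFun.obj X) ⟶ Z :=
  matDesc F.obj (Q.counitRightFun.obj X) fun i => f i.1 i.2.2

lemma counitLeftι_desc (X : I) {Z : C}
    (f : ∀ (p : Q.idx X) (_ : Q.eidx (Q.l X p)), F.obj.obj (Q.r X p) ⟶ Z) (p e) :
    Q.counitLeftι F X p e ≫ Q.counitLeftDesc F X f = f p e :=
  matι_desc _ _ _ _

lemma counitRightι_desc (X : I) {Z : C}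
    (f : ∀ (p : Q.idx X) (_ : Q.eidx (Q.r X p)), F.obj.obj (Q.l X p) ⟶ Z) (p e) :
    Q.counitRightι F X p e ≫ Q.counitRightDesc F X f = f p e :=
  matι_desc _ _ _ _

lemma counitLeftι_map {X Y : I} (f : X ⟶ Y) (p : Q.idx X) (e : Q.eidx (Q.l X p)) :
    Q.counitLeftι F X p e ≫ (matLift F.obj).map (Q.counitLeftFun.map f) =
      ∑ p', ∑ e', F.obj.map (Q.counitFst e e' (Q.comul p p' f)) ≫ Q.counitLeftι F Y p' e' :=
  (matι_map F.obj (Q.counitLeftFun.map f) ⟨p, (e, PUnit.unit)⟩).trans (sum_sigma_prod_punit _)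

lemma counitRightι_map {X Y : I} (f : X ⟶ Y) (p : Q.idx X) (e : Q.eidx (Q.r X p)) :
    Q.counitRightι F X p e ≫ (matLift F.obj).map (Q.counitRightFun.map f) =
      ∑ p', ∑ e', F.obj.map (Q.counitSnd e e' (Q.comul p p' f)) ≫ Q.counitRightι F Y p' e' :=
  (matι_map F.obj (Q.counitRightFun.map f) ⟨p, (PUnit.unit, e)⟩).trans (sum_sigma_punit_prod _)

lemma counitLeftι_counitLeft_hom (X : I) (p : Q.idx X) (e : Q.eidx (Q.l X p)) :
    Q.counitLeftι F X p e ≫ (matLift F.obj).map (Q.counitLeft.hom.app X) =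
      F.obj.map (Q.cl X p e) ≫ embι F X :=
  (matι_map F.obj (Q.counitLeft.hom.app X) ⟨p, (e, PUnit.unit)⟩).trans (Fintype.sum_unique (ι := PUnit) _)

lemma counitRightι_counitRight_hom (X : I) (p : Q.idx X) (e : Q.eidx (Q.r X p)) :
    Q.counitRightι F X p e ≫ (matLift F.obj).map (Q.counitRight.hom.app X) =
      F.obj.map (Q.cr X p e) ≫ embι F X :=
  (matι_map F.obj (Q.counitRight.hom.app X) ⟨p, (PUnit.unit, e)⟩).trans (Fintype.sum_unique (ι := PUnit) _)

/-- The isomorphism `(𝟙 ⊗ F)(X) ≅ (× ∘ F ∘ (ε ⊠ id) ∘ Δ)(X)`. -/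
def unitConvIsoApp (X : I) : (Q.conv Q.convUnit F).obj.obj X ≅
    (matLift F.obj).obj (Q.counitLeftFun.obj X) where
  hom := Q.convDesc _ _ X fun p => Q.unitDescRight _ fun e =>
    (λ_ _).hom ≫ Q.counitLeftι F X p e
  inv := Q.counitLeftDesc F X fun p e =>
    (λ_ _).inv ≫ (Q.unitι (Q.l X p) e ▷ F.obj.obj (Q.r X p)) ≫ Q.convι Q.convUnit F X p
  hom_inv_id := Q.conv_ext fun p => Q.unit_ext_right fun e => by
    rw [reassoc_of% convι_desc, reassoc_of% unitι_descRight, Category.assoc, Category.comp_id,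
      counitLeftι_desc, Iso.hom_inv_id_assoc]
  inv_hom_id := Q.counitLeft_ext fun p e => by
    rw [reassoc_of% counitLeftι_desc, Category.assoc, Category.assoc, convι_desc, unitι_descRight,
      Iso.inv_hom_id_assoc, Category.comp_id]

lemma unitι_unitConvIsoApp_hom (X : I) (p : Q.idx X) (e : Q.eidx (Q.l X p)) :
    (Q.unitι (Q.l X p) e ▷ F.obj.obj (Q.r X p)) ≫ Q.convι Q.convUnit F X p ≫
      (Q.unitConvIsoApp F X).hom = (λ_ _).hom ≫ Q.counitLeftι F X p e := by
  rw [unitConvIsoApp, convι_desc, unitι_descRight]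

/-- The isomorphism `(F ⊗ 𝟙)(X) ≅ (× ∘ F ∘ (id ⊠ ε) ∘ Δ)(X)`. -/
def convUnitIsoApp (X : I) : (Q.conv F Q.convUnit).obj.obj X ≅
    (matLift F.obj).obj (Q.counitRightFun.obj X) where
  hom := Q.convDesc _ _ X fun p => Q.unitDescLeft _ fun e =>
    (ρ_ _).hom ≫ Q.counitRightι F X p e
  inv := Q.counitRightDesc F X fun p e =>
    (ρ_ _).inv ≫ (F.obj.obj (Q.l X p) ◁ Q.unitι (Q.r X p) e) ≫ Q.convι F Q.convUnit X p
  hom_inv_id := Q.conv_ext fun p => Q.unit_ext_left fun e => by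
    rw [reassoc_of% convι_desc, reassoc_of% unitι_descLeft, Category.assoc, Category.comp_id,
      counitRightι_desc, Iso.hom_inv_id_assoc]
  inv_hom_id := Q.counitRight_ext fun p e => by
    rw [reassoc_of% counitRightι_desc, Category.assoc, Category.assoc, convι_desc, unitι_descLeft,
      Iso.inv_hom_id_assoc, Category.comp_id]

lemma unitι_convUnitIsoApp_hom (X : I) (p : Q.idx X) (e : Q.eidx (Q.r X p)) :
    (F.obj.obj (Q.l X p) ◁ Q.unitι (Q.r X p) e) ≫ Q.convι F Q.convUnit X p ≫
      (Q.convUnitIsoApp F X).hom = (ρ_ _).hom ≫ Q.counitRightι F X p e := by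
  rw [convUnitIsoApp, convι_desc, unitι_descLeft]

/-- The isomorphism `𝟙 ⊗ F ≅ × ∘ F ∘ (ε ⊠ id) ∘ Δ`. -/
def unitConvIso : (Q.conv Q.convUnit F).obj ≅ Q.counitLeftFun ⋙ matLift F.obj :=
  NatIso.ofComponents (Q.unitConvIsoApp F) fun {X Y} f => by
    refine Q.conv_ext fun p => Q.unit_ext_right fun e => ?_
    rw [reassoc_of% convι_map, reassoc_of% unitι_unitConvIsoApp_hom, Functor.comp_map, counitLeftι_map]
    simp only [Preadditive.comp_sum, Preadditive.sum_comp, Category.assoc, reassoc_of% unitι_tmap₂,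
      unitι_unitConvIsoApp_hom, Iso.inv_hom_id_assoc]

/-- The isomorphism `F ⊗ 𝟙 ≅ × ∘ F ∘ (id ⊠ ε) ∘ Δ`. -/
def convUnitIso : (Q.conv F Q.convUnit).obj ≅ Q.counitRightFun ⋙ matLift F.obj :=
  NatIso.ofComponents (Q.convUnitIsoApp F) fun {X Y} f => by
    refine Q.conv_ext fun p => Q.unit_ext_left fun e => ?_
    rw [reassoc_of% convι_map, reassoc_of% unitι_convUnitIsoApp_hom, Functor.comp_map, counitRightι_map]
    simp only [Preadditive.comp_sum, Preadditive.sum_comp, Category.assoc, reassoc_of% tmap₂_unitι,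
      unitι_convUnitIsoApp_hom, Iso.inv_hom_id_assoc]

/-- The left unit isomorphism of the convolution product. -/
def convLeftUnitor : Q.conv Q.convUnit F ≅ F :=
  ObjectProperty.isoMk _ (Q.unitConvIso F ≪≫
    Functor.isoWhiskerRight Q.counitLeft (matLift F.obj) ≪≫ matLiftEmbeddingIso F)

/-- The right unit isomorphism of the convolution product. -/
def convRightUnitor : Q.conv F Q.convUnit ≅ F :=
  ObjectProperty.isoMk _ (Q.convUnitIso F ≪≫
    Functor.isoWhiskerRight Q.counitRight (matLift F.obj) ≪≫ matLiftEmbeddingIso F)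

/-- The target of the counit isomorphism is a one-element family, so its matrix has a single column
and no sum remains. -/
lemma unitι_convLeftUnitor_hom (X : I) (p : Q.idx X) (e : Q.eidx (Q.l X p)) :
    (Q.unitι (Q.l X p) e ▷ F.obj.obj (Q.r X p)) ≫ Q.convι Q.convUnit F X p ≫
      (Q.convLeftUnitor F).hom.hom.app X = (λ_ _).hom ≫ F.obj.map (Q.cl X p e) := by
  have h : (Q.convLeftUnitor F).hom.hom.app X = (Q.unitConvIsoApp F X).hom ≫
    (matLift F.obj).map (Q.counitLeft.hom.app X) ≫ embπ F X := rfl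
  rw [h, reassoc_of% unitι_unitConvIsoApp_hom, reassoc_of% counitLeftι_counitLeft_hom, embι_π, Category.comp_id]

lemma unitι_convRightUnitor_hom (X : I) (p : Q.idx X) (e : Q.eidx (Q.r X p)) :
    (F.obj.obj (Q.l X p) ◁ Q.unitι (Q.r X p) e) ≫ Q.convι F Q.convUnit X p ≫
      (Q.convRightUnitor F).hom.hom.app X = (ρ_ _).hom ≫ F.obj.map (Q.cr X p e) := by
  have h : (Q.convRightUnitor F).hom.hom.app X = (Q.convUnitIsoApp F X).hom ≫
    (matLift F.obj).map (Q.counitRight.hom.app X) ≫ embπ F X := rfl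
  rw [h, reassoc_of% unitι_convUnitIsoApp_hom, reassoc_of% counitRightι_counitRight_hom, embι_π, Category.comp_id]

end Unitors

/-! ### The braiding -/

section Braiding

variable [BraidedCategory C]

/-- The transposition of `I ⊠ I` corresponds to the braiding of `C`; on pure tensors this is
naturality of the braiding. It makes `× ⋄ Ψ ⋄ (F ⊠ G) ∘ Δᵒᵖ` natural. -/
lemma tmap₂_swap (F G : LinFun k I C) {x x' y y' : I}
    (c : (⟨x, y⟩ : Box k I I) ⟶ ⟨x', y'⟩) :
    tmap₂ F G ((Box.swap k I I).map c) ≫ (β_ _ _).hom = (β_ _ _).hom ≫ tmap₂ G F c := by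
  induction c using Box.induction₂ with
  | zero =>
    rw [Functor.map_zero, map_zero, comp_zero]
    exact (congrArg (· ≫ _) (map_zero (tmap₂ F G))).trans zero_comp
  | add a b ha hb =>
    rw [Functor.map_add, map_add, Preadditive.comp_add, ← ha, ← hb, ← Preadditive.add_comp]
    exact congrArg (· ≫ _) (map_add (tmap₂ F G) _ _)
  | tens f g => exact BraidedCategory.braiding_naturality _ _

variable (F G : LinFun k I C)

/-- The inclusion of a summand into `(• ∘ (F ⊠ G) ∘ Δᵒᵖ)(X)`. -/
def opι (X : I) (p : Q.idx X) : F.obj.obj (Q.r X p) ⊗ G.obj.obj (Q.l X p) ⟶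
    (matLift (tensorBox (k := k) F.obj G.obj)).obj (Q.Δop.obj X) :=
  matι (tensorBox (k := k) F.obj G.obj) (Q.Δop.obj X) p

variable {F G} in
lemma op_ext {X : I} {Z : C}
    {f g : (matLift (tensorBox (k := k) F.obj G.obj)).obj (Q.Δop.obj X) ⟶ Z}
    (h : ∀ p : Q.idx X, Q.opι F G X p ≫ f = Q.opι F G X p ≫ g) : f = g :=
  matι_ext h

/-- The isomorphism `× ⋄ Ψ ⋄ (F ⊠ G) ∘ Δᵒᵖ` at `X`. -/
def opIsoApp (X : I) : (matLift (tensorBox (k := k) F.obj G.obj)).obj (Q.Δop.obj X) ≅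
    (Q.conv G F).obj.obj X :=
  biproduct.mapIso (f := fun p : Q.idx X => F.obj.obj (Q.r X p) ⊗ G.obj.obj (Q.l X p))
    (g := fun p : Q.idx X => G.obj.obj (Q.l X p) ⊗ F.obj.obj (Q.r X p))
    fun p => β_ (F.obj.obj (Q.r X p)) (G.obj.obj (Q.l X p))

lemma opι_opIsoApp_hom (X : I) (p : Q.idx X) :
    Q.opι F G X p ≫ (Q.opIsoApp F G X).hom = (β_ _ _).hom ≫ Q.convι G F X p :=
  biproduct.ι_map (f := fun p : Q.idx X => F.obj.obj (Q.r X p) ⊗ G.obj.obj (Q.l X p))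
    (g := fun p : Q.idx X => G.obj.obj (Q.l X p) ⊗ F.obj.obj (Q.r X p))
    (fun p => (β_ (F.obj.obj (Q.r X p)) (G.obj.obj (Q.l X p))).hom) p

lemma opι_map {X Y : I} (f : X ⟶ Y) (p : Q.idx X) :
    Q.opι F G X p ≫ (matLift (tensorBox (k := k) F.obj G.obj)).map (Q.Δop.map f) =
      ∑ q, tmap₂ F G ((Box.swap k I I).map (Q.comul p q f)) ≫ Q.opι F G Y q :=
  matι_map (tensorBox (k := k) F.obj G.obj) (Q.Δop.map f) p

/-- The isomorphism `× ⋄ Ψ ⋄ (F ⊠ G) ∘ Δᵒᵖ`. -/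
def opIso : Q.Δop ⋙ matLift (tensorBox (k := k) F.obj G.obj) ≅ (Q.conv G F).obj :=
  NatIso.ofComponents (Q.opIsoApp F G) fun {X Y} f => by
    refine Q.op_ext fun p => ?_
    rw [Functor.comp_map, Functor.comp_map, reassoc_of% opι_map, reassoc_of% opι_opIsoApp_hom, convι_map]
    simp only [Preadditive.comp_sum, Preadditive.sum_comp, Category.assoc, opι_opIsoApp_hom]
    refine Finset.sum_congr rfl fun q _ => ?_
    exact (Category.assoc _ _ _).symm.trans
      ((congrArg (· ≫ _) (tmap₂_swap F G (Q.comul p q f))).trans (Category.assoc _ _ _))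

variable (R : Q.Δ ≅ Q.Δop)

/-- The braiding of the convolution product. -/
def convBraiding : Q.conv F G ≅ Q.conv G F :=
  ObjectProperty.isoMk _ (Functor.isoWhiskerRight R (matLift (tensorBox (k := k) F.obj G.obj)) ≪≫
    Q.opIso F G)

/-- The component `• ∘ (F ⊠ G) ⋄ R` at `X`. -/
def braidingMap (X : I) : (Q.conv F G).obj.obj X ⟶
    (matLift (tensorBox (k := k) F.obj G.obj)).obj (Q.Δop.obj X) :=
  (matLift (tensorBox (k := k) F.obj G.obj)).map (R.hom.app X)

lemma convι_braidingMap (X : I) (p : Q.idx X) :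
    Q.convι F G X p ≫ Q.braidingMap F G R X =
      ∑ q, tmap₂ F G (Q.R₂ R X p q) ≫ Q.opι F G X q :=
  matι_map (tensorBox (k := k) F.obj G.obj) (R.hom.app X) p

lemma convι_convBraiding_hom (X : I) (p : Q.idx X) :
    Q.convι F G X p ≫ (Q.convBraiding F G R).hom.hom.app X =
      ∑ q, tmap₂ F G (Q.R₂ R X p q) ≫ (β_ _ _).hom ≫ Q.convι G F X q := by
  have h : (Q.convBraiding F G R).hom.hom.app X =
    Q.braidingMap F G R X ≫ (Q.opIsoApp F G X).hom := rfl
  rw [h, reassoc_of% convι_braidingMap]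
  simp only [Preadditive.sum_comp, Category.assoc, opι_opIsoApp_hom]

lemma isBraiding_convBraiding : Q.IsBraiding (C := C) R fun F G => Q.convBraiding F G R :=
  fun _ _ _ => rfl

end Braiding

end CoalgebraData

end KMat

end

/-! ### Reordering of sums, functoriality and naturality of the convolution product -/

noncomputable section

namespace KMat

open MonoidalCategory

set_option linter.unusedSectionVars false

/-- The three-edge side of the pentagon, expanded edge by edge, has the intermediate indices `u'`,
`v'` between the target indices `t` and `u`, `v`. The pentagon of `I` is given for a fixed target,
so `t`, `u`, `v` must come outermost; since `u` and `v` depend on `t`, they move one at a time. -/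
lemma sum_pentagon_comm {M : Type*} [AddCommMonoid M] {A : Type} [Fintype A] {B : A → Type}
    [∀ a, Fintype (B a)] {T : Type} [Fintype T] {U : T → Type} [∀ t, Fintype (U t)]
    {V V' : ∀ t, U t → Type} [∀ t u, Fintype (V t u)] [∀ t u, Fintype (V' t u)]
    (f : ∀ a (_ : B a) t u' (_ : V' t u') u (_ : V t u), M) :
    ∑ a, ∑ b, ∑ t, ∑ u', ∑ v', ∑ u, ∑ v, f a b t u' v' u v =
      ∑ t, ∑ u, ∑ v, ∑ a, ∑ b, ∑ u', ∑ v', f a b t u' v' u v := by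
  have h : ∀ {A T : Type} [Fintype A] [Fintype T] {B : A → Type} [∀ a, Fintype (B a)]
      (g : ∀ a (_ : B a) (_ : T), M), ∑ a, ∑ b, ∑ t, g a b t = ∑ t, ∑ a, ∑ b, g a b t := by
    intro A T _ _ B _ g
    rw [Finset.sum_comm (s := (Finset.univ : Finset T))]
    exact Finset.sum_congr rfl fun a _ => Finset.sum_comm
  rw [h]
  refine Finset.sum_congr rfl fun t _ => ?_
  calc _ = ∑ a, ∑ b, ∑ u, ∑ v, ∑ u', ∑ v', f a b t u' v' u v :=
        Finset.sum_congr rfl fun a _ => Finset.sum_congr rfl fun b _ => by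
          rw [h]
          exact Finset.sum_congr rfl fun u _ => h _
    _ = _ := by
          rw [h]
          exact Finset.sum_congr rfl fun u _ => h _

/-- The same reordering for the two-edge side of the pentagon. -/
lemma sum_triple_comm {M : Type*} [AddCommMonoid M] {A : Type} [Fintype A] {B B' : A → Type}
    [∀ a, Fintype (B a)] [∀ a, Fintype (B' a)] {T : Type} [Fintype T] {U : T → Type}
    [∀ t, Fintype (U t)] {V : ∀ t, U t → Type} [∀ t u, Fintype (V t u)]
    (f : ∀ a (_ : B a) (_ : B' a) t u (_ : V t u), M) :
    ∑ a, ∑ b, ∑ b', ∑ t, ∑ u, ∑ v, f a b b' t u v =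
      ∑ t, ∑ u, ∑ v, ∑ a, ∑ b, ∑ b', f a b b' t u v := by
  have h : ∀ {A T : Type} [Fintype A] [Fintype T] {B B' : A → Type} [∀ a, Fintype (B a)]
      [∀ a, Fintype (B' a)] (g : ∀ a (_ : B a) (_ : B' a) (_ : T), M),
      ∑ a, ∑ b, ∑ b', ∑ t, g a b b' t = ∑ t, ∑ a, ∑ b, ∑ b', g a b b' t := by
    intro A T _ _ B B' _ _ g
    rw [Finset.sum_comm (s := (Finset.univ : Finset T))]
    refine Finset.sum_congr rfl fun a _ => ?_
    rw [Finset.sum_comm (s := (Finset.univ : Finset T))]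
    exact Finset.sum_congr rfl fun b _ => Finset.sum_comm
  rw [h]
  refine Finset.sum_congr rfl fun t _ => ?_
  rw [h]
  exact Finset.sum_congr rfl fun u _ => h _

section Ext

variable {C : Type u₁} [Category.{v₁} C] [Preadditive C] [HasFiniteBiproducts C]
variable [MonoidalCategory C] [MonoidalPreadditive C]

/-- Restriction to summands of a factor enclosed on both sides, as the unit object is in the
triangle diagram. -/
lemma leftDistributor_whiskerRight_ext {J : Type} [Fintype J] {A : J → C} {W W' Z : C}
    {f g : (W ⊗ ⨁ A) ⊗ W' ⟶ Z}
    (h : ∀ j, ((W ◁ biproduct.ι A j) ▷ W') ≫ f = ((W ◁ biproduct.ι A j) ▷ W') ≫ g) : f = g := by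
  rw [← cancel_epi ((leftDistributor W A).inv ▷ W')]
  refine rightDistributor_ext_left fun j => ?_
  rw [← comp_whiskerRight_assoc, ← comp_whiskerRight_assoc,
    biproduct_ι_comp_leftDistributor_inv, h]

end Ext

section LinFun

variable {k : Type w} [CommRing k]
variable {I : Type u₁} [Category.{v₁} I] [Preadditive I] [Linear k I]
variable {C : Type u₂} [Category.{v₂} C] [Preadditive C] [Linear k C]

lemma linFun_ext {F G : LinFun k I C} {φ ψ : F ⟶ G} (h : ∀ X, φ.hom.app X = ψ.hom.app X) :
    φ = ψ :=
  ObjectProperty.hom_ext _ (NatTrans.ext (funext h))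

lemma linFun_comp_app {F G H : LinFun k I C} (φ : F ⟶ G) (ψ : G ⟶ H) (X : I) :
    (φ ≫ ψ).hom.app X = φ.hom.app X ≫ ψ.hom.app X := rfl

lemma linFun_id_app (F : LinFun k I C) (X : I) :
    (𝟙 F : F ⟶ F).hom.app X = 𝟙 (F.obj.obj X) := rfl

variable [MonoidalCategory C] [MonoidalPreadditive C] [MonoidalLinear k C]

lemma tmap₂_naturality {F F' G G' : LinFun k I C} (φ : F ⟶ F') (χ : G ⟶ G') {x x' y y' : I}
    (c : (⟨x, y⟩ : Box k I I) ⟶ ⟨x', y'⟩) :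
    tmap₂ F G c ≫ (φ.hom.app x' ⊗ₘ χ.hom.app y') =
      (φ.hom.app x ⊗ₘ χ.hom.app y) ≫ tmap₂ F' G' c :=
  (tensorBoxHom (k := k) φ.hom χ.hom).naturality c

lemma tmap₃_naturality {F F' G G' K K' : LinFun k I C} (φ : F ⟶ F') (χ : G ⟶ G') (ψ : K ⟶ K')
    {x x' y y' z z' : I} (c : (⟨x, ⟨y, z⟩⟩ : Box k I (Box k I I)) ⟶ ⟨x', ⟨y', z'⟩⟩) :
    tmap₃ F G K c ≫ (φ.hom.app x' ⊗ₘ (χ.hom.app y' ⊗ₘ ψ.hom.app z')) =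
      (φ.hom.app x ⊗ₘ (χ.hom.app y ⊗ₘ ψ.hom.app z)) ≫ tmap₃ F' G' K' c :=
  (tensorBoxHom (k := k) φ.hom (tensorBoxHom (k := k) χ.hom ψ.hom)).naturality c

/-- Absorbs a whiskering by `F` into the evaluation, as an identity in the first slot. -/
lemma whiskerLeft_tmap₂ (F G K : LinFun k I C) (x : I) {y y' z z' : I}
    (c : (⟨y, z⟩ : Box k I I) ⟶ ⟨y', z'⟩) :
    F.obj.obj x ◁ tmap₂ G K c = tmap₃ F G K (Box.tens k (𝟙 x) c) := by
  rw [tmap₃_tens, CategoryTheory.Functor.map_id, id_tensorHom]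

lemma whiskerLeft_tmap₃ (F G K H : LinFun k I C) (x : I) {y y' z z' w w' : I}
    (c : (⟨y, ⟨z, w⟩⟩ : Box k I (Box k I I)) ⟶ ⟨y', ⟨z', w'⟩⟩) :
    F.obj.obj x ◁ tmap₃ G K H c = tmap₄ F G K H (Box.tens k (𝟙 x) c) := by
  rw [tmap₄_tens, CategoryTheory.Functor.map_id, id_tensorHom]

end LinFun

namespace CoalgebraData

variable {k : Type w} [CommRing k]
variable {I : Type u₁} [Category.{v₁} I] [Preadditive I] [Linear k I]
variable {C : Type u₂} [Category.{v₂} C] [Preadditive C] [Linear k C]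
variable [MonoidalCategory C] [MonoidalPreadditive C] [MonoidalLinear k C]
variable [HasFiniteBiproducts C]
variable (Q : CoalgebraData k I)

section Functoriality

variable {F F' F'' G G' G'' K K' : LinFun k I C}

lemma convHom_id : Q.convHom (𝟙 F) (𝟙 G) = 𝟙 (Q.conv F G) :=
  linFun_ext fun X => Q.conv_ext fun p => by
    rw [convι_convHom, linFun_id_app, linFun_id_app, linFun_id_app, id_tensorHom_id,
      Category.id_comp, Category.comp_id]

lemma convHom_comp (φ : F ⟶ F') (φ' : F' ⟶ F'') (χ : G ⟶ G') (χ' : G' ⟶ G'') :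
    Q.convHom φ χ ≫ Q.convHom φ' χ' = Q.convHom (φ ≫ φ') (χ ≫ χ') :=
  linFun_ext fun X => Q.conv_ext fun p => by
    rw [linFun_comp_app, reassoc_of% convι_convHom, convι_convHom, convι_convHom, linFun_comp_app,
      linFun_comp_app, tensorHom_comp_tensorHom_assoc]

lemma convHom_zero (φ : F ⟶ F') : Q.convHom φ (0 : G ⟶ G') = 0 :=
  linFun_ext fun X => Q.conv_ext fun p => by
    rw [convι_convHom]
    exact (congrArg (· ≫ _) (MonoidalPreadditive.tensor_zero _)).trans
      (zero_comp.trans comp_zero.symm)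

lemma zero_convHom (χ : G ⟶ G') : Q.convHom (0 : F ⟶ F') χ = 0 :=
  linFun_ext fun X => Q.conv_ext fun p => by
    rw [convι_convHom]
    exact (congrArg (· ≫ _) (MonoidalPreadditive.zero_tensor _)).trans
      (zero_comp.trans comp_zero.symm)

lemma convHom_add (φ : F ⟶ F') (χ χ' : G ⟶ G') :
    Q.convHom φ (χ + χ') = Q.convHom φ χ + Q.convHom φ χ' :=
  linFun_ext fun X => Q.conv_ext fun p => by
    have h : (Q.convHom φ χ + Q.convHom φ χ').hom.app X =
      (Q.convHom φ χ).hom.app X + (Q.convHom φ χ').hom.app X := rfl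
    rw [h, Preadditive.comp_add, convι_convHom, convι_convHom, convι_convHom,
      ← Preadditive.add_comp, ← MonoidalPreadditive.tensor_add]
    rfl

lemma add_convHom (φ φ' : F ⟶ F') (χ : G ⟶ G') :
    Q.convHom (φ + φ') χ = Q.convHom φ χ + Q.convHom φ' χ :=
  linFun_ext fun X => Q.conv_ext fun p => by
    have h : (Q.convHom φ χ + Q.convHom φ' χ).hom.app X =
      (Q.convHom φ χ).hom.app X + (Q.convHom φ' χ).hom.app X := rfl
    rw [h, Preadditive.comp_add, convι_convHom, convι_convHom, convι_convHom,
      ← Preadditive.add_comp, ← MonoidalPreadditive.add_tensor]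
    rfl

lemma convHom_smul (r : k) (φ : F ⟶ F') (χ : G ⟶ G') :
    Q.convHom φ (r • χ) = r • Q.convHom φ χ :=
  linFun_ext fun X => Q.conv_ext fun p => by
    have h : (r • Q.convHom φ χ).hom.app X = r • (Q.convHom φ χ).hom.app X := rfl
    have h' : (r • χ).hom.app (Q.r X p) = r • χ.hom.app (Q.r X p) := rfl
    rw [h, Linear.comp_smul, convι_convHom, convι_convHom, h', ← Linear.smul_comp]
    simp [MonoidalCategory.tensorHom_def]

lemma smul_convHom (r : k) (φ : F ⟶ F') (χ : G ⟶ G') :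
    Q.convHom (r • φ) χ = r • Q.convHom φ χ :=
  linFun_ext fun X => Q.conv_ext fun p => by
    have h : (r • Q.convHom φ χ).hom.app X = r • (Q.convHom φ χ).hom.app X := rfl
    have h' : (r • φ).hom.app (Q.l X p) = r • φ.hom.app (Q.l X p) := rfl
    rw [h, Linear.comp_smul, convι_convHom, convι_convHom, h', ← Linear.smul_comp]
    simp [MonoidalCategory.tensorHom_def]

lemma convι_convHom_left (φ : F ⟶ F') (X : I) (p : Q.idx X) :
    Q.convι F G X p ≫ (Q.convHom φ (𝟙 G)).hom.app X =
      (φ.hom.app _ ▷ G.obj.obj _) ≫ Q.convι F' G X p := by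
  rw [convι_convHom, linFun_id_app, tensorHom_id]

lemma convι_convHom_right (χ : G ⟶ G') (X : I) (p : Q.idx X) :
    Q.convι F G X p ≫ (Q.convHom (𝟙 F) χ).hom.app X =
      (F.obj.obj _ ◁ χ.hom.app _) ≫ Q.convι F G' X p := by
  rw [convι_convHom, linFun_id_app, id_tensorHom]

/-- The entries agree one by one: the associativity of `C` is natural, and `F ⊠ G ⊠ K` on a fixed
entry of `a` is natural in the three functors. -/
lemma convAssoc_naturality (φ : F ⟶ F') (χ : G ⟶ G') (ψ : K ⟶ K') :
    Q.convHom (Q.convHom φ χ) ψ ≫ (Q.convAssoc F' G' K').hom =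
      (Q.convAssoc F G K).hom ≫ Q.convHom φ (Q.convHom χ ψ) :=
  linFun_ext fun X => Q.conv_ext fun p => Q.conv_ext_right fun q => by
    rw [linFun_comp_app, linFun_comp_app, reassoc_of% convι_convHom, convι_convAssoc_hom_assoc,
      ← tensorHom_id, tensorHom_comp_tensorHom_assoc, convι_convHom, Category.id_comp,
      -- Splits off the inclusion of the inner summand, so that the formula for the associator
      -- applies after `(φ ⊗ χ) ⊗ ψ`.
      ← Category.comp_id (ψ.hom.app _), ← tensorHom_comp_tensorHom_assoc, tensorHom_id,
      convι_convAssoc_hom]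
    simp only [Preadditive.comp_sum, Preadditive.sum_comp, Category.assoc]
    refine Finset.sum_congr rfl fun p' _ => Finset.sum_congr rfl fun q' _ => ?_
    rw [associator_naturality_assoc, ← reassoc_of% tmap₃_naturality, convι_convHom, ← id_tensorHom,
      ← id_tensorHom, tensorHom_comp_tensorHom_assoc, tensorHom_comp_tensorHom_assoc,
      convι_convHom, Category.id_comp, Category.comp_id]

lemma convLeftUnitor_naturality (φ : F ⟶ F') :
    Q.convHom (𝟙 Q.convUnit) φ ≫ (Q.convLeftUnitor F').hom = (Q.convLeftUnitor F).hom ≫ φ :=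
  linFun_ext fun X => Q.conv_ext fun p => Q.unit_ext_right fun e => by
    rw [linFun_comp_app, linFun_comp_app, reassoc_of% convι_convHom_right,
      reassoc_of% unitι_convLeftUnitor_hom, ← whisker_exchange_assoc, unitι_convLeftUnitor_hom,
      φ.hom.naturality]
    simp

lemma convRightUnitor_naturality (φ : F ⟶ F') :
    Q.convHom φ (𝟙 Q.convUnit) ≫ (Q.convRightUnitor F').hom = (Q.convRightUnitor F).hom ≫ φ :=
  linFun_ext fun X => Q.conv_ext fun p => Q.unit_ext_left fun e => by
    rw [linFun_comp_app, linFun_comp_app, reassoc_of% convι_convHom_left,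
      reassoc_of% unitι_convRightUnitor_hom, whisker_exchange_assoc, unitι_convRightUnitor_hom,
      φ.hom.naturality]
    simp

end Functoriality

/-! ### The pentagon -/

section Pentagon

variable (F G H K : LinFun k I C)

/-- First edge of the three-edge side. The row of the associator of `F`, `G`, `H` at `Q.l X p` is
tensored with `K`. -/
lemma convι_convHom_convAssoc_left (X : I) (p : Q.idx X) (q : Q.idx (Q.l X p))
    (s : Q.idx (Q.l (Q.l X p) q)) :
    ((Q.convι F G _ s ▷ H.obj.obj _) ▷ K.obj.obj _) ≫ (Q.convι (Q.conv F G) H _ q ▷ K.obj.obj _) ≫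
      Q.convι (Q.conv (Q.conv F G) H) K X p ≫
        (Q.convHom (Q.convAssoc F G H).hom (𝟙 K)).hom.app X =
      ∑ q', ∑ s', ((α_ _ _ _).hom ▷ K.obj.obj _) ≫
        (tmap₃ F G H (Q.a (Q.l X p) q s q' s') ▷ K.obj.obj _) ≫
          ((F.obj.obj _ ◁ Q.convι G H _ s') ▷ K.obj.obj _) ≫
            (Q.convι F (Q.conv G H) _ q' ▷ K.obj.obj _) ≫
              Q.convι (Q.conv F (Q.conv G H)) K X p := by
  rw [convι_convHom_left, ← comp_whiskerRight_assoc, ← comp_whiskerRight_assoc, Category.assoc,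
    convι_convAssoc_hom]
  simp only [sum_whiskerRight, comp_whiskerRight, Preadditive.sum_comp, Category.assoc]

lemma convι_convHom_convAssoc_left_assoc (X : I) (p : Q.idx X) (q : Q.idx (Q.l X p))
    (s : Q.idx (Q.l (Q.l X p) q)) {T : C}
    (h' : _ ⟶ T) :
    ((Q.convι F G _ s ▷ H.obj.obj _) ▷ K.obj.obj _) ≫ (Q.convι (Q.conv F G) H _ q ▷ K.obj.obj _) ≫
      Q.convι (Q.conv (Q.conv F G) H) K X p ≫
        (Q.convHom (Q.convAssoc F G H).hom (𝟙 K)).hom.app X ≫ h' =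
      (∑ q', ∑ s', ((α_ _ _ _).hom ▷ K.obj.obj _) ≫
        (tmap₃ F G H (Q.a (Q.l X p) q s q' s') ▷ K.obj.obj _) ≫
          ((F.obj.obj _ ◁ Q.convι G H _ s') ▷ K.obj.obj _) ≫
            (Q.convι F (Q.conv G H) _ q' ▷ K.obj.obj _) ≫
              Q.convι (Q.conv F (Q.conv G H)) K X p) ≫ h' := by
  rw [reassoc_of% convι_convHom_convAssoc_left]

/-- Second edge, starting from the inclusions in which the first one ends. The middle functor is
itself a product, so `Δ` is applied to the middle slot of `a`. -/
lemma convι_convAssoc_middle (X : I) (p : Q.idx X) (q : Q.idx (Q.l X p))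
    (s : Q.idx (Q.r (Q.l X p) q)) :
    ((F.obj.obj _ ◁ Q.convι G H _ s) ▷ K.obj.obj _) ≫
      (Q.convι F (Q.conv G H) _ q ▷ K.obj.obj _) ≫ Q.convι (Q.conv F (Q.conv G H)) K X p ≫
        (Q.convAssoc F (Q.conv G H) K).hom.hom.app X =
      ∑ t, ∑ u, ∑ v, (α_ _ _ _).hom ≫ (_ ◁ (α_ _ _ _).hom) ≫
        tmap₄ F G H K (Box.homMap LinearMap.id (Q.comulFst s v) (Q.a X p q t u)) ≫
          (_ ◁ (α_ _ _ _).inv) ≫ (F.obj.obj _ ◁ (Q.convι G H _ v ▷ K.obj.obj _)) ≫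
            (F.obj.obj _ ◁ Q.convι (Q.conv G H) K _ u) ≫ Q.convι F _ X t := by
  rw [convι_convAssoc_hom]
  simp only [Preadditive.comp_sum]
  refine Finset.sum_congr rfl fun t _ => Finset.sum_congr rfl fun u _ => ?_
  rw [associator_naturality_middle_assoc, reassoc_of% tmap₃_convι_left]
  simp only [Preadditive.comp_sum, Preadditive.sum_comp, Category.assoc]

lemma convι_convAssoc_middle_assoc (X : I) (p : Q.idx X) (q : Q.idx (Q.l X p))
    (s : Q.idx (Q.r (Q.l X p) q)) {T : C}
    (h' : _ ⟶ T) :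
    ((F.obj.obj _ ◁ Q.convι G H _ s) ▷ K.obj.obj _) ≫
      (Q.convι F (Q.conv G H) _ q ▷ K.obj.obj _) ≫ Q.convι (Q.conv F (Q.conv G H)) K X p ≫
        (Q.convAssoc F (Q.conv G H) K).hom.hom.app X ≫ h' =
      (∑ t, ∑ u, ∑ v, (α_ _ _ _).hom ≫ (_ ◁ (α_ _ _ _).hom) ≫
        tmap₄ F G H K (Box.homMap LinearMap.id (Q.comulFst s v) (Q.a X p q t u)) ≫
          (_ ◁ (α_ _ _ _).inv) ≫ (F.obj.obj _ ◁ (Q.convι G H _ v ▷ K.obj.obj _)) ≫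
            (F.obj.obj _ ◁ Q.convι (Q.conv G H) K _ u) ≫ Q.convι F _ X t) ≫ h' := by
  rw [reassoc_of% convι_convAssoc_middle]

/-- Third edge. The inverse associator at the start is the one left over by the second edge. -/
lemma convι_convHom_convAssoc_right (X : I) (t : Q.idx X) (u : Q.idx (Q.r X t))
    (v : Q.idx (Q.l (Q.r X t) u)) :
    (_ ◁ (α_ _ _ _).inv) ≫ (F.obj.obj _ ◁ (Q.convι G H _ v ▷ K.obj.obj _)) ≫
      (F.obj.obj _ ◁ Q.convι (Q.conv G H) K _ u) ≫ Q.convι F (Q.conv (Q.conv G H) K) X t ≫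
        (Q.convHom (𝟙 F) (Q.convAssoc G H K).hom).hom.app X =
      ∑ u', ∑ v', tmap₄ F G H K (Box.tens k (𝟙 (Q.l X t)) (Q.a (Q.r X t) u v u' v')) ≫
        (F.obj.obj _ ◁ (G.obj.obj _ ◁ Q.convι H K _ v')) ≫
          (F.obj.obj _ ◁ Q.convι G (Q.conv H K) _ u') ≫ Q.convι F _ X t := by
  rw [convι_convHom_right, ← whiskerLeft_comp_assoc, ← whiskerLeft_comp_assoc,
    ← whiskerLeft_comp_assoc, Category.assoc, Category.assoc, convι_convAssoc_hom]
  simp only [Preadditive.comp_sum, whiskerLeft_sum, Preadditive.sum_comp, Iso.inv_hom_id_assoc,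
    whiskerLeft_comp, Category.assoc, whiskerLeft_tmap₃]

/-- First edge of the two-edge side: `Δ` acts on the first slot of `a`. The inclusions of the two
inner summands are exchanged at the end to fit the next edge. -/
lemma convι_convAssoc_left (X : I) (p : Q.idx X) (q : Q.idx (Q.l X p))
    (s : Q.idx (Q.l (Q.l X p) q)) :
    ((Q.convι F G _ s ▷ H.obj.obj _) ▷ K.obj.obj _) ≫ (Q.convι (Q.conv F G) H _ q ▷ K.obj.obj _) ≫
      Q.convι (Q.conv (Q.conv F G) H) K X p ≫
        (Q.convAssoc (Q.conv F G) H K).hom.hom.app X =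
      ∑ p', ∑ q', ∑ s', (α_ _ _ _).hom ≫ (α_ _ _ _).hom ≫
        tmap₄ F G H K (Q.comulFst s s' (Q.a X p q p' q')) ≫ (α_ _ _ _).inv ≫
          ((_ ⊗ _) ◁ Q.convι H K _ q') ≫ (Q.convι F G _ s' ▷ _) ≫
            Q.convι (Q.conv F G) (Q.conv H K) X p' := by
  rw [convι_convAssoc_hom]
  simp only [Preadditive.comp_sum]
  refine Finset.sum_congr rfl fun p' _ => Finset.sum_congr rfl fun q' _ => ?_
  rw [associator_naturality_left_assoc, reassoc_of% convι_tmap₃]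
  simp only [Preadditive.comp_sum, Preadditive.sum_comp, Category.assoc, whisker_exchange_assoc]

lemma convι_convAssoc_left_assoc (X : I) (p : Q.idx X) (q : Q.idx (Q.l X p))
    (s : Q.idx (Q.l (Q.l X p) q)) {T : C}
    (h' : _ ⟶ T) :
    ((Q.convι F G _ s ▷ H.obj.obj _) ▷ K.obj.obj _) ≫ (Q.convι (Q.conv F G) H _ q ▷ K.obj.obj _) ≫
      Q.convι (Q.conv (Q.conv F G) H) K X p ≫
        (Q.convAssoc (Q.conv F G) H K).hom.hom.app X ≫ h' =
      (∑ p', ∑ q', ∑ s', (α_ _ _ _).hom ≫ (α_ _ _ _).hom ≫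
        tmap₄ F G H K (Q.comulFst s s' (Q.a X p q p' q')) ≫ (α_ _ _ _).inv ≫
          ((_ ⊗ _) ◁ Q.convι H K _ q') ≫ (Q.convι F G _ s' ▷ _) ≫
            Q.convι (Q.conv F G) (Q.conv H K) X p') ≫ h' := by
  rw [reassoc_of% convι_convAssoc_left]

lemma convι_convAssoc_right (X : I) (p : Q.idx X) (s : Q.idx (Q.l X p)) (q : Q.idx (Q.r X p)) :
    (α_ _ _ _).inv ≫ ((_ ⊗ _) ◁ Q.convι H K _ q) ≫ (Q.convι F G _ s ▷ _) ≫
      Q.convι (Q.conv F G) (Q.conv H K) X p ≫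
        (Q.convAssoc F G (Q.conv H K)).hom.hom.app X =
      ∑ t, ∑ u, ∑ v,
        tmap₄ F G H K (Box.homMap LinearMap.id (Q.comulSnd q v) (Q.a X p s t u)) ≫
          (F.obj.obj _ ◁ (G.obj.obj _ ◁ Q.convι H K _ v)) ≫
            (F.obj.obj _ ◁ Q.convι G (Q.conv H K) _ u) ≫ Q.convι F _ X t := by
  rw [convι_convAssoc_hom]
  simp only [Preadditive.comp_sum]
  refine Finset.sum_congr rfl fun t _ => Finset.sum_congr rfl fun u _ => ?_
  rw [associator_naturality_right_assoc, Iso.inv_hom_id_assoc, reassoc_of% tmap₃_convι_right]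
  simp only [Preadditive.sum_comp, Category.assoc]

lemma convAssoc_pentagon (hQ : Q.Pentagon) :
    Q.convHom (Q.convAssoc F G H).hom (𝟙 K) ≫ (Q.convAssoc F (Q.conv G H) K).hom ≫
      Q.convHom (𝟙 F) (Q.convAssoc G H K).hom =
    (Q.convAssoc (Q.conv F G) H K).hom ≫ (Q.convAssoc F G (Q.conv H K)).hom := by
  refine linFun_ext fun X => Q.conv_ext fun p => Q.conv_ext_right fun q =>
    rightDistributor_ext₂_left (J := Q.idx _) fun s => ?_
  change ((Q.convι F G _ s ▷ H.obj.obj _) ▷ K.obj.obj _) ≫ _ =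
    ((Q.convι F G _ s ▷ H.obj.obj _) ▷ K.obj.obj _) ≫ _
  rw [linFun_comp_app, linFun_comp_app, linFun_comp_app, convι_convHom_convAssoc_left_assoc,
    convι_convAssoc_left_assoc]
  simp only [Preadditive.comp_sum, Preadditive.sum_comp, Category.assoc,
    convι_convAssoc_middle_assoc, convι_convHom_convAssoc_right, convι_convAssoc_right]
  -- The associators of `C` are moved in front of the evaluations; the pentagon of `C` then makes
  -- them equal to those of the other side.
  simp only [tmap₄_tensorId_assoc, MonoidalCategory.pentagon_assoc]
  rw [sum_pentagon_comm, sum_triple_comm]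
  refine Finset.sum_congr rfl fun t _ => Finset.sum_congr rfl fun u _ =>
    Finset.sum_congr rfl fun v _ => ?_
  -- With the target summand fixed, what remains is the image under `tmap₄` of the pentagon of `I`.
  have h := congrArg (fun c => (α_ _ _ _).hom ≫ (α_ _ _ _).hom ≫ tmap₄ F G H K c ≫
    (F.obj.obj _ ◁ (G.obj.obj _ ◁ Q.convι H K _ v)) ≫
      (F.obj.obj _ ◁ Q.convι G (Q.conv H K) _ u) ≫ Q.convι F _ X t) (hQ X p q s t u v)
  simpa only [map_sum, tmap₄_comp, Preadditive.comp_sum, Preadditive.sum_comp, Category.assoc]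
    using h

end Pentagon

/-! ### The triangle -/

section Triangle

variable (F G : LinFun k I C)

/-- One side of the triangle of `I` contains the identity matrix of `Δ X`; its evaluation acts as a
Kronecker delta and collapses the sum over target summands. -/
lemma sum_tmap₂_id (X : I) (p : Q.idx X) {Z : C}
    (f : ∀ t : Q.idx X, F.obj.obj (Q.l X t) ⊗ G.obj.obj (Q.r X t) ⟶ Z) :
    ∑ t, tmap₂ F G ((𝟙 (Q.Δ.obj X) : Q.Δ.obj X ⟶ Q.Δ.obj X) p t) ≫ f t = f p := by
  rw [Finset.sum_eq_single p ?_ (by simp), Mat_.id_apply_self]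
  · exact (congrArg (· ≫ f p) (tmap₂_id F G)).trans (Category.id_comp _)
  · intro t _ ht
    rw [Mat_.id_apply_of_ne _ _ _ ht.symm]
    exact (congrArg (· ≫ f t) (map_zero (tmap₂ F G))).trans zero_comp

lemma unitι_convHom_convLeftUnitor (X : I) (t : Q.idx X) (u : Q.idx (Q.r X t))
    (e : Q.eidx (Q.l (Q.r X t) u)) :
    (F.obj.obj (Q.l X t) ◁ (λ_ (G.obj.obj (Q.r (Q.r X t) u))).inv) ≫
      (F.obj.obj (Q.l X t) ◁ (Q.unitι (Q.l (Q.r X t) u) e ▷ G.obj.obj (Q.r (Q.r X t) u))) ≫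
        (F.obj.obj (Q.l X t) ◁ Q.convι Q.convUnit G (Q.r X t) u) ≫
          Q.convι F (Q.conv Q.convUnit G) X t ≫
            (Q.convHom (𝟙 F) (Q.convLeftUnitor G).hom).hom.app X =
      tmap₂ F G (Box.tens k (𝟙 (Q.l X t)) (Q.cl (Q.r X t) u e)) ≫ Q.convι F G X t := by
  rw [convι_convHom_right, ← whiskerLeft_comp_assoc, ← whiskerLeft_comp_assoc,
    ← whiskerLeft_comp_assoc, Category.assoc, Category.assoc, unitι_convLeftUnitor_hom,
    Iso.inv_hom_id_assoc, tmap₂_tens, CategoryTheory.Functor.map_id, id_tensorHom]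

lemma convAssoc_triangle (hQ : Q.Triangle) :
    (Q.convAssoc F Q.convUnit G).hom ≫ Q.convHom (𝟙 F) (Q.convLeftUnitor G).hom =
      Q.convHom (Q.convRightUnitor F).hom (𝟙 G) := by
  refine linFun_ext fun X => Q.conv_ext fun p => Q.conv_ext_right fun q =>
    leftDistributor_whiskerRight_ext (J := Q.eidx _) (A := fun _ => 𝟙_ C) fun e => ?_
  change ((F.obj.obj _ ◁ Q.unitι _ e) ▷ G.obj.obj _) ≫ _ =
    ((F.obj.obj _ ◁ Q.unitι _ e) ▷ G.obj.obj _) ≫ _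
  rw [linFun_comp_app, convι_convAssoc_hom_assoc, convι_convHom_left, ← comp_whiskerRight_assoc,
    ← comp_whiskerRight_assoc, Category.assoc, unitι_convRightUnitor_hom]
  have h := fun t => congrArg (fun c => tmap₂ F G c ≫ Q.convι F G X t) (hQ X p q e t)
  simp only [map_sum, tmap₂_comp, Preadditive.sum_comp, Category.assoc] at h
  simp only [Preadditive.comp_sum, Preadditive.sum_comp, Category.assoc,
    associator_naturality_middle_assoc, reassoc_of% tmap₃_unitι, unitι_convHom_convLeftUnitor]
  -- The triangle of `I` holds for each target `t`; summing over `t` leaves only `t = p`. The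
  -- triangle of `C` then accounts for the remaining associator and unitors.
  simp only [← Preadditive.comp_sum, h, sum_tmap₂_id]
  rw [tmap₂_tens, CategoryTheory.Functor.map_id, tensorHom_id, comp_whiskerRight, Category.assoc,
    triangle_assoc]

end Triangle

end CoalgebraData

end KMat

end

/-! ### Permutations of tensor factors, naturality of the braiding and the hexagons -/

noncomputable section

namespace KMat

open MonoidalCategory

set_option linter.unusedSectionVars false

/-- Brings the target indices outermost on the side of the hexagon with two associators and one
braiding; `sum_hexagon_comm` does so for the side with two braidings. -/
lemma sum_quadruple_comm {M : Type*} [AddCommMonoid M] {A A' : Type} [Fintype A] [Fintype A']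
    {B : A → Type} [∀ a, Fintype (B a)] {B' : A' → Type} [∀ a, Fintype (B' a)] {T : Type}
    [Fintype T] {U : T → Type} [∀ t, Fintype (U t)]
    (f : ∀ a (_ : B a) a' (_ : B' a') t (_ : U t), M) :
    ∑ a, ∑ b, ∑ a', ∑ b', ∑ t, ∑ u, f a b a' b' t u =
      ∑ t, ∑ u, ∑ a, ∑ b, ∑ a', ∑ b', f a b a' b' t u := by
  have h : ∀ {A T : Type} [Fintype A] [Fintype T] {B : A → Type} [∀ a, Fintype (B a)]
      (g : ∀ a (_ : B a) (_ : T), M), ∑ a, ∑ b, ∑ t, g a b t = ∑ t, ∑ a, ∑ b, g a b t := by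
    intro A T _ _ B _ g
    rw [Finset.sum_comm (s := (Finset.univ : Finset T))]
    exact Finset.sum_congr rfl fun a _ => Finset.sum_comm
  calc _ = ∑ a, ∑ b, ∑ t, ∑ u, ∑ a', ∑ b', f a b a' b' t u :=
        Finset.sum_congr rfl fun a _ => Finset.sum_congr rfl fun b _ => by
          rw [h]
          exact Finset.sum_congr rfl fun t _ => h _
    _ = _ := by
          rw [h]
          exact Finset.sum_congr rfl fun t _ => h _

lemma sum_hexagon_comm {M : Type*} [AddCommMonoid M] {A : Type} [Fintype A] {T : Type}
    [Fintype T] {U U' : T → Type} [∀ t, Fintype (U t)] [∀ t, Fintype (U' t)]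
    (f : ∀ (_ : A) t (_ : U' t) (_ : U t), M) :
    ∑ a, ∑ t, ∑ u', ∑ u, f a t u' u = ∑ t, ∑ u, ∑ a, ∑ u', f a t u' u := by
  rw [Finset.sum_comm]
  refine Finset.sum_congr rfl fun t _ => ?_
  rw [Finset.sum_comm (t := (Finset.univ : Finset A))]
  exact Finset.sum_congr rfl fun a _ => Finset.sum_comm

/-- The forward hexagon of `C`, solved for the braiding past a product. -/
lemma braiding_associator {C : Type u₁} [Category.{v₁} C] [MonoidalCategory C] [BraidedCategory C]
    (X Y Z : C) : (β_ X (Y ⊗ Z)).hom ≫ (α_ Y Z X).hom =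
      (α_ X Y Z).inv ≫ ((β_ X Y).hom ▷ Z) ≫ (α_ Y X Z).hom ≫ (Y ◁ (β_ X Z).hom) := by
  rw [Iso.eq_inv_comp, BraidedCategory.hexagon_forward]

lemma braiding_associator_assoc {C : Type u₁} [Category.{v₁} C] [MonoidalCategory C] [BraidedCategory C]
    (X Y Z : C) {T : C}
    (h' : _ ⟶ T) :
    (β_ X (Y ⊗ Z)).hom ≫ (α_ Y Z X).hom ≫ h' =
      (α_ X Y Z).inv ≫ ((β_ X Y).hom ▷ Z) ≫ (α_ Y X Z).hom ≫ (Y ◁ (β_ X Z).hom) ≫ h' := by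
  rw [reassoc_of% braiding_associator]

section Permutations

variable {k : Type w} [CommRing k]
variable {I : Type u₁} [Category.{v₁} I] [Preadditive I] [Linear k I]
variable {x x' y y' z z' : I}

lemma Box.rot_zero :
    Box.rot (0 : (⟨x, ⟨y, z⟩⟩ : Box k I (Box k I I)) ⟶ ⟨x', ⟨y', z'⟩⟩) = 0 :=
  (Box.swap k I (Box k I I) ⋙ Box.assoc k I I I).map_zero _ _

lemma Box.rot_add (a b : (⟨x, ⟨y, z⟩⟩ : Box k I (Box k I I)) ⟶ ⟨x', ⟨y', z'⟩⟩) :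
    Box.rot (a + b) = Box.rot a + Box.rot b :=
  (Box.swap k I (Box k I I) ⋙ Box.assoc k I I I).map_add

lemma Box.rot_tens (f : x ⟶ x') (g : y ⟶ y') (h : z ⟶ z') :
    Box.rot (Box.tens k f (Box.tens k g h)) = Box.tens k g (Box.tens k h f) := rfl

lemma Box.swap₂₃_zero :
    Box.swap₂₃ (0 : (⟨x, ⟨y, z⟩⟩ : Box k I (Box k I I)) ⟶ ⟨x', ⟨y', z'⟩⟩) = 0 :=
  (Box.map k (𝟭 I) (Box.swap k I I)).map_zero _ _

lemma Box.swap₂₃_add (a b : (⟨x, ⟨y, z⟩⟩ : Box k I (Box k I I)) ⟶ ⟨x', ⟨y', z'⟩⟩) :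
    Box.swap₂₃ (a + b) = Box.swap₂₃ a + Box.swap₂₃ b :=
  (Box.map k (𝟭 I) (Box.swap k I I)).map_add

lemma Box.swap₂₃_tens (f : x ⟶ x') (g : y ⟶ y') (h : z ⟶ z') :
    Box.swap₂₃ (Box.tens k f (Box.tens k g h)) = Box.tens k f (Box.tens k h g) := rfl

lemma Box.swap₁₂_zero :
    Box.swap₁₂ (0 : (⟨x, ⟨y, z⟩⟩ : Box k I (Box k I I)) ⟶ ⟨x', ⟨y', z'⟩⟩) = 0 := by
  rw [Box.swap₁₂, Box.rot_zero, Box.swap₂₃_zero]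

lemma Box.swap₁₂_add (a b : (⟨x, ⟨y, z⟩⟩ : Box k I (Box k I I)) ⟶ ⟨x', ⟨y', z'⟩⟩) :
    Box.swap₁₂ (a + b) = Box.swap₁₂ a + Box.swap₁₂ b := by
  rw [Box.swap₁₂, Box.rot_add, Box.swap₂₃_add]
  rfl

lemma Box.swap₁₂_tens (f : x ⟶ x') (g : y ⟶ y') (h : z ⟶ z') :
    Box.swap₁₂ (Box.tens k f (Box.tens k g h)) = Box.tens k g (Box.tens k f h) := rfl

variable {C : Type u₂} [Category.{v₂} C] [Preadditive C] [Linear k C]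
variable [MonoidalCategory C] [MonoidalPreadditive C] [MonoidalLinear k C] [BraidedCategory C]
variable (F G K : LinFun k I C)

/-- Two rotations carry the last slot to the front, and the braiding followed by the associator
undoes this in `C`. On pure tensors it is naturality of both. -/
lemma tmap₃_rot_rot (c : (⟨x, ⟨y, z⟩⟩ : Box k I (Box k I I)) ⟶ ⟨x', ⟨y', z'⟩⟩) :
    tmap₃ K F G (Box.rot (Box.rot c)) ≫ (β_ _ _).hom ≫ (α_ _ _ _).hom =
      (β_ _ _).hom ≫ (α_ _ _ _).hom ≫ tmap₃ F G K c := by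
  induction c using Box.induction₃ with
  | zero => simp [Box.rot_zero]
  | add a b ha hb =>
    simp only [Box.rot_add, map_add, Preadditive.add_comp, Preadditive.comp_add, ha, hb]
  | tens f g h =>
    rw [Box.rot_tens, Box.rot_tens, tmap₃_tens, tmap₃_tens, tmap₂_tens, tmap₂_tens,
      BraidedCategory.braiding_naturality_assoc, associator_naturality]

lemma tmap₃_rot_rot_assoc (c : (⟨x, ⟨y, z⟩⟩ : Box k I (Box k I I)) ⟶ ⟨x', ⟨y', z'⟩⟩) {T : C}
    (h' : _ ⟶ T) :
    tmap₃ K F G (Box.rot (Box.rot c)) ≫ (β_ _ _).hom ≫ (α_ _ _ _).hom ≫ h' =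
      (β_ _ _).hom ≫ (α_ _ _ _).hom ≫ tmap₃ F G K c ≫ h' := by
  rw [reassoc_of% tmap₃_rot_rot]

lemma tmap₃_rot (c : (⟨x, ⟨y, z⟩⟩ : Box k I (Box k I I)) ⟶ ⟨x', ⟨y', z'⟩⟩) :
    tmap₃ G K F (Box.rot c) ≫ (α_ _ _ _).inv ≫ (β_ _ _).hom =
      (α_ _ _ _).inv ≫ (β_ _ _).hom ≫ tmap₃ F G K c := by
  induction c using Box.induction₃ with
  | zero => simp [Box.rot_zero]
  | add a b ha hb =>
    simp only [Box.rot_add, map_add, Preadditive.add_comp, Preadditive.comp_add, ha, hb]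
  | tens f g h =>
    rw [Box.rot_tens, tmap₃_tens, tmap₃_tens, tmap₂_tens, tmap₂_tens,
      associator_inv_naturality_assoc, BraidedCategory.braiding_naturality]

lemma tmap₃_rot_assoc (c : (⟨x, ⟨y, z⟩⟩ : Box k I (Box k I I)) ⟶ ⟨x', ⟨y', z'⟩⟩) {T : C}
    (h' : _ ⟶ T) :
    tmap₃ G K F (Box.rot c) ≫ (α_ _ _ _).inv ≫ (β_ _ _).hom ≫ h' =
      (α_ _ _ _).inv ≫ (β_ _ _).hom ≫ tmap₃ F G K c ≫ h' := by
  rw [reassoc_of% tmap₃_rot]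

/-- Exchanging the first two slots in `I` is matched by braiding them in `C`, with the brackets
moved to make them adjacent. -/
lemma tmap₃_swap₁₂ (c : (⟨x, ⟨y, z⟩⟩ : Box k I (Box k I I)) ⟶ ⟨x', ⟨y', z'⟩⟩) :
    tmap₃ G F K (Box.swap₁₂ c) ≫ (α_ _ _ _).inv ≫ ((β_ _ _).hom ▷ _) ≫ (α_ _ _ _).hom =
      (α_ _ _ _).inv ≫ ((β_ _ _).hom ▷ _) ≫ (α_ _ _ _).hom ≫ tmap₃ F G K c := by
  induction c using Box.induction₃ with
  | zero => simp [Box.swap₁₂_zero]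
  | add a b ha hb =>
    simp only [Box.swap₁₂_add, map_add, Preadditive.add_comp, Preadditive.comp_add, ha, hb]
  | tens f g h =>
    rw [Box.swap₁₂_tens, tmap₃_tens, tmap₃_tens, tmap₂_tens, tmap₂_tens,
      associator_inv_naturality_assoc, ← associator_naturality, ← tensorHom_id, ← tensorHom_id,
      tensorHom_comp_tensorHom_assoc, tensorHom_comp_tensorHom_assoc,
      BraidedCategory.braiding_naturality, Category.id_comp, Category.comp_id]

lemma tmap₃_swap₁₂_assoc (c : (⟨x, ⟨y, z⟩⟩ : Box k I (Box k I I)) ⟶ ⟨x', ⟨y', z'⟩⟩) {T : C}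
    (h' : _ ⟶ T) :
    tmap₃ G F K (Box.swap₁₂ c) ≫ (α_ _ _ _).inv ≫ ((β_ _ _).hom ▷ _) ≫ (α_ _ _ _).hom ≫ h' =
      (α_ _ _ _).inv ≫ ((β_ _ _).hom ▷ _) ≫ (α_ _ _ _).hom ≫ tmap₃ F G K c ≫ h' := by
  rw [reassoc_of% tmap₃_swap₁₂]

lemma tmap₃_swap₂₃ (c : (⟨x, ⟨y, z⟩⟩ : Box k I (Box k I I)) ⟶ ⟨x', ⟨y', z'⟩⟩) :
    tmap₃ F K G (Box.swap₂₃ c) ≫ (_ ◁ (β_ _ _).hom) = (_ ◁ (β_ _ _).hom) ≫ tmap₃ F G K c := by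
  induction c using Box.induction₃ with
  | zero => simp [Box.swap₂₃_zero]
  | add a b ha hb =>
    simp only [Box.swap₂₃_add, map_add, Preadditive.add_comp, Preadditive.comp_add, ha, hb]
  | tens f g h =>
    rw [Box.swap₂₃_tens, tmap₃_tens, tmap₃_tens, tmap₂_tens, tmap₂_tens, ← id_tensorHom,
      ← id_tensorHom, tensorHom_comp_tensorHom, tensorHom_comp_tensorHom,
      BraidedCategory.braiding_naturality, Category.id_comp, Category.comp_id]

lemma tmap₃_swap₂₃_assoc (c : (⟨x, ⟨y, z⟩⟩ : Box k I (Box k I I)) ⟶ ⟨x', ⟨y', z'⟩⟩) {T : C}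
    (h' : _ ⟶ T) :
    tmap₃ F K G (Box.swap₂₃ c) ≫ (_ ◁ (β_ _ _).hom) ≫ h' =
      (_ ◁ (β_ _ _).hom) ≫ tmap₃ F G K c ≫ h' := by
  rw [reassoc_of% tmap₃_swap₂₃]

lemma tmap₂_whiskerRight_associator (c : (⟨x, y⟩ : Box k I I) ⟶ ⟨x', y'⟩) (z : I) :
    (tmap₂ F G c ▷ K.obj.obj z) ≫ (α_ _ _ _).hom =
      (α_ _ _ _).hom ≫ tmap₃ F G K (Box.homAssoc (Box.tens k c (𝟙 z))) := by
  rw [tmap₃_homAssoc, Iso.hom_inv_id_assoc, CategoryTheory.Functor.map_id, tensorHom_id]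

lemma tmap₂_whiskerRight_associator_assoc (c : (⟨x, y⟩ : Box k I I) ⟶ ⟨x', y'⟩) (z : I) {T : C}
    (h' : _ ⟶ T) :
    (tmap₂ F G c ▷ K.obj.obj z) ≫ (α_ _ _ _).hom ≫ h' =
      (α_ _ _ _).hom ≫ tmap₃ F G K (Box.homAssoc (Box.tens k c (𝟙 z))) ≫ h' := by
  rw [reassoc_of% tmap₂_whiskerRight_associator]

lemma associator_inv_tmap₂_whiskerRight (c : (⟨x, y⟩ : Box k I I) ⟶ ⟨x', y'⟩) (z : I) :
    (α_ _ _ _).inv ≫ (tmap₂ F G c ▷ K.obj.obj z) =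
      tmap₃ F G K (Box.homAssoc (Box.tens k c (𝟙 z))) ≫ (α_ _ _ _).inv := by
  rw [Iso.inv_comp_eq, ← tmap₂_whiskerRight_associator_assoc, Iso.hom_inv_id, Category.comp_id]

lemma associator_inv_tmap₂_whiskerRight_assoc (c : (⟨x, y⟩ : Box k I I) ⟶ ⟨x', y'⟩) (z : I) {T : C}
    (h' : _ ⟶ T) :
    (α_ _ _ _).inv ≫ (tmap₂ F G c ▷ K.obj.obj z) ≫ h' =
      tmap₃ F G K (Box.homAssoc (Box.tens k c (𝟙 z))) ≫ (α_ _ _ _).inv ≫ h' := by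
  rw [reassoc_of% associator_inv_tmap₂_whiskerRight]

end Permutations

namespace CoalgebraData

variable {k : Type w} [CommRing k]
variable {I : Type u₁} [Category.{v₁} I] [Preadditive I] [Linear k I]
variable {C : Type u₂} [Category.{v₂} C] [Preadditive C] [Linear k C]
variable [MonoidalCategory C] [MonoidalPreadditive C] [MonoidalLinear k C]
variable [HasFiniteBiproducts C] [BraidedCategory C]
variable (Q : CoalgebraData k I) (R : Q.Δ ≅ Q.Δop)

/-- For each entry of `R`: evaluation is natural in both functors, and the braiding of `C` is
natural. -/
lemma convBraiding_naturality {F F' G G' : LinFun k I C} (φ : F ⟶ F') (χ : G ⟶ G') :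
    Q.convHom φ χ ≫ (Q.convBraiding F' G' R).hom =
      (Q.convBraiding F G R).hom ≫ Q.convHom χ φ :=
  linFun_ext fun X => Q.conv_ext fun p => by
    rw [linFun_comp_app, linFun_comp_app, reassoc_of% convι_convHom, convι_convBraiding_hom,
      reassoc_of% convι_convBraiding_hom]
    simp only [Preadditive.comp_sum, Preadditive.sum_comp, Category.assoc]
    refine Finset.sum_congr rfl fun q _ => ?_
    rw [convι_convHom, ← reassoc_of% tmap₂_naturality, BraidedCategory.braiding_naturality_assoc]

variable (F G K : LinFun k I C)

/-- Braiding past the product `G ⊗ K` applies `id ⊠ Δ` to `R`. This is the left-hand side of the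
first dual hexagon identity. -/
lemma convι_convBraiding_right (X : I) (p : Q.idx X) (q : Q.idx (Q.r X p)) :
    (F.obj.obj _ ◁ Q.convι G K _ q) ≫ Q.convι F (Q.conv G K) X p ≫
      (Q.convBraiding F (Q.conv G K) R).hom.hom.app X =
        ∑ t, ∑ u, tmap₃ F G K (Q.comulSnd q u (Q.R₂ R X p t)) ≫ (β_ _ _).hom ≫
          (Q.convι G K _ u ▷ F.obj.obj _) ≫ Q.convι (Q.conv G K) F X t := by
  rw [convι_convBraiding_hom]
  simp only [Preadditive.comp_sum, reassoc_of% tmap₂_convι, Preadditive.sum_comp, Category.assoc,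
    BraidedCategory.braiding_naturality_right_assoc]

lemma convι_convBraiding_right_assoc (X : I) (p : Q.idx X) (q : Q.idx (Q.r X p)) {T : C}
    (h' : _ ⟶ T) :
    (F.obj.obj _ ◁ Q.convι G K _ q) ≫ Q.convι F (Q.conv G K) X p ≫
      (Q.convBraiding F (Q.conv G K) R).hom.hom.app X ≫ h' =
      (∑ t, ∑ u, tmap₃ F G K (Q.comulSnd q u (Q.R₂ R X p t)) ≫ (β_ _ _).hom ≫
          (Q.convι G K _ u ▷ F.obj.obj _) ≫ Q.convι (Q.conv G K) F X t) ≫ h' := by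
  rw [reassoc_of% convι_convBraiding_right]

/-- Mirror image, with `Δ ⊠ id` applied to `R`; the leading inverse associator is the one in which
the inverse associator formula ends. -/
lemma convι_convBraiding_left (X : I) (p : Q.idx X) (q : Q.idx (Q.l X p)) :
    (α_ _ _ _).inv ≫ (Q.convι F G _ q ▷ K.obj.obj _) ≫ Q.convι (Q.conv F G) K X p ≫
      (Q.convBraiding (Q.conv F G) K R).hom.hom.app X =
        ∑ t, ∑ u, tmap₃ F G K (Q.comulFst q u (Q.R₂ R X p t)) ≫ (α_ _ _ _).inv ≫
          (β_ _ _).hom ≫ (K.obj.obj _ ◁ Q.convι F G _ u) ≫ Q.convι K (Q.conv F G) X t := by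
  rw [convι_convBraiding_hom]
  simp only [Preadditive.comp_sum, reassoc_of% convι_tmap₂, Preadditive.sum_comp, Category.assoc,
    BraidedCategory.braiding_naturality_left_assoc, Iso.inv_hom_id_assoc]

lemma convι_convBraiding_left_assoc (X : I) (p : Q.idx X) (q : Q.idx (Q.l X p)) {T : C}
    (h' : _ ⟶ T) :
    (α_ _ _ _).inv ≫ (Q.convι F G _ q ▷ K.obj.obj _) ≫ Q.convι (Q.conv F G) K X p ≫
      (Q.convBraiding (Q.conv F G) K R).hom.hom.app X ≫ h' =
      (∑ t, ∑ u, tmap₃ F G K (Q.comulFst q u (Q.R₂ R X p t)) ≫ (α_ _ _ _).inv ≫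
          (β_ _ _).hom ≫ (K.obj.obj _ ◁ Q.convι F G _ u) ≫ Q.convι K (Q.conv F G) X t) ≫ h' := by
  rw [reassoc_of% convι_convBraiding_left]

lemma convι_convHom_convBraiding_left (X : I) (p : Q.idx X) (q : Q.idx (Q.l X p)) :
    (Q.convι F G _ q ▷ K.obj.obj _) ≫ Q.convι (Q.conv F G) K X p ≫
      (Q.convHom (Q.convBraiding F G R).hom (𝟙 K)).hom.app X =
        ∑ u, (tmap₂ F G (Q.R₂ R _ q u) ▷ K.obj.obj _) ≫ ((β_ _ _).hom ▷ K.obj.obj _) ≫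
          (Q.convι G F _ u ▷ K.obj.obj _) ≫ Q.convι (Q.conv G F) K X p := by
  rw [convι_convHom_left, ← comp_whiskerRight_assoc, convι_convBraiding_hom]
  simp only [sum_whiskerRight, comp_whiskerRight, Preadditive.sum_comp, Category.assoc]

lemma convι_convHom_convBraiding_left_assoc (X : I) (p : Q.idx X) (q : Q.idx (Q.l X p)) {T : C}
    (h' : _ ⟶ T) :
    (Q.convι F G _ q ▷ K.obj.obj _) ≫ Q.convι (Q.conv F G) K X p ≫
      (Q.convHom (Q.convBraiding F G R).hom (𝟙 K)).hom.app X ≫ h' =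
      (∑ u, (tmap₂ F G (Q.R₂ R _ q u) ▷ K.obj.obj _) ≫ ((β_ _ _).hom ▷ K.obj.obj _) ≫
          (Q.convι G F _ u ▷ K.obj.obj _) ≫ Q.convι (Q.conv G F) K X p) ≫ h' := by
  rw [reassoc_of% convι_convHom_convBraiding_left]

lemma convι_convHom_convBraiding_right (X : I) (p : Q.idx X) (q : Q.idx (Q.r X p)) :
    (F.obj.obj _ ◁ Q.convι G K _ q) ≫ Q.convι F (Q.conv G K) X p ≫
      (Q.convHom (𝟙 F) (Q.convBraiding G K R).hom).hom.app X =
        ∑ u, tmap₃ F G K (Box.tens k (𝟙 _) (Q.R₂ R _ q u)) ≫ (F.obj.obj _ ◁ (β_ _ _).hom) ≫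
          (F.obj.obj _ ◁ Q.convι K G _ u) ≫ Q.convι F (Q.conv K G) X p := by
  rw [convι_convHom_right, ← whiskerLeft_comp_assoc, convι_convBraiding_hom]
  simp only [whiskerLeft_sum, whiskerLeft_comp, Preadditive.sum_comp, Category.assoc,
    whiskerLeft_tmap₂]

lemma convι_convHom_convBraiding_right_assoc (X : I) (p : Q.idx X) (q : Q.idx (Q.r X p)) {T : C}
    (h' : _ ⟶ T) :
    (F.obj.obj _ ◁ Q.convι G K _ q) ≫ Q.convι F (Q.conv G K) X p ≫
      (Q.convHom (𝟙 F) (Q.convBraiding G K R).hom).hom.app X ≫ h' =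
      (∑ u, tmap₃ F G K (Box.tens k (𝟙 _) (Q.R₂ R _ q u)) ≫ (F.obj.obj _ ◁ (β_ _ _).hom) ≫
          (F.obj.obj _ ◁ Q.convι K G _ u) ≫ Q.convι F (Q.conv K G) X p) ≫ h' := by
  rw [reassoc_of% convι_convHom_convBraiding_right]

lemma convBraiding_hexagon_forward (hR : Q.Hexagon₁ R) :
    (Q.convAssoc F G K).hom ≫ (Q.convBraiding F (Q.conv G K) R).hom ≫ (Q.convAssoc G K F).hom =
      Q.convHom (Q.convBraiding F G R).hom (𝟙 K) ≫ (Q.convAssoc G F K).hom ≫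
        Q.convHom (𝟙 G) (Q.convBraiding F K R).hom := by
  refine linFun_ext fun X => Q.conv_ext fun p => Q.conv_ext_right fun q => ?_
  rw [linFun_comp_app, linFun_comp_app, linFun_comp_app, linFun_comp_app,
    convι_convAssoc_hom_assoc, convι_convHom_convBraiding_left_assoc]
  simp only [Preadditive.comp_sum, Preadditive.sum_comp, Category.assoc,
    convι_convBraiding_right_assoc, convι_convAssoc_hom, convι_convAssoc_hom_assoc,
    convι_convHom_convBraiding_right]
  rw [sum_quadruple_comm, sum_hexagon_comm]
  refine Finset.sum_congr rfl fun t _ => Finset.sum_congr rfl fun u _ => ?_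
  -- The first dual hexagon for a fixed target summand, evaluated in `C`. The double rotation of the
  -- second `a` is then absorbed by moving it past the braiding and the associator.
  have h := congrArg (fun c => (α_ _ _ _).hom ≫ tmap₃ F G K c ≫ (β_ _ _).hom ≫ (α_ _ _ _).hom ≫
    (G.obj.obj _ ◁ Q.convι K F _ u) ≫ Q.convι G _ X t) (hR X p q t u)
  simp only [map_sum, tmap₃_comp, Preadditive.comp_sum, Preadditive.sum_comp, Category.assoc,
    tmap₃_rot_rot_assoc] at h
  rw [h]
  refine Finset.sum_congr rfl fun q₁ _ => Finset.sum_congr rfl fun u₁ _ => ?_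
  -- The hexagon of `C` splits the braiding. Its first half is carried leftwards past `id ⊗ R` and
  -- then past `a`, removing both transpositions, until it stands right after `R ⊗ id`.
  rw [braiding_associator_assoc, tmap₃_swap₁₂_assoc, tmap₃_swap₁₂_assoc,
    ← tmap₂_whiskerRight_associator_assoc, Iso.hom_inv_id_assoc]

lemma convBraiding_hexagon_reverse (hR : Q.Hexagon₂ R) :
    (Q.convAssoc F G K).inv ≫ (Q.convBraiding (Q.conv F G) K R).hom ≫ (Q.convAssoc K F G).inv =
      Q.convHom (𝟙 F) (Q.convBraiding G K R).hom ≫ (Q.convAssoc F K G).inv ≫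
        Q.convHom (Q.convBraiding F K R).hom (𝟙 G) := by
  refine linFun_ext fun X => Q.conv_ext fun p => Q.conv_ext_left fun q => ?_
  rw [linFun_comp_app, linFun_comp_app, linFun_comp_app, linFun_comp_app,
    convι_convAssoc_inv_assoc, convι_convHom_convBraiding_right_assoc]
  simp only [Preadditive.comp_sum, Preadditive.sum_comp, Category.assoc,
    convι_convBraiding_left_assoc, convι_convAssoc_inv, convι_convAssoc_inv_assoc,
    convι_convHom_convBraiding_left]
  rw [sum_quadruple_comm, sum_hexagon_comm]
  refine Finset.sum_congr rfl fun t _ => Finset.sum_congr rfl fun u _ => ?_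
  have h := congrArg (fun c => tmap₃ F G K c ≫ (α_ _ _ _).inv ≫ (β_ _ _).hom ≫ (α_ _ _ _).inv ≫
    (Q.convι K F _ u ▷ G.obj.obj _) ≫ Q.convι _ G X t) (hR X p q t u)
  simp only [map_sum, tmap₃_comp, Preadditive.sum_comp, Category.assoc, tmap₃_rot_assoc] at h
  rw [h]
  refine Finset.sum_congr rfl fun q₁ _ => Finset.sum_congr rfl fun u₁ _ => ?_
  -- The same argument with the reverse hexagon of `C`, the first braiding now exchanging the last
  -- two slots.
  rw [BraidedCategory.hexagon_reverse_assoc, tmap₃_swap₂₃_assoc, tmap₃_swap₂₃_assoc,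
    associator_inv_tmap₂_whiskerRight_assoc]

end CoalgebraData

end KMat

end

/-! ### The monoidal axioms, and inheritance of the factor and exactness properties -/

noncomputable section

namespace KMat

open MonoidalCategory

namespace CoalgebraCategory

variable {k : Type w} [CommRing k]
variable {I : Type u₁} [Category.{v₁} I] [Preadditive I] [Linear k I]
variable {C : Type u₂} [Category.{v₂} C] [Preadditive C] [Linear k C]
variable [MonoidalCategory C] [MonoidalPreadditive C] [MonoidalLinear k C]
variable [HasFiniteBiproducts C]
variable (Q : CoalgebraCategory k I)

/-- The convolution product on linear functors satisfies the axioms of a monoidal category. -/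
lemma isMonoidal_conv : IsMonoidal (Q.convStruct (C := C) Q.convAssoc Q.convLeftUnitor
    Q.convRightUnitor) where
  tensorHom_def φ χ := by
    refine Eq.trans ?_ (Q.convHom_comp _ _ _ _).symm
    rw [Category.comp_id, Category.id_comp]
    rfl
  id_tensorHom_id F G := Q.convHom_id
  tensorHom_comp_tensorHom φ χ φ' χ' := Q.convHom_comp _ _ _ _
  whiskerLeft_id F G := Q.convHom_id
  id_whiskerRight F G := Q.convHom_id
  associator_naturality φ χ ψ := Q.convAssoc_naturality φ χ ψ
  leftUnitor_naturality φ := Q.convLeftUnitor_naturality φ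
  rightUnitor_naturality φ := Q.convRightUnitor_naturality φ
  pentagon F G H K := Q.convAssoc_pentagon F G H K Q.pentagon
  triangle F G := Q.convAssoc_triangle F G Q.triangle

end CoalgebraCategory

section Exactness

variable {k : Type w} [CommRing k]
variable {I : Type u₁} [Category.{v₁} I] [Preadditive I] [Linear k I]
variable {C : Type u₂} [Category.{v₂} C] [Abelian C] [Linear k C]
variable [MonoidalCategory C] [MonoidalPreadditive C] [MonoidalLinear k C]

namespace CoalgebraData

variable (Q : CoalgebraData k I) {F F' G G' : LinFun k I C}

/-- At `X` the map is a direct sum of tensor products of epimorphisms of `C`. -/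
lemma convHom_epi (hC : TensorFactor C) (φ : F ⟶ F') (χ : G ⟶ G') [Epi φ] [Epi χ] :
    Epi (Q.convHom φ χ) :=
  epi_of_epi_app _ fun X => by
    rw [convHom_app]
    exact biproduct_map_epi _ fun p => hC.1 _ _ (epi_app φ _) (epi_app χ _)

lemma convHom_mono (hC : TensorFactor C) (φ : F ⟶ F') (χ : G ⟶ G') [Mono φ] [Mono χ] :
    Mono (Q.convHom φ χ) :=
  mono_of_mono_app _ fun X => by
    rw [convHom_app]
    exact biproduct_map_mono _ fun p => hC.2 _ _ (mono_app φ _) (mono_app χ _)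

/-- At `X` the square is the direct sum, over the pairs in `Δ X`, of the pushout squares that
exactness of `C` provides. -/
lemma convHom_isPushout (hC : TensorExact C) (φ : F ⟶ F') (χ : G ⟶ G') [Epi φ] [Epi χ] :
    IsPushout (Q.convHom φ (𝟙 G)) (Q.convHom (𝟙 F) χ) (Q.convHom (𝟙 F') χ)
      (Q.convHom φ (𝟙 G')) :=
  isPushout_of_app fun X => by
    simp only [convHom_app, linFun_id_app, id_tensorHom, tensorHom_id]
    exact biproduct_isPushout fun p => hC.1 _ _ (epi_app φ _) (epi_app χ _)

lemma convHom_isPullback (hC : TensorExact C) (φ : F ⟶ F') (χ : G ⟶ G') [Mono φ] [Mono χ] :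
    IsPullback (Q.convHom φ (𝟙 G)) (Q.convHom (𝟙 F) χ) (Q.convHom (𝟙 F') χ)
      (Q.convHom φ (𝟙 G')) :=
  isPullback_of_app fun X => by
    simp only [convHom_app, linFun_id_app, id_tensorHom, tensorHom_id]
    exact biproduct_isPullback fun p => hC.2 _ _ (mono_app φ _) (mono_app χ _)

end CoalgebraData

end Exactness

end KMat

end

theorem mainTheorem9 (k : Type w) [CommRing k]
    (I : Type u₁) [Category.{v₁} I] [Preadditive I] [Linear k I]
    (Q : KMat.QuasitriangularCoalgebraCategory k I)
    (C : Type u₂) [Category.{v₂} C] [Abelian C] [Linear k C]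
    [MonoidalCategory C] [MonoidalPreadditive C] [MonoidalLinear k C] [BraidedCategory C] :
    (∃ A : Abelian (KMat.LinFun k I C),
      A.toPreadditive = Preadditive.fullSubcategory (KMat.isLinear k I C)) ∧
    ∃ (assoc : ∀ F G K : KMat.LinFun k I C, Q.conv (Q.conv F G) K ≅ Q.conv F (Q.conv G K))
      (lam : ∀ F : KMat.LinFun k I C, Q.conv Q.convUnit F ≅ F)
      (rho : ∀ F : KMat.LinFun k I C, Q.conv F Q.convUnit ≅ F)
      (braid : ∀ F G : KMat.LinFun k I C, Q.conv F G ≅ Q.conv G F)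
      (hM : KMat.IsMonoidal (Q.convStruct assoc lam rho)),
      Q.IsAssociator assoc ∧ Q.IsLeftUnitor lam ∧ Q.IsRightUnitor rho ∧ Q.IsBraiding Q.R braid ∧
      letI : MonoidalCategory (KMat.LinFun k I C) := hM.toMonoidalCategory
      (∃ _ : MonoidalPreadditive (KMat.LinFun k I C), MonoidalLinear k (KMat.LinFun k I C)) ∧
      (∃ B : BraidedCategory (KMat.LinFun k I C), B.braiding = braid) ∧
      (KMat.TensorFactor C → KMat.TensorFactor (KMat.LinFun k I C)) ∧
      (KMat.TensorExact C → KMat.TensorExact (KMat.LinFun k I C)) := by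
  refine ⟨⟨KMat.linFunAbelian k I C, KMat.linFunAbelian_toPreadditive k I C⟩, Q.convAssoc,
    Q.convLeftUnitor, Q.convRightUnitor, fun F G => Q.convBraiding F G Q.R, Q.isMonoidal_conv,
    Q.isAssociator_convAssoc, fun F X p e => Q.unitι_convLeftUnitor_hom F X p e,
    fun F X p e => Q.unitι_convRightUnitor_hom F X p e, Q.isBraiding_convBraiding Q.R, ?_⟩
  let : MonoidalCategory (KMat.LinFun k I C) := Q.isMonoidal_conv.toMonoidalCategory
  have hP : MonoidalPreadditive (KMat.LinFun k I C) :=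
    { whiskerLeft_zero := Q.convHom_zero _
      zero_whiskerRight := Q.zero_convHom _
      whiskerLeft_add := Q.convHom_add _
      add_whiskerRight := fun φ χ => Q.add_convHom φ χ _ }
  refine ⟨⟨hP, ?_⟩, ⟨?_, ?_⟩, ?_, ?_⟩
  · exact
      { whiskerLeft_smul := fun F _ _ r χ => Q.convHom_smul r (𝟙 F) χ
        smul_whiskerRight := fun r _ _ φ G => Q.smul_convHom r φ (𝟙 G) }
  · exact
      { braiding := fun F G => Q.convBraiding F G Q.R
        braiding_naturality_right := fun _ _ _ χ => Q.convBraiding_naturality Q.R (𝟙 _) χ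
        braiding_naturality_left := fun φ _ => Q.convBraiding_naturality Q.R φ (𝟙 _)
        hexagon_forward := fun F G K => Q.convBraiding_hexagon_forward Q.R F G K Q.hexagon₁
        hexagon_reverse := fun F G K => Q.convBraiding_hexagon_reverse Q.R F G K Q.hexagon₂ }
  -- The braiding isomorphisms of the structure are `convBraiding` by construction.
  · rfl
  · exact fun hC => ⟨fun φ χ _ _ => Q.convHom_epi hC φ χ, fun φ χ _ _ => Q.convHom_mono hC φ χ⟩
  · exact fun hC =>
      ⟨fun φ χ _ _ => Q.convHom_isPushout hC φ χ, fun φ χ _ _ => Q.convHom_isPullback hC φ χ⟩
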